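/- **Conventions.** $\mathbb N=\{1,2,\dots\}$. Algorithms are probabilistic Turing machines (finitely many stacks, finite control, one fair coin flip per step). The running time on an input is the least $T$ such that all computation paths halt within $T$ steps, and $T_{\mathcal A}(X)$ is the supremum of the running times of $\mathcal A$ on the inputs in $X$. Inputs and outputs are written as words over finite alphabets: formulas clause by clause with variable indices in unary, networks as the list of their weight matrices and biases (one letter per weight, weights being taken from a fixed finite set), output numbers as binary fractions. *SAT.* A CNF formula is a finite list of clauses, a clause is a finite list of literals. For $k,\widetilde C_k,n\in\mathbb N$ let $\widetilde{\mathcal S}_k(n)$ be the set of CNF formulas in the variables $x_1,\dots,x_n$ with at most $k$ literals per clause and at most $\widetilde C_k n$ clauses. A decision algorithm for $k$SAT always halts on every CNF formula with at most $k$ literals per clause, decides its satisfiability correctly with probability at least $2/3$, and accepts any other word as a valid input with probability at most $1/3$. Let $$\widetilde s_k:=\inf\{s>0 : \text{there is a decision algorithm }\mathcal B\text{ for }k\text{SAT with }T_{\mathcal B}(\widetilde{\mathcal S}_k(n))=\mathcal O(2^{sn})\text{ as }n\to\infty\}.$$ *Networks.* For finite $\theta\subset\mathbb R$ let $\mathcal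 N(d,w,L,\theta)$ be the set of feed-forward networks with $d$ inputs and scalar output, with at most $L$ layers (at least one), all layer widths (including input and output) between $1$ and $w$, and all weights and biases in $\theta$; $\mathcal R_\Phi$ denotes the realization of $\Phi$ with the activation $\sigma(x)=\max\{0,x\}$ after every layer but the last. *Curve.* For $0<\delta<1/2$ let $s(t)=t/\delta$ for $t\le\delta$, $s(t)=1$ for $\delta<t\le 1-\delta$, $s(t)=1-(t-1+\delta)/\delta$ for $t>1-\delta$; let $f_1(t)=t$ and $f_{m+1}(t)=(f_m(s(t)),t)\in\mathbb R^{m+1}$. Let $\pi$ denote the coordinatewise projection of $\mathbb R$ to $[0,1]$. For $\Omega\subseteq\mathbb R^d$, $n>d$ and $z\in\{0,1\}^n$ let $$Q_z:=\Big\{x\in\Omega : \max_{1\le i\le d-1}|z_i-\pi(x_i)|\le\delta,\ \max_{d\le i\le n}\big|z_i-\pi\big(f_{n-d+1}(x_d)_{i-d+1}\big)\big|\le\delta\Big\}.$$ **Theorem.** Let $d,k,\widetilde C_k\in\mathbb N$ and $0<\delta<1/2$. Let $\theta_r\subset\mathbb R$ be finite, $\Psi\in\mathcal N(1,w_r,L_r,\theta_r)$,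 and let $r:\mathbb R\to[0,1]$ be continuous with $r=0$ on $(-\infty,1/2]$, $r=1$ on $[1-\delta,\infty)$ and $\mathcal R_\Psi=r$. Let $\theta_{\rm CNF}\subset\mathbb R$ be any finite set that contains $\theta_r$, $\{-1,0,1\}$ and all numbers $a(jb+c)+e$ with $a,b\in\theta_r$, $j\in\{0,\dots,k\}$, $c\in\{-1,0,1\}$, $e\in\theta_r\cup\{0\}$, and let $\theta_{\rm CV}\subset\mathbb R$ be any finite set that contains $\{-1,0,1,-\delta^{-1},\delta^{-1},\delta,-(1-\delta)\}$. For $n\ge d$ let $$\mathcal K(n):=\{\Phi\in\mathcal N(d,\max(2,\widetilde C_kw_rk)\,n,\,3L_r+(n-d)-1,\,\theta_{\rm CNF}\cup\theta_{\rm CV}) : 0\le\mathcal R_\Phi\le 1\text{ on }\mathbb R^d\},$$ and let $\mathcal K(n):=\mathcal K(d)$ for $0\le n<d$. 1. Let $\Omega\subseteq\mathbb R^d$ be measurable with $[0,1]^d\subseteq\Omega$, let $\mu$ be a Borel probability measure with $\mu(\Omega)=1$, and let $C>0$ be such that $\mu(Q_z)\ge C\delta^n$ for all $n>d$ and all $z\in\{0,1\}^n$.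 Let $\mathcal A$ be an algorithm such that for all $n\in\mathbb N$ and all $\Phi\in\mathcal K(n)\setminus\mathcal K(n-1)$, with probability at least $2/3$, the output satisfies $$\Big|\mathcal A(\Phi)-\int_\Omega\mathcal R_\Phi\,d\mu\Big|<\frac{C\delta^n}{2}.$$ If $T_{\mathcal A}(\mathcal K(n))=\mathcal O(2^{tn})$ as $n\to\infty$ for some $t>0$, then $t\ge\widetilde s_k$. 2. If $\Omega\subseteq\mathbb R^d$ is measurable with $[0,1]^d\subseteq\Omega$ and $|\Omega|<\infty$, then the normalized Lebesgue measure $\mu=|\cdot\cap\Omega|/|\Omega|$ satisfies the assumptions of part 1 with $C=|\Omega|^{-1}$. -/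

import Mathlib

open MeasureTheory Filter
open scoped ENNReal

namespace NNQuad

noncomputable section

/-! ### Probabilistic Turing machines and their running time -/

/-- A probabilistic multi-stack Turing machine over Mathlib's model `Turing.TM2`, with input letters
in `I` and output letters in `O`. As usual for probabilistic machines, there are two programs
`prog false` and `prog true` on the same configurations, and a fair coin decides in each step which
of them is applied. All the data is finite. The input is written on the stack `k₀`, the output is
read from the stack `k₁`. -/
structure ProbTM (I O : Type) where
  K : Type
  [decEqK : DecidableEq K]
  [fintypeK : Fintype K]
  k₀ : K
  k₁ : K
  Γ : K → Type
  [fintypeΓ : ∀ i, Fintype (Γ i)]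
  Λ : Type
  [fintypeΛ : Fintype Λ]
  main : Λ
  σ : Type
  [fintypeσ : Fintype σ]
  initialState : σ
  prog : Bool → Λ → Turing.TM2.Stmt Γ Λ σ
  inp : I → Γ k₀
  out : Γ k₁ → O

attribute [instance] ProbTM.decEqK ProbTM.fintypeK ProbTM.fintypeΓ ProbTM.fintypeΛ ProbTM.fintypeσ

namespace ProbTM

variable {I O : Type}

/-- Configurations; a configuration `c` is halted when `c.l = none`. -/
abbrev Cfg (M : ProbTM I O) : Type := Turing.TM2.Cfg M.Γ M.Λ M.σ

/-- The initial configuration: the input word is on the input stack, the other stacks are empty. -/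
def init (M : ProbTM I O) (w : List I) : M.Cfg where
  l := some M.main
  var := M.initialState
  stk := Function.update (fun _ => []) M.k₀ (w.map M.inp)

/-- One step, given the outcome of the coin; halted configurations do not change. -/
def step (M : ProbTM I O) (b : Bool) (c : M.Cfg) : M.Cfg :=
  (Turing.TM2.step (M.prog b) c).getD c

/-- The distribution of the configuration after `t` steps, with one fair coin flip per step. -/
def run (M : ProbTM I O) : ℕ → M.Cfg → PMF M.Cfg
  | 0, c => PMF.pure c
  | t + 1, c => (PMF.uniformOfFintype Bool).bind fun b => M.run t (M.step b c)

/-- The output word that is read off a configuration (from the top of the output stack). -/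
def output (M : ProbTM I O) (c : M.Cfg) : List O := (c.stk M.k₁).map M.out

/-- On input `w`, every computation path halts after at most `t` steps. -/
def HaltsWithin (M : ProbTM I O) (w : List I) (t : ℕ) : Prop :=
  ∀ c ∈ (M.run t (M.init w)).support, c.l = none

/-- The number of steps needed on input `w` (`⊤` if there is no bound). -/
def time (M : ProbTM I O) (w : List I) : ℕ∞ :=
  ⨅ (t : ℕ) (_ : M.HaltsWithin w t), (t : ℕ∞)

/-- The worst case running time on a set of inputs. -/
def worstTime (M : ProbTM I O) (X : Set (List I)) : ℕ∞ :=
  ⨆ w ∈ X, M.time w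

/-- The probability that on input `w` the machine halts with an output word in `S`. -/
def prob (M : ProbTM I O) (w : List I) (S : Set (List O)) : ℝ≥0∞ :=
  ⨆ t : ℕ, (M.run t (M.init w)).toOuterMeasure {c | c.l = none ∧ M.output c ∈ S}

end ProbTM

/-- `T(n) = O(2 ^ (t n))` as `n → ∞`. -/
def IsBigOTwoPow (T : ℕ → ℕ∞) (t : ℝ) : Prop :=
  ∃ c : ℝ, ∀ᶠ n : ℕ in atTop, ((T n : ℕ∞) : ℝ≥0∞) ≤ ENNReal.ofReal (c * (2 : ℝ) ^ (t * (n : ℝ)))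

/-! ### Formulas in conjunctive normal form -/

/-- A literal `(i, γ)`: the variable `x_i` if `γ = true`, its negation if `γ = false`.
Variables are numbered from `0`. -/
abbrev Literal : Type := ℕ × Bool

/-- A clause is given by the list of its literals. -/
abbrev Clause : Type := List Literal

/-- A formula in conjunctive normal form is given by the list of its clauses. -/
abbrev CNF : Type := List Clause

/-- The formula has a satisfying assignment. -/
def CNF.Satisfiable (α : CNF) : Prop :=
  ∃ z : ℕ → Bool, ∀ C ∈ α, ∃ l ∈ C, z l.1 = l.2

/-- Every clause has at most `k` literals. -/
def CNF.IsKCNF (k : ℕ) (α : CNF) : Prop := ∀ C ∈ α, C.length ≤ k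

/-- The formulas with at most `k` literals per clause, variables among `x_0, …, x_{n-1}` and at most
`Ct * n` clauses. -/
def sparseCNF (k Ct n : ℕ) : Set CNF :=
  {α | α.IsKCNF k ∧ (∀ C ∈ α, ∀ l ∈ C, l.1 < n) ∧ α.length ≤ Ct * n}

/-- The letters with which formulas are written. -/
inductive CNFSym : Type
  | tick
  | sign (γ : Bool)
  | clauseEnd

/-- The literal `(i, γ)` is written as `i` ticks followed by its sign. -/
def Literal.encode (l : Literal) : List CNFSym :=
  List.replicate l.1 CNFSym.tick ++ [CNFSym.sign l.2]

def Clause.encode (C : Clause) : List CNFSym :=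
  C.flatMap Literal.encode ++ [CNFSym.clauseEnd]

def CNF.encode (α : CNF) : List CNFSym := α.flatMap Clause.encode

/-- `M` is a probabilistic decision algorithm for `k`SAT: on every formula with at most `k` literals
per clause it always halts, and with probability at least `2/3` it outputs `1` or `0` according to
whether the formula is satisfiable; a word that is not the code of such a formula is accepted as a
valid input, i.e. answered by `0` or `1`, with probability at most `1/3`. -/
def DecidesKSAT (k : ℕ) (M : ProbTM CNFSym Bool) : Prop :=
  (∀ α : CNF, α.IsKCNF k →
    (∃ t, M.HaltsWithin α.encode t) ∧
    (α.Satisfiable → 2 / 3 ≤ M.prob α.encode {[true]}) ∧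
    (¬ α.Satisfiable → 2 / 3 ≤ M.prob α.encode {[false]})) ∧
  (∀ w : List CNFSym, (¬ ∃ α : CNF, α.IsKCNF k ∧ α.encode = w) →
    M.prob w {[true], [false]} ≤ 1 / 3)

/-- The exponent of `k`SAT for formulas with at most `Ct * n` clauses: the infimum of the `s > 0` such
that some decision algorithm for `k`SAT needs time `O(2 ^ (s n))` on these formulas. -/
def sTilde (k Ct : ℕ) : ℝ :=
  sInf {s : ℝ | 0 < s ∧ ∃ M : ProbTM CNFSym Bool, DecidesKSAT k M ∧
    IsBigOTwoPow (fun n => M.worstTime (CNF.encode '' sparseCNF k Ct n)) s}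

/-! ### ReLU networks -/

/-- Feed-forward networks with `m` inputs, `o` outputs and at least one layer, whose weights and
biases are elements of `θ`. -/
inductive Net (θ : Finset ℝ) : ℕ → ℕ → Type
  | last {m o : ℕ} (W : Matrix (Fin o) (Fin m) θ) (b : Fin o → θ) : Net θ m o
  | cons {m h o : ℕ} (W : Matrix (Fin h) (Fin m) θ) (b : Fin h → θ) (rest : Net θ h o) : Net θ m o

namespace Net

variable {θ : Finset ℝ}

/-- The affine map `x ↦ W x + b`. -/
def affine {m h : ℕ} (W : Matrix (Fin h) (Fin m) θ) (b : Fin h → θ) (x : Fin m → ℝ) : Fin h → ℝ :=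
  fun i => (∑ j, (W i j : ℝ) * x j) + (b i : ℝ)

/-- The realization of a network with the activation function `x ↦ max 0 x`, which is applied after
every layer except the last one. -/
def realize : {m o : ℕ} → Net θ m o → (Fin m → ℝ) → (Fin o → ℝ)
  | _, _, last W b, x => affine W b x
  | _, _, cons W b rest, x => rest.realize fun i => max 0 (affine W b x i)

/-- The number of layers. -/
def depth : {m o : ℕ} → Net θ m o → ℕ
  | _, _, last _ _ => 1
  | _, _, cons _ _ rest => rest.depth + 1

/-- All layer widths, including the input and the output width, are between `1` and `w`. -/
def WidthAtMost (w : ℕ) : {m o : ℕ} → Net θ m o → Prop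
  | m, o, last _ _ => (1 ≤ m ∧ m ≤ w) ∧ (1 ≤ o ∧ o ≤ w)
  | m, _, cons _ _ rest => (1 ≤ m ∧ m ≤ w) ∧ rest.WidthAtMost w

end Net

/-- The networks with `d` inputs, scalar output, width at most `w`, depth at most `L`, and weights and
biases in `θ`. -/
def netClass (θ : Finset ℝ) (d w L : ℕ) : Set (Net θ d 1) :=
  {Φ | Φ.WidthAtMost w ∧ Φ.depth ≤ L}

/-- The letters with which networks with weights in the finite set `θ` are written. -/
inductive NetSym (θ : Finset ℝ) : Type
  | weight (a : θ)
  | rowEnd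
  | layerEnd

/-- A layer is written row by row, each row of weights followed by the corresponding bias. -/
def encodeLayer {θ : Finset ℝ} {m h : ℕ} (W : Matrix (Fin h) (Fin m) θ) (b : Fin h → θ) :
    List (NetSym θ) :=
  (List.ofFn fun i =>
    (List.ofFn fun j => NetSym.weight (W i j)) ++ [NetSym.weight (b i), NetSym.rowEnd]).flatten
    ++ [NetSym.layerEnd]

def Net.encode {θ : Finset ℝ} : {m o : ℕ} → Net θ m o → List (NetSym θ)
  | _, _, Net.last W b => encodeLayer W b
  | _, _, Net.cons W b rest => encodeLayer W b ++ rest.encode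

/-- The weights that occur when a formula with at most `k` literals per clause is turned into a
network by composing copies of a network with weights in `θr` with each other, with the literals
`x ↦ x` and `x ↦ 1 - x`, and with the subtraction of `1`: when the output layers of up to `k` copies
are merged with the input layer of another copy, an input weight `a` is multiplied with an output
weight `b`, with a sum `j * b` of output biases or with `0, 1, -1`, and an input bias `e` may be
added. -/
def cnfWeights (k : ℕ) (θr : Finset ℝ) : Set ℝ :=
  (θr : Set ℝ) ∪ {-1, 0, 1} ∪
    {x | ∃ a ∈ θr, ∃ b ∈ θr, ∃ j ≤ k, ∃ c ∈ ({-1, 0, 1} : Set ℝ), ∃ e ∈ (θr : Set ℝ) ∪ {0},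
      x = a * ((j : ℝ) * b + c) + e}

/-- The weights that occur when the curve below is realized by compositions of the hat function
`x ↦ 1 - δ⁻¹ * max 0 (δ - x) - δ⁻¹ * max 0 (x - (1 - δ))` and identities. -/
def cvWeights (δ : ℝ) : Set ℝ := {-1, 0, 1, -δ⁻¹, δ⁻¹, δ, -(1 - δ)}

/-- The class `𝒦(n)` of networks; the class for `n < d` is the one for `n = d`. -/
def inputClass (θ : Finset ℝ) (d k Ct wr Lr n : ℕ) : Set (Net θ d 1) :=
  {Φ | Φ ∈ netClass θ d (max 2 (Ct * wr * k) * max n d) (3 * Lr + (max n d - d) - 1) ∧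
    ∀ x : Fin d → ℝ, 0 ≤ Φ.realize x 0 ∧ Φ.realize x 0 ≤ 1}

/-! ### The orthant visiting curve and the sets `Q_z` -/

/-- The hat function. -/
def hat (δ t : ℝ) : ℝ :=
  if t ≤ δ then t / δ else if t ≤ 1 - δ then 1 else 1 - (t - 1 + δ) / δ

/-- The curves `f_1(t) = t` and `f_{m+1}(t) = (f_m(s(t)), t)`, with `s` the hat function. -/
def curve (δ : ℝ) : (m : ℕ) → ℝ → (Fin m → ℝ)
  | 0, _ => Fin.elim0
  | m + 1, t => Fin.snoc (α := fun _ => ℝ) (curve δ m (hat δ t)) t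

/-- The projection onto `[0, 1]`. -/
def clamp (x : ℝ) : ℝ := max 0 (min 1 x)

/-- A truth value as a real number. -/
def bit (b : Bool) : ℝ := if b then 1 else 0

/-- The points `x ∈ Ω` such that the point `(x_1, …, x_{d-1}, f_{n-d+1}(x_d))`, projected to the unit
cube, is `δ`-close to the vertex `z` (indices are counted from `0` in the code). -/
def Qset (δ : ℝ) {d n : ℕ} (Ω : Set (Fin d → ℝ)) (z : Fin n → Bool) : Set (Fin d → ℝ) :=
  {x | x ∈ Ω ∧
    (∀ (i : Fin n) (l : Fin d), (l : ℕ) + 1 < d → (i : ℕ) = l →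
      |bit (z i) - clamp (x l)| ≤ δ) ∧
    (∀ (i : Fin n) (l : Fin d) (j : Fin (n - d + 1)), (l : ℕ) + 1 = d → (i : ℕ) = l + j →
      |bit (z i) - clamp (curve δ (n - d + 1) (x l) j)| ≤ δ)}

/-- `μ(Q_z) ≥ C δ^n` for all `n > d` and all `z ∈ {0,1}^n`. -/
def CurveMassBound (δ C : ℝ) {d : ℕ} (Ω : Set (Fin d → ℝ)) (μ : Measure (Fin d → ℝ)) : Prop :=
  ∀ n : ℕ, d < n → ∀ z : Fin n → Bool, C * δ ^ n ≤ μ.real (Qset δ Ω z)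

/-! ### Quadrature algorithms -/

/-- The letters with which rational numbers are written. -/
inductive RatSym : Type
  | sign (negative : Bool)
  | digit (b : Bool)
  | slash

/-- The number with the given binary digits, least significant digit first. -/
def binVal (p : List Bool) : ℕ := Nat.ofDigits 2 (p.map fun b => if b then 1 else 0)

/-- The word `w` represents the number `x`: it consists of a sign, the binary digits of a numerator,
a slash, and the binary digits of a nonzero denominator. The fraction need not be reduced. -/
def Represents (w : List RatSym) (x : ℝ) : Prop :=
  ∃ (s : Bool) (p q : List Bool),
    w = RatSym.sign s :: (p.map RatSym.digit ++ RatSym.slash :: q.map RatSym.digit) ∧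
    binVal q ≠ 0 ∧
    x = (if s then -1 else 1) * ((binVal p : ℝ) / (binVal q : ℝ))

/-- With probability at least `2/3`, the algorithm `A` outputs a number `x` with `|x - y| < ε`. -/
def ApproximatesAt {I : Type} (A : ProbTM I RatSym) (w : List I) (y ε : ℝ) : Prop :=
  2 / 3 ≤ A.prob w {u | ∃ x : ℝ, Represents u x ∧ |x - y| < ε}

end

end NNQuad

open NNQuad

/-! The lower bound is a reduction of kSAT to quadrature. A formula in `n` variables is turned into
a ReLU network with values in `[0, 1]` that vanishes identically if the formula is unsatisfiable,
and equals `1` wherever the iterates of the hat function at the last coordinate are `δ`-close to a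
satisfying assignment. The integral is then `0` in the first case (`integral_cnfNet_of_unsat`) and
at least `C * δ ^ (n + d)` in the second, by the mass bound and Markov's inequality
(`integral_cnfNet_of_sat`). A sufficiently accurate quadrature tells the two apart.

The hat function is `1` minus two ramps, each multiplied by `δ⁻¹`, so one layer turns the ramps at
one iterate into the ramps at the next (`HatState.shift`), while a shift register keeps `max 0 (2 *
s - 1)` and `max 0 (1 - 2 * s)` for each iterate `s`. At most one of these two is positive. Rounding
the iterates at `1/2` therefore gives an assignment that makes every literal of positive value true,
and a positive output forces satisfiability. Close to a vertex the true literals have value at least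
`1 - 2 * δ`; multiplication by powers of `δ⁻¹` and truncation at `1` bring them to `1`. Clauses and
their conjunction are neurons of the form `max 0 (1 - ∑ x)`. Only weights in `cvWeights` occur.

Accuracy `C * δ ^ N / 2` is promised only for networks in class `N` but not in class `N - 1`, and a
machine has to compare the answer with a threshold it can write down, although `δ` and `C` are
arbitrary reals. The variables are therefore grouped in `u` blocks of length `q`, and `N = (q + 1) *
u + e₁`. The spare factor `δ < 1/2` per block leaves room for a power of two with `δ ^ (q + 1) ≤ 2⁻¹
^ p ≤ δ ^ q`, so that `2⁻¹ ^ (p * u + e₀)` separates the two cases (`exists_fits`,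
`lower_le_threshold`, `threshold_le_upper`). The spare depth is filled with amplification layers, so
that the depth is the largest one allowed (`net_mem`). As `u ≤ n / q + 1` for sparse formulas, time
`O(2 ^ (t * N))` becomes `O(2 ^ (t * (1 + 1 / q) * n))`, and `q → ∞` removes the loss (`sTilde_le`).

The reduction is carried out on machines. Structured stack programs with a step count are compiled
to the machine model (`Exec.reaches`); the functions computable in polynomial time on encoded trees
(`PT`) are closed under enough constructions to contain the map from formulas to network words. The
given algorithm then runs as a subroutine with its own coin flips, and its output is compared with
the threshold; the phases before and after ignore the coin.

For Lebesgue measure, each outer branch of the hat function stretches an interval of length `δ`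
affinely onto `[0, 1]`, so every prescribed bit of the curve costs a factor `δ`
(`pow_le_volume_curveSet`). -/

namespace NNQuad

/-! ### A structured language of stack programs -/

/-- Structured programs on a family of stacks. `case k f` pops the stack `k` and continues with the
program selected by the popped letter; `loop k halting f` pops the stack `k` until the popped letter
satisfies `halting`, and runs `f` on every other popped letter. -/
inductive Prog {K : Type} (Γ : K → Type) : Type
  | skip : Prog Γ
  | push (k : K) (a : Γ k) : Prog Γ
  | seq (p q : Prog Γ) : Prog Γ
  | case (k : K) (f : Option (Γ k) → Prog Γ) : Prog Γ
  | loop (k : K) (halting : Option (Γ k) → Bool) (f : Option (Γ k) → Prog Γ) : Prog Γ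

section Language

variable {K : Type} {Γ : K → Type}

/-- `Exec p s s' n`: the program `p` transforms the stacks `s` into `s'` in `n` steps. -/
inductive Exec [DecidableEq K] : Prog Γ → (∀ k, List (Γ k)) → (∀ k, List (Γ k)) → ℕ → Prop
  | skip (s) : Exec .skip s s 1
  | push (k a s) : Exec (.push k a) s (Function.update s k (a :: s k)) 1
  | seq {p q s s' s'' n m} : Exec p s s' n → Exec q s' s'' m → Exec (.seq p q) s s'' (n + m)
  | case {k f s s' n} : Exec (f (s k).head?) (Function.update s k (s k).tail) s' n →
      Exec (.case k f) s s' (n + 1)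
  | loop_exit {k halting f s} : halting (s k).head? = true →
      Exec (.loop k halting f) s (Function.update s k (s k).tail) 1
  | loop_step {k halting f s s' s'' n m} : halting (s k).head? = false →
      Exec (f (s k).head?) (Function.update s k (s k).tail) s' n →
      Exec (.loop k halting f) s' s'' m → Exec (.loop k halting f) s s'' (n + m + 1)

namespace Prog

/-- The control points of a program. -/
def Lab : Prog Γ → Type
  | skip => Unit
  | push _ _ => Unit
  | seq p q => Lab p ⊕ Lab q
  | case _ f => Option (Σ r, Lab (f r))
  | loop _ _ f => Option (Σ r, Lab (f r))

/-- The first control point. -/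
def entry : (p : Prog Γ) → p.Lab
  | skip => ()
  | push _ _ => ()
  | seq p _ => Sum.inl (entry p)
  | case _ _ => none
  | loop _ _ _ => none

/-- Finite alphabets give finitely many branches at each `case` and `loop`. This is what makes the
compiled program a legitimate finite control. -/
theorem finite_lab [∀ k, Finite (Γ k)] : (p : Prog Γ) → Finite p.Lab
  | skip => inferInstanceAs (Finite Unit)
  | push _ _ => inferInstanceAs (Finite Unit)
  | seq p q => by
      have := finite_lab p
      have := finite_lab q
      exact inferInstanceAs (Finite (Lab p ⊕ Lab q))
  | case _ f => by
      have := fun r => finite_lab (f r)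
      exact inferInstanceAs (Finite (Option (Σ r, Lab (f r))))
  | loop _ _ f => by
      have := fun r => finite_lab (f r)
      exact inferInstanceAs (Finite (Option (Σ r, Lab (f r))))

/-- The translation of a program to statements of a stack machine whose internal state contains a
register for the letter that was popped last from each stack. -/
def code [DecidableEq K] {Λ τ : Type} : (p : Prog Γ) → (p.Lab → Λ) → Λ → p.Lab →
    Turing.TM2.Stmt Γ Λ (τ × (∀ k, Option (Γ k)))
  | skip, _, exit, _ => .goto fun _ => exit
  | push k a, _, exit, _ => .push k (fun _ => a) (.goto fun _ => exit)
  | seq p q, emb, _, Sum.inl l => code p (fun l => emb (Sum.inl l)) (emb (Sum.inr q.entry)) l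
  | seq _ q, emb, exit, Sum.inr l => code q (fun l => emb (Sum.inr l)) exit l
  | case k f, emb, _, none => .pop k (fun v r => (v.1, Function.update v.2 k r))
      (.goto fun v => emb (some ⟨v.2 k, (f (v.2 k)).entry⟩))
  | case _ f, emb, exit, some ⟨r, l⟩ => code (f r) (fun l => emb (some ⟨r, l⟩)) exit l
  | loop k halting f, emb, exit, none => .pop k (fun v r => (v.1, Function.update v.2 k r))
      (.goto fun v => if halting (v.2 k) then exit else emb (some ⟨v.2 k, (f (v.2 k)).entry⟩))
  | loop _ _ f, emb, _, some ⟨r, l⟩ => code (f r) (fun l => emb (some ⟨r, l⟩)) (emb none) l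

end Prog

/-- One step of a stack machine; halted configurations do not change. -/
def detStep [DecidableEq K] {Λ σ : Type} (T : Λ → Turing.TM2.Stmt Γ Λ σ) (c : Turing.TM2.Cfg Γ Λ σ) :
    Turing.TM2.Cfg Γ Λ σ :=
  (Turing.TM2.step T c).getD c

theorem detStep_some [DecidableEq K] {Λ σ : Type} (T : Λ → Turing.TM2.Stmt Γ Λ σ) (l : Λ) (v : σ)
    (s : ∀ k, List (Γ k)) : detStep T ⟨some l, v, s⟩ = Turing.TM2.stepAux (T l) v s := rfl

/-- `Reach step n c c'`: whatever the outcomes of the coin flips are, `n` steps lead from `c` to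
`c'`. -/
inductive Reach {C : Type} (step : Bool → C → C) : ℕ → C → C → Prop
  | refl (c : C) : Reach step 0 c c
  | head {n : ℕ} {c c₁ c' : C} : (∀ b, step b c = c₁) → Reach step n c₁ c' →
      Reach step (n + 1) c c'

theorem Reach.trans {C : Type} {step : Bool → C → C} {n m : ℕ} {c c' c'' : C}
    (h : Reach step n c c') (h' : Reach step m c' c'') : Reach step (n + m) c c'' := by
  induction h with
  | refl c => rwa [Nat.zero_add]
  | head h₁ _ ih =>
    rw [Nat.add_right_comm]
    exact .head h₁ (ih h')

/-- The translated program simulates the execution of the program, step by step. -/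
theorem Exec.reaches [DecidableEq K] {Λ τ : Type}
    (T : Bool → Λ → Turing.TM2.Stmt Γ Λ (τ × (∀ k, Option (Γ k))))
    {p : Prog Γ} {s s' : ∀ k, List (Γ k)} {n : ℕ} (h : Exec p s s' n) :
    ∀ (emb : p.Lab → Λ) (exit : Λ), (∀ b l, T b (emb l) = p.code emb exit l) →
    ∀ v : τ × (∀ k, Option (Γ k)), ∃ ρ,
      Reach (fun b => detStep (T b)) n ⟨some (emb p.entry), v, s⟩ ⟨some exit, (v.1, ρ), s'⟩ := by
  induction h with
  | skip s =>
    intro emb exit hT v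
    exact ⟨v.2, .head (fun b => by simp [detStep_some, hT, Prog.code]) (.refl _)⟩
  | push k a s =>
    intro emb exit hT v
    exact ⟨v.2, .head (fun b => by simp [detStep_some, hT, Prog.code]) (.refl _)⟩
  | seq _ _ ih₁ ih₂ =>
    intro emb exit hT v
    -- The exit of the first program is the entry of the second.
    obtain ⟨ρ, h₁⟩ := ih₁ (fun l => emb (Sum.inl l)) _ (fun b l => hT b (Sum.inl l)) v
    obtain ⟨ρ', h₂⟩ := ih₂ (fun l => emb (Sum.inr l)) exit (fun b l => hT b (Sum.inr l)) (v.1, ρ)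
    exact ⟨ρ', h₁.trans h₂⟩
  | @case k f s s' n _ ih =>
    intro emb exit hT v
    obtain ⟨ρ, h₁⟩ := ih (fun l => emb (some ⟨_, l⟩)) exit (fun b l => hT b (some ⟨_, l⟩))
      (v.1, Function.update v.2 k (s k).head?)
    refine ⟨ρ, .head (fun b => ?_) h₁⟩
    rw [detStep_some]
    refine (congrArg (fun q => Turing.TM2.stepAux q v s) (hT b none)).trans ?_
    simp only [Prog.code, Turing.TM2.stepAux]
    -- The jump target depends on the register of stack `k`, which after the pop contains the popped
    -- letter.
    exact congrArg (fun r => (⟨some (emb (some ⟨r, (f r).entry⟩)), _, _⟩ :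
      Turing.TM2.Cfg Γ Λ (τ × (∀ k, Option (Γ k))))) (Function.update_self k _ v.2)
  | @loop_exit k halting f s hs =>
    intro emb exit hT v
    refine ⟨Function.update v.2 k (s k).head?, .head (fun b => ?_) (.refl _)⟩
    rw [detStep_some]
    refine (congrArg (fun q => Turing.TM2.stepAux q v s) (hT b none)).trans ?_
    simp [Prog.code, hs]
  | @loop_step k halting f s s' s'' n m hs _ _ ih₁ ih₂ =>
    intro emb exit hT v
    -- The body of a loop exits to the loop head `emb none`.
    obtain ⟨ρ, h₁⟩ := ih₁ (fun l => emb (some ⟨_, l⟩)) (emb none) (fun b l => hT b (some ⟨_, l⟩))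
      (v.1, Function.update v.2 k (s k).head?)
    obtain ⟨ρ', h₂⟩ := ih₂ emb exit hT (v.1, ρ)
    refine ⟨ρ', .head (fun b => ?_) (h₁.trans h₂)⟩
    rw [detStep_some]
    refine (congrArg (fun q => Turing.TM2.stepAux q v s) (hT b none)).trans ?_
    simp only [Prog.code, Turing.TM2.stepAux, Function.update_self, hs, Bool.false_eq_true,
      if_false]
    exact congrArg (fun r => (⟨some (emb (some ⟨r, (f r).entry⟩)), _, _⟩ :
      Turing.TM2.Cfg Γ Λ (τ × (∀ k, Option (Γ k))))) (Function.update_self k _ v.2)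

end Language

/-! ### Programs on a larger family of stacks -/

section Lift

variable {K₁ K₂ : Type} {Γ₁ : K₁ → Type} {Γ₂ : K₂ → Type}

/-- The letters of two families of stacks side by side. -/
abbrev SumΓ (Γ₁ : K₁ → Type) (Γ₂ : K₂ → Type) : K₁ ⊕ K₂ → Type
  | Sum.inl k => Γ₁ k
  | Sum.inr k => Γ₂ k

/-- The two families of stacks side by side. -/
def joinStk (s : ∀ k, List (Γ₁ k)) (t : ∀ k, List (Γ₂ k)) :
    ∀ k : K₁ ⊕ K₂, List (SumΓ Γ₁ Γ₂ k)
  | Sum.inl k => s k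
  | Sum.inr k => t k

@[simp] theorem joinStk_inl (s : ∀ k, List (Γ₁ k)) (t : ∀ k, List (Γ₂ k)) (k : K₁) :
    joinStk s t (Sum.inl k) = s k := rfl

@[simp] theorem joinStk_inr (s : ∀ k, List (Γ₁ k)) (t : ∀ k, List (Γ₂ k)) (k : K₂) :
    joinStk s t (Sum.inr k) = t k := rfl

variable [DecidableEq K₁] [DecidableEq K₂]

@[simp] theorem update_joinStk_inl (s : ∀ k, List (Γ₁ k)) (t : ∀ k, List (Γ₂ k)) (k : K₁)
    (x : List (Γ₁ k)) :
    Function.update (joinStk s t) (Sum.inl k) x = joinStk (Function.update s k x) t := by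
  funext i
  rcases i with i | i
  · by_cases h : i = k
    · subst h; simp
    · have h' : (Sum.inl i : K₁ ⊕ K₂) ≠ Sum.inl k := by simpa using h
      rw [Function.update_of_ne h', joinStk_inl, joinStk_inl, Function.update_of_ne h]
  · have h' : (Sum.inr i : K₁ ⊕ K₂) ≠ Sum.inl k := by simp
    rw [Function.update_of_ne h']; rfl

@[simp] theorem update_joinStk_inr (s : ∀ k, List (Γ₁ k)) (t : ∀ k, List (Γ₂ k)) (k : K₂)
    (x : List (Γ₂ k)) :
    Function.update (joinStk s t) (Sum.inr k) x = joinStk s (Function.update t k x) := by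
  funext i
  rcases i with i | i
  · have h' : (Sum.inl i : K₁ ⊕ K₂) ≠ Sum.inr k := by simp
    rw [Function.update_of_ne h']; rfl
  · by_cases h : i = k
    · subst h; simp
    · have h' : (Sum.inr i : K₁ ⊕ K₂) ≠ Sum.inr k := by simpa using h
      rw [Function.update_of_ne h', joinStk_inr, joinStk_inr, Function.update_of_ne h]

/-- A program on the first family of stacks, seen as a program on both families. -/
def Prog.lift (Γ₂ : K₂ → Type) : Prog Γ₁ → Prog (SumΓ Γ₁ Γ₂)
  | skip => skip
  | push k a => push (Sum.inl k) a
  | seq p q => seq (lift Γ₂ p) (lift Γ₂ q)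
  | case k f => case (Sum.inl k) fun r => lift Γ₂ (f r)
  | loop k halting f => loop (Sum.inl k) halting fun r => lift Γ₂ (f r)

theorem Exec.lift {p : Prog Γ₁} {s s' : ∀ k, List (Γ₁ k)} {n : ℕ} (h : Exec p s s' n)
    (t : ∀ k, List (Γ₂ k)) : Exec (p.lift Γ₂) (joinStk s t) (joinStk s' t) n := by
  induction h with
  | skip s => exact .skip _
  | push k a s =>
    have := Exec.push (Γ := SumΓ Γ₁ Γ₂) (Sum.inl k) a (joinStk s t)
    rwa [joinStk_inl, update_joinStk_inl] at this
  | seq _ _ ih₁ ih₂ => exact .seq ih₁ ih₂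
  | case _ ih =>
    refine Exec.case (Γ := SumΓ Γ₁ Γ₂) (k := Sum.inl _) ?_
    rw [joinStk_inl]
    rw [update_joinStk_inl]
    exact ih
  | @loop_exit k halting f s hs =>
    have := Exec.loop_exit (Γ := SumΓ Γ₁ Γ₂) (k := Sum.inl k) (halting := halting)
      (f := fun r => (f r).lift Γ₂) (s := joinStk s t) hs
    rw [joinStk_inl, update_joinStk_inl] at this
    exact this
  | loop_step hs _ _ ih₁ ih₂ =>
    refine Exec.loop_step (Γ := SumΓ Γ₁ Γ₂) (k := Sum.inl _) hs ?_ ih₂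
    rw [joinStk_inl]
    rw [update_joinStk_inl]
    exact ih₁

end Lift

/-! ### Execution rules for stacks with known contents -/

section ExecRules

variable {K : Type} [DecidableEq K] {Γ : K → Type}

theorem Exec.push_eq {k : K} {a : Γ k} {s s' : ∀ k, List (Γ k)}
    (h : Function.update s k (a :: s k) = s') : Exec (.push k a) s s' 1 :=
  h ▸ Exec.push k a s

theorem Exec.case_cons {k : K} {f : Option (Γ k) → Prog Γ} {s s₁ s' : ∀ k, List (Γ k)} {n : ℕ}
    {a : Γ k} {l : List (Γ k)} (h : s k = a :: l) (h₁ : Function.update s k l = s₁)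
    (h₂ : Exec (f (some a)) s₁ s' n) : Exec (.case k f) s s' (n + 1) := by
  subst h₁
  apply Exec.case
  simpa [h] using h₂

theorem Exec.case_nil {k : K} {f : Option (Γ k) → Prog Γ} {s s' : ∀ k, List (Γ k)} {n : ℕ}
    (h : s k = []) (h₂ : Exec (f none) s s' n) : Exec (.case k f) s s' (n + 1) := by
  apply Exec.case
  rw [h]
  have : Function.update s k ([] : List (Γ k)).tail = s := by
    rw [List.tail_nil, ← h, Function.update_eq_self]
  rwa [this]

theorem Exec.loop_exit_cons {k : K} {halting : Option (Γ k) → Bool} {f : Option (Γ k) → Prog Γ}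
    {s s' : ∀ k, List (Γ k)} {a : Γ k} {l : List (Γ k)} (h : s k = a :: l)
    (h₁ : Function.update s k l = s') (ha : halting (some a) = true) :
    Exec (.loop k halting f) s s' 1 := by
  subst h₁
  have := Exec.loop_exit (k := k) (halting := halting) (f := f) (s := s) (by rw [h]; exact ha)
  rwa [h] at this

theorem Exec.loop_exit_nil {k : K} {halting : Option (Γ k) → Bool} {f : Option (Γ k) → Prog Γ}
    {s : ∀ k, List (Γ k)} (h : s k = []) (ha : halting none = true) :
    Exec (.loop k halting f) s s 1 := by
  have := Exec.loop_exit (k := k) (halting := halting) (f := f) (s := s) (by rw [h]; exact ha)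
  rwa [h, List.tail_nil, ← h, Function.update_eq_self] at this

theorem Exec.loop_step_cons {k : K} {halting : Option (Γ k) → Bool} {f : Option (Γ k) → Prog Γ}
    {s s₁ s' s'' : ∀ k, List (Γ k)} {n m : ℕ} {a : Γ k} {l : List (Γ k)} (h : s k = a :: l)
    (h₁ : Function.update s k l = s₁) (ha : halting (some a) = false)
    (h₂ : Exec (f (some a)) s₁ s' n) (h₃ : Exec (.loop k halting f) s' s'' m) :
    Exec (.loop k halting f) s s'' (n + m + 1) := by
  subst h₁
  refine Exec.loop_step (by rw [h]; exact ha) ?_ h₃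
  simpa [h] using h₂

end ExecRules

/-! ### Work stacks -/

/-- The letters on the work stacks. -/
abbrev Sym : Type := Fin 4

/-- The work stacks: a main stack, two stacks for intermediate storage, a counter, an input stack and
an output stack. -/
inductive WK : Type
  | main | left | right | cnt | inp | out
  deriving DecidableEq

instance : Fintype WK :=
  ⟨{.main, .left, .right, .cnt, .inp, .out}, fun k => by cases k <;> simp⟩

/-- The alphabets of the work stacks. -/
abbrev WΓ : WK → Type := fun _ => Sym

/-- Programs on the work stacks. -/
abbrev WProg : Type := Prog WΓ

/-- The contents of the work stacks; the two storage stacks are interchanged if `β` is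
`false`. -/
def stB (β : Bool) (m x y c i o : List Sym) : ∀ k, List (WΓ k)
  | .main => m
  | .left => cond β x y
  | .right => cond β y x
  | .cnt => c
  | .inp => i
  | .out => o

/-- The contents of the work stacks. -/
abbrev st (m x y c i o : List Sym) : ∀ k, List (WΓ k) := stB true m x y c i o

/-- The storage stack selected by `β`. -/
abbrev store (β : Bool) : WK := cond β .left .right

section

variable (β : Bool) (m x y c i o v : List Sym)

@[simp] theorem stB_main : stB β m x y c i o .main = m := by cases β <;> rfl
@[simp] theorem stB_store : stB β m x y c i o (store β) = x := by cases β <;> rfl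
@[simp] theorem stB_cnt : stB β m x y c i o .cnt = c := by cases β <;> rfl
@[simp] theorem stB_inp : stB β m x y c i o .inp = i := by cases β <;> rfl

/-- Lets programs that use the two storage stacks in opposite roles be described by one notation. -/
theorem stB_not : stB (!β) m x y c i o = stB β m y x c i o := by cases β <;> rfl

@[simp] theorem update_stB_main :
    Function.update (stB β m x y c i o) .main v = stB β v x y c i o := by
  cases β <;> (funext k; cases k <;> rfl)
@[simp] theorem update_stB_store :
    Function.update (stB β m x y c i o) (store β) v = stB β m v y c i o := by
  cases β <;> (funext k; cases k <;> rfl)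
@[simp] theorem update_stB_cnt :
    Function.update (stB β m x y c i o) .cnt v = stB β m x y v i o := by
  cases β <;> (funext k; cases k <;> rfl)
@[simp] theorem update_stB_inp :
    Function.update (stB β m x y c i o) .inp v = stB β m x y c v o := by
  cases β <;> (funext k; cases k <;> rfl)
@[simp] theorem update_stB_out :
    Function.update (stB β m x y c i o) .out v = stB β m x y c i v := by
  cases β <;> (funext k; cases k <;> rfl)

end

theorem exec_push_main (β : Bool) (a : Sym) (m x y c i o : List Sym) :
    Exec (.push .main a) (stB β m x y c i o) (stB β (a :: m) x y c i o) 1 :=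
  Exec.push_eq (by simp)

theorem exec_push_store (β : Bool) (a : Sym) (m x y c i o : List Sym) :
    Exec (.push (store β) a) (stB β m x y c i o) (stB β m (a :: x) y c i o) 1 :=
  Exec.push_eq (by simp)

theorem exec_push_cnt (β : Bool) (a : Sym) (m x y c i o : List Sym) :
    Exec (.push .cnt a) (stB β m x y c i o) (stB β m x y (a :: c) i o) 1 :=
  Exec.push_eq (by simp)

theorem exec_case_main {β : Bool} {f : Option Sym → WProg} {a : Sym} {m x y c i o : List Sym}
    {s' : ∀ k, List (WΓ k)} {n : ℕ} (h : Exec (f (some a)) (stB β m x y c i o) s' n) :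
    Exec (.case .main f) (stB β (a :: m) x y c i o) s' (n + 1) :=
  Exec.case_cons (k := WK.main) (a := a) (l := m) (by simp) (by simp) h

/-! ### Binary trees on stacks -/

/-- Binary trees, the data on which programs operate. -/
inductive D : Type
  | nil : D
  | cons (a b : D) : D

namespace D

/-- A tree in prefix notation. -/
def word : D → List Sym
  | nil => [0]
  | cons a b => 1 :: (word a ++ word b)

/-- The number of nodes. -/
def size : D → ℕ
  | nil => 1
  | cons a b => size a + size b + 1

theorem length_word : (t : D) → t.word.length = t.size
  | nil => rfl
  | cons a b => by simp [word, size, length_word a, length_word b]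

theorem size_pos (t : D) : 1 ≤ t.size := by cases t <;> simp [size]

theorem mem_word {t : D} {a : Sym} (h : a ∈ t.word) : a = 0 ∨ a = 1 := by
  induction t with
  | nil => left; simpa [word] using h
  | cons t₁ t₂ ih₁ ih₂ =>
    simp only [word, List.mem_cons, List.mem_append] at h
    rcases h with h | h | h
    · exact Or.inr h
    · exact ih₁ h
    · exact ih₂ h

end D

/-- The loop that reads a tree from the main stack and processes its letters by `f`; the number of
subtrees that remain to be read is on the counter. -/
def scanLoop (f : Sym → WProg) : WProg :=
  .loop .cnt (fun r => decide (r ≠ some 0)) fun _ => .case .main fun r => match r with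
    | some 0 => f 0
    | some 1 => .seq (f 1) (.seq (.push .cnt 0) (.push .cnt 0))
    | _ => .skip

theorem flatMap_nil_fun {α β : Type} (l : List α) : (l.flatMap fun _ => ([] : List β)) = [] := by
  induction l <;> simp_all

/-- In prefix notation a leaf settles one pending subtree and an inner node replaces one by two, so
a counter suffices to find the end of a tree. The loop does not stop between consecutive subtrees,
which is why the lemma is in continuation form: a run of the loop after the tree extends to one that
starts before it. -/
theorem exec_scanLoop {β : Bool} {f : Sym → WProg} {g : Sym → List Sym} {τ : ℕ}
    (hf : ∀ a m x y c i o, ∃ n ≤ τ, Exec (f a) (stB β m x y c i o) (stB β m (g a ++ x) y c i o) n)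
    (t : D) : ∀ (m x y c i o : List Sym) (s' : ∀ k, List (WΓ k)) (n : ℕ),
    Exec (scanLoop f) (stB β m ((t.word.reverse.flatMap g) ++ x) y c i o) s' n →
    ∃ n' ≤ n + (τ + 4) * t.size,
      Exec (scanLoop f) (stB β (t.word ++ m) x y (0 :: c) i o) s' n' := by
  induction t with
  | nil =>
    intro m x y c i o s' n h
    obtain ⟨n₁, hn₁, h₁⟩ := hf 0 m x y c i o
    refine ⟨(n₁ + 1) + n + 1, by simp [D.size]; omega, ?_⟩
    refine Exec.loop_step_cons (k := WK.cnt) (a := (0 : Sym)) (l := c) (by simp)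
      (update_stB_cnt _ _ _ _ _ _ _ _) (by simp) (exec_case_main h₁) ?_
    change Exec (scanLoop f) _ _ _
    simpa [D.word] using h
  | cons a b iha ihb =>
    intro m x y c i o s' n h
    obtain ⟨n₁, hn₁, h₁⟩ := hf 1 (a.word ++ (b.word ++ m)) x y c i o
    -- Runs are extended backwards, hence the second subtree comes first.
    obtain ⟨n₂, hn₂, h₂⟩ := ihb m (a.word.reverse.flatMap g ++ (g 1 ++ x)) y c i o s' n
      (by simpa [D.word, List.append_assoc] using h)
    obtain ⟨n₃, hn₃, h₃⟩ := iha (b.word ++ m) (g 1 ++ x) y (0 :: c) i o s' n₂ h₂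
    refine ⟨(n₁ + (1 + 1) + 1) + n₃ + 1, ?_, ?_⟩
    · simp only [D.size]; nlinarith
    refine Exec.loop_step_cons (k := WK.cnt) (a := (0 : Sym)) (l := c) (by simp)
      (update_stB_cnt _ _ _ _ _ _ _ _) (by simp) ?_ h₃
    simp only [D.word, List.cons_append, List.append_assoc]
    exact exec_case_main (.seq h₁ (.seq (exec_push_cnt _ _ _ _ _ _ _ _)
      (exec_push_cnt _ _ _ _ _ _ _ _)))

/-- Moves a tree from the main stack to a storage stack, in reversed order and above a mark. -/
def stash (β : Bool) : WProg :=
  .seq (.push (store β) 2) (.seq (.push .cnt 2) (.seq (.push .cnt 0)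
    (scanLoop fun a => .push (store β) a)))

theorem exec_stash (β : Bool) (t : D) (m x y c i o : List Sym) :
    ∃ n ≤ 5 * t.size + 4, Exec (stash β) (stB β (t.word ++ m) x y c i o)
      (stB β m (t.word.reverse ++ 2 :: x) y c i o) n := by
  obtain ⟨n, hn, h⟩ := exec_scanLoop (β := β) (f := fun a => .push (store β) a) (g := fun a => [a])
    (τ := 1) (fun a m x y c i o => ⟨1, le_rfl, exec_push_store _ _ _ _ _ _ _ _⟩) t
    m (2 :: x) y (2 :: c) i o (stB β m (t.word.reverse ++ 2 :: x) y c i o) 1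
    (by
      -- The mark `2` below the counter stops the scan when no subtree is pending.
      refine Exec.loop_exit_cons (k := WK.cnt) (a := (2 : Sym)) (l := c) (by simp) ?_ (by simp)
      simp)
  exact ⟨1 + (1 + (1 + n)), by omega, .seq (exec_push_store _ _ _ _ _ _ _ _)
    (.seq (exec_push_cnt _ _ _ _ _ _ _ _) (.seq (exec_push_cnt _ _ _ _ _ _ _ _) h))⟩

/-- Removes a tree from the main stack. -/
def dropTree : WProg := .seq (.push .cnt 2) (.seq (.push .cnt 0) (scanLoop fun _ => .skip))

theorem exec_dropTree (t : D) (m x y c i o : List Sym) :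
    ∃ n ≤ 5 * t.size + 3, Exec dropTree (st (t.word ++ m) x y c i o) (st m x y c i o) n := by
  obtain ⟨n, hn, h⟩ := exec_scanLoop (β := true) (f := fun _ => .skip) (g := fun _ => [])
    (τ := 1) (fun a m x y c i o => ⟨1, le_rfl, Exec.skip _⟩) t
    m x y (2 :: c) i o (st m x y c i o) 1
    (by
      refine Exec.loop_exit_cons (k := WK.cnt) (a := (2 : Sym)) (l := c) (by simp) ?_ (by simp)
      simp [flatMap_nil_fun])
  exact ⟨1 + (1 + n), by omega, .seq (exec_push_cnt _ _ _ _ _ _ _ _)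
    (.seq (exec_push_cnt _ _ _ _ _ _ _ _) h)⟩

/-- The loop that empties a storage stack down to the next mark and processes the letters by `f`. -/
def unstashLoop (β : Bool) (f : Sym → WProg) : WProg :=
  .loop (store β) (fun r => decide (r ≠ some 0 ∧ r ≠ some 1)) fun r => match r with
    | some a => f a
    | none => .skip

/-- Letters of trees are `0` or `1`, so the mark `2` delimits the stored word. Every letter may be
written both to the main stack, by `g`, and to the other storage stack, by `h`; the latter is needed
for copying. -/
theorem exec_unstashLoop {β : Bool} {f : Sym → WProg} {g h : Sym → List Sym} {τ : ℕ}
    (hf : ∀ a m x y c i o, ∃ n ≤ τ, Exec (f a) (stB β m x y c i o)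
      (stB β (g a ++ m) x (h a ++ y) c i o) n)
    (l : List Sym) : ∀ (m x y c i o : List Sym), (∀ a ∈ l, a = 0 ∨ a = 1) →
    ∃ n ≤ (τ + 1) * l.length + 1,
      Exec (unstashLoop β f) (stB β m (l ++ 2 :: x) y c i o)
        (stB β (l.reverse.flatMap g ++ m) x (l.reverse.flatMap h ++ y) c i o) n := by
  induction l with
  | nil =>
    intro m x y c i o _
    refine ⟨1, by simp, ?_⟩
    exact Exec.loop_exit_cons (k := store β) (a := (2 : Sym)) (l := x) (by simp)
      (by simp) (by simp)
  | cons a l ih =>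
    intro m x y c i o hl
    obtain ⟨n₁, hn₁, h₁⟩ := hf a m (l ++ 2 :: x) y c i o
    obtain ⟨n₂, hn₂, h₂⟩ := ih (g a ++ m) x (h a ++ y) c i o fun b hb => hl b (by simp [hb])
    refine ⟨n₁ + n₂ + 1, by simp only [List.length_cons]; nlinarith, ?_⟩
    refine Exec.loop_step_cons (k := store β) (a := a) (l := l ++ 2 :: x) (by simp)
      (update_stB_store _ _ _ _ _ _ _ _) ?_ h₁ ?_
    · rcases hl a (by simp) with rfl | rfl <;> simp
    · change Exec (unstashLoop β f) _ _ _
      simpa [List.append_assoc] using h₂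

/-- Moves a tree back from a storage stack to the main stack. -/
def unstash (β : Bool) : WProg := unstashLoop β fun a => .push .main a

theorem exec_unstash (β : Bool) (t : D) (m x y c i o : List Sym) :
    ∃ n ≤ 2 * t.size + 1, Exec (unstash β) (stB β m (t.word.reverse ++ 2 :: x) y c i o)
      (stB β (t.word ++ m) x y c i o) n := by
  obtain ⟨n, hn, h⟩ := exec_unstashLoop (β := β) (f := fun a => .push .main a) (g := fun a => [a])
    (h := fun _ => []) (τ := 1) (fun a m x y c i o => ⟨1, le_rfl, exec_push_main _ _ _ _ _ _ _ _⟩)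
    t.word.reverse m x y c i o (fun a ha => D.mem_word (List.mem_reverse.1 ha))
  refine ⟨n, by simpa [D.length_word] using hn, ?_⟩
  simpa [flatMap_nil_fun, unstash] using h

/-- `Runs p u v T`: the program `p` replaces the word `u` on top of the main stack by `v` in at most
`T` steps, and does not touch anything else. -/
def Runs (p : WProg) (u v : List Sym) (T : ℕ) : Prop :=
  ∀ m x y c i o, ∃ n ≤ T, Exec p (st (u ++ m) x y c i o) (st (v ++ m) x y c i o) n

theorem Runs.seq {p q : WProg} {u v w : List Sym} {T T' : ℕ} (h : Runs p u v T)
    (h' : Runs q v w T') : Runs (.seq p q) u w (T + T') := by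
  intro m x y c i o
  obtain ⟨n, hn, e⟩ := h m x y c i o
  obtain ⟨n', hn', e'⟩ := h' m x y c i o
  exact ⟨n + n', by omega, .seq e e'⟩

theorem Runs.mono {p : WProg} {u v : List Sym} {T T' : ℕ} (h : Runs p u v T) (hT : T ≤ T') :
    Runs p u v T' := fun m x y c i o =>
  let ⟨n, hn, e⟩ := h m x y c i o
  ⟨n, hn.trans hT, e⟩

theorem Runs.append_right {p : WProg} {u v : List Sym} {T : ℕ} (h : Runs p u v T)
    (w : List Sym) : Runs p (u ++ w) (v ++ w) T := by
  intro m x y c i o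
  simpa [List.append_assoc] using h (w ++ m) x y c i o

theorem runs_skip (u : List Sym) : Runs .skip u u 1 := fun _ _ _ _ _ _ => ⟨1, le_rfl, .skip _⟩

theorem runs_push (a : Sym) (u : List Sym) : Runs (.push .main a) u (a :: u) 1 :=
  fun _ _ _ _ _ _ => ⟨1, le_rfl, exec_push_main _ _ _ _ _ _ _ _⟩

theorem runs_drop (t : D) (u : List Sym) : Runs dropTree (t.word ++ u) u (5 * t.size + 3) := by
  intro m x y c i o
  simpa [List.append_assoc] using exec_dropTree t (u ++ m) x y c i o

theorem runs_case {f : Option Sym → WProg} {a : Sym} {u v : List Sym} {T : ℕ}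
    (h : Runs (f (some a)) u v T) : Runs (.case .main f) (a :: u) v (T + 1) := by
  intro m x y c i o
  obtain ⟨n, hn, e⟩ := h m x y c i o
  exact ⟨n + 1, by omega, exec_case_main e⟩

/-- Removes the top letter of the main stack. -/
def popMain : WProg := .case .main fun _ => .skip

theorem runs_pop (a : Sym) (u : List Sym) : Runs popMain (a :: u) u 2 := runs_case (runs_skip u)

/-- Runs a program below the top tree of the main stack. -/
def dip (p : WProg) : WProg := .seq (stash true) (.seq p (unstash true))

theorem runs_dip {p : WProg} {u v : List Sym} {T : ℕ} (h : Runs p u v T) (t : D) :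
    Runs (dip p) (t.word ++ u) (t.word ++ v) (T + (7 * t.size + 5)) := by
  intro m x y c i o
  obtain ⟨n₁, hn₁, e₁⟩ := exec_stash true t (u ++ m) x y c i o
  obtain ⟨n₂, hn₂, e₂⟩ := h m (t.word.reverse ++ 2 :: x) y c i o
  obtain ⟨n₃, hn₃, e₃⟩ := exec_unstash true t (v ++ m) x y c i o
  refine ⟨n₁ + (n₂ + n₃), by omega, ?_⟩
  simp only [List.append_assoc]
  exact .seq e₁ (.seq e₂ e₃)

/-- Interchanges the two top trees of the main stack. -/
def swapTrees : WProg := .seq (stash true) (.seq (stash false) (.seq (unstash true) (unstash false)))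

/-- The two trees are put on different storage stacks, so that they can be brought back in either
order. -/
theorem runs_swap (t t' : D) : Runs swapTrees (t.word ++ t'.word) (t'.word ++ t.word)
    (7 * (t.size + t'.size) + 10) := by
  intro m x y c i o
  obtain ⟨n₁, hn₁, e₁⟩ := exec_stash true t (t'.word ++ m) x y c i o
  obtain ⟨n₂, hn₂, e₂⟩ := exec_stash false t' m y (t.word.reverse ++ 2 :: x) c i o
  obtain ⟨n₃, hn₃, e₃⟩ := exec_unstash true t m x (t'.word.reverse ++ 2 :: y) c i o
  obtain ⟨n₄, hn₄, e₄⟩ := exec_unstash false t' (t.word ++ m) y x c i o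
  refine ⟨n₁ + (n₂ + (n₃ + n₄)), by omega, ?_⟩
  simp only [List.append_assoc]
  exact .seq e₁ (.seq e₂ (.seq e₃ e₄))

/-- Duplicates the top tree of the main stack. -/
def dupTree : WProg :=
  .seq (stash true) (.seq (.push .right 2)
    (.seq (unstashLoop true fun a => .seq (.push .main a) (.push .right a))
      (.seq (.push .left 2) (.seq (unstashLoop false fun a => .push .left a) (unstash true)))))

/-- Reading is destructive: on its way back from the first storage stack the tree is also written to
the second one, and this copy returns through the first stack, which restores the order of its
letters. -/
theorem runs_dup (t : D) : Runs dupTree t.word (t.word ++ t.word) (12 * t.size + 9) := by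
  intro m x y c i o
  obtain ⟨n₁, hn₁, e₁⟩ := exec_stash true t m x y c i o
  have e₂ := exec_push_store false 2 m y (t.word.reverse ++ 2 :: x) c i o
  obtain ⟨n₃, hn₃, e₃⟩ := exec_unstashLoop (β := true)
    (f := fun a => .seq (.push .main a) (.push .right a)) (g := fun a => [a]) (h := fun a => [a]) (τ := 2)
    (fun a m x y c i o => ⟨1 + 1, le_rfl, .seq (exec_push_main _ _ _ _ _ _ _ _)
      (exec_push_store false a (a :: m) y x c i o)⟩)
    t.word.reverse m x (2 :: y) c i o (fun a ha => D.mem_word (List.mem_reverse.1 ha))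
  have e₄ := exec_push_store true 2 (t.word ++ m) x (t.word ++ 2 :: y) c i o
  obtain ⟨n₅, hn₅, e₅⟩ := exec_unstashLoop (β := false)
    (f := fun a => .push .left a) (g := fun a => []) (h := fun a => [a]) (τ := 1)
    (fun a m x y c i o => ⟨1, le_rfl, exec_push_store true a m y x c i o⟩)
    t.word (t.word ++ m) y (2 :: x) c i o (fun a ha => D.mem_word ha)
  obtain ⟨n₆, hn₆, e₆⟩ := exec_unstash true t (t.word ++ m) x y c i o
  simp only [List.length_reverse, D.length_word] at hn₃ hn₅
  refine ⟨n₁ + (1 + (n₃ + (1 + (n₅ + n₆)))), by omega, ?_⟩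
  simp only [List.append_assoc]
  refine .seq e₁ (.seq e₂ (.seq (s' := st (t.word ++ m) x (t.word ++ 2 :: y) c i o) ?_
    (.seq e₄ (.seq ?_ e₆))))
  · rw [← Bool.not_true, stB_not]
    simpa using e₃
  · rw [← Bool.not_false, stB_not, stB_not]
    simpa [flatMap_nil_fun] using e₅

/-! ### Polynomial bounds -/

/-- Functions of polynomial growth. -/
def IsPoly (g : ℕ → ℕ) : Prop := ∃ c, ∀ s, g s ≤ (s + 2) ^ c

namespace IsPoly

/-- The base `s + 2` is at least `2` for every `s`, so a single exponent absorbs constants and sums.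
-/
theorem const (a : ℕ) : IsPoly fun _ => a :=
  ⟨a, fun s => (Nat.lt_two_pow_self).le.trans (Nat.pow_le_pow_left (by omega) a)⟩

theorem id : IsPoly fun s => s := ⟨1, fun s => by simp⟩

theorem add {g h : ℕ → ℕ} (hg : IsPoly g) (hh : IsPoly h) : IsPoly fun s => g s + h s := by
  obtain ⟨a, ha⟩ := hg
  obtain ⟨b, hb⟩ := hh
  refine ⟨a + b + 1, fun s => ?_⟩
  have h₁ : (s + 2) ^ a ≤ (s + 2) ^ (a + b) := Nat.pow_le_pow_right (by omega) (by omega)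
  have h₂ : (s + 2) ^ b ≤ (s + 2) ^ (a + b) := Nat.pow_le_pow_right (by omega) (by omega)
  have := ha s
  have := hb s
  rw [pow_succ]
  nlinarith

theorem mul {g h : ℕ → ℕ} (hg : IsPoly g) (hh : IsPoly h) : IsPoly fun s => g s * h s := by
  obtain ⟨a, ha⟩ := hg
  obtain ⟨b, hb⟩ := hh
  exact ⟨a + b, fun s => by rw [pow_add]; exact Nat.mul_le_mul (ha s) (hb s)⟩

theorem pow {g : ℕ → ℕ} (hg : IsPoly g) (c : ℕ) : IsPoly fun s => g s ^ c := by
  obtain ⟨a, ha⟩ := hg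
  exact ⟨a * c, fun s => by rw [pow_mul]; exact Nat.pow_le_pow_left (ha s) c⟩

end IsPoly

/-! ### Encodings and functions computable in polynomial time -/

/-- Types whose elements are written as trees. -/
class Enc (α : Type) where
  enc : α → D


/-- The size of the encoding. -/
def esize {α : Type} [Enc α] (a : α) : ℕ := (Enc.enc a).size

/-- The word that encodes an object. -/
def eword {α : Type} [Enc α] (a : α) : List Sym := (Enc.enc a).word

instance : Enc Unit := ⟨fun _ => .nil⟩

/-- Numbers are written in unary. -/
def encNat : ℕ → D
  | 0 => .nil
  | n + 1 => .cons .nil (encNat n)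

instance : Enc ℕ := ⟨encNat⟩

instance : Enc Bool := ⟨fun b => cond b (.cons .nil .nil) .nil⟩

section

variable {α β : Type} [Enc α] [Enc β]

instance : Enc (α × β) := ⟨fun p => .cons (Enc.enc p.1) (Enc.enc p.2)⟩

/-- The encoding of lists. -/
def encList : List α → D
  | [] => .nil
  | a :: l => .cons (Enc.enc a) (encList l)

instance : Enc (List α) := ⟨encList⟩

instance : Enc (Option α) := ⟨fun x => x.elim .nil fun a => .cons (Enc.enc a) .nil⟩

theorem esize_pos (a : α) : 1 ≤ esize a := D.size_pos _

theorem length_eword (a : α) : (eword a).length = esize a := D.length_word _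

@[simp] theorem esize_pair (a : α) (b : β) : esize (a, b) = esize a + esize b + 1 := rfl

@[simp] theorem esize_list_nil : esize ([] : List α) = 1 := rfl

@[simp] theorem esize_list_cons (a : α) (l : List α) :
    esize (a :: l) = esize a + esize l + 1 := rfl

@[simp] theorem esize_zero : esize 0 = 1 := rfl

@[simp] theorem esize_nat : (n : ℕ) → esize n = 2 * n + 1
  | 0 => rfl
  | n + 1 => by
      change 1 + esize n + 1 = _
      rw [esize_nat n]; ring

theorem esize_bool_le (b : Bool) : esize b ≤ 3 := by
  cases b
  · change 1 ≤ 3; omega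
  · change 3 ≤ 3; omega

@[simp] theorem esize_none : esize (none : Option α) = 1 := rfl

@[simp] theorem esize_some (a : α) : esize (some a) = esize a + 2 := rfl

theorem eword_pair (a : α) (b : β) : eword (a, b) = 1 :: (eword a ++ eword b) := rfl

theorem eword_cons (a : α) (l : List α) : eword (a :: l) = 1 :: (eword a ++ eword l) := rfl

theorem esize_append (l l' : List α) : esize (l ++ l') + 1 = esize l + esize l' := by
  induction l with
  | nil => simp; omega
  | cons a l ih => simp only [List.cons_append, esize_list_cons]; omega

theorem length_lt_esize (l : List α) : 2 * l.length + 1 ≤ esize l := by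
  induction l with
  | nil => simp
  | cons a l ih => simp only [List.length_cons, esize_list_cons]; have := esize_pos a; omega

theorem esize_le_of_forall {l : List α} {B : ℕ} (h : ∀ a ∈ l, esize a ≤ B) :
    esize l ≤ (B + 1) * l.length + 1 := by
  induction l with
  | nil => simp
  | cons a l ih =>
    have h₁ := h a (by simp)
    have h₂ := ih fun b hb => h b (by simp [hb])
    simp only [esize_list_cons, List.length_cons]
    nlinarith

end

/-- Functions that are computed by a program on the main stack in polynomial time. -/
def PT {α β : Type} [Enc α] [Enc β] (f : α → β) : Prop :=
  ∃ (p : WProg) (c : ℕ), ∀ x, esize (f x) ≤ (esize x + 2) ^ c ∧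
    Runs p (eword x) (eword (f x)) ((esize x + 2) ^ c)

section

variable {α β γ δ ε σ : Type} [Enc α] [Enc β] [Enc γ] [Enc δ] [Enc ε] [Enc σ]

theorem PT.of_poly {f : α → β} (p : WProg) {g : ℕ → ℕ} (hg : IsPoly g)
    (h₁ : ∀ x, esize (f x) ≤ g (esize x))
    (h₂ : ∀ x, Runs p (eword x) (eword (f x)) (g (esize x))) : PT f :=
  let ⟨c, hc⟩ := hg
  ⟨p, c, fun x => ⟨(h₁ x).trans (hc _), (h₂ x).mono (hc _)⟩⟩

/-- Change of type at no cost. It is used to identify truth values with lists of length at most one,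
unary numbers with lists of units, and nonempty lists with pairs. -/
theorem PT.of_enc_eq {f : α → β} (h : ∀ x, Enc.enc (f x) = Enc.enc x) : PT f := by
  refine PT.of_poly .skip (g := fun s => s + 1) (IsPoly.id.add (.const 1)) (fun x => ?_) fun x => ?_
  · unfold esize; rw [h]; omega
  · unfold eword
    rw [h]
    exact (runs_skip _).mono (by omega)

theorem PT.id : PT fun x : α => x := PT.of_enc_eq fun _ => rfl

theorem PT.comp {f : β → γ} {g : α → β} (hf : PT f) (hg : PT g) : PT fun x => f (g x) := by
  obtain ⟨p, a, hp⟩ := hf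
  obtain ⟨q, b, hq⟩ := hg
  refine PT.of_poly (.seq q p) (g := fun s => (s + 2) ^ b + ((s + 2) ^ b + 2) ^ a) ?_ ?_ ?_
  · exact ((IsPoly.id.add (.const 2)).pow b).add ((((IsPoly.id.add (.const 2)).pow b).add
      (.const 2)).pow a)
  · intro x
    have h₁ := (hp (g x)).1
    have h₂ : (esize (g x) + 2) ^ a ≤ ((esize x + 2) ^ b + 2) ^ a :=
      Nat.pow_le_pow_left (by have := (hq x).1; omega) a
    omega
  · intro x
    have h₂ : (esize (g x) + 2) ^ a ≤ ((esize x + 2) ^ b + 2) ^ a :=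
      Nat.pow_le_pow_left (by have := (hq x).1; omega) a
    exact (hq x).2.seq ((hp (g x)).2.mono h₂)

/-- Pushes a word. -/
def pushWord : List Sym → WProg
  | [] => .skip
  | a :: l => .seq (pushWord l) (.push .main a)

theorem runs_pushWord (w u : List Sym) : Runs (pushWord w) u (w ++ u) (w.length + 1) := by
  induction w with
  | nil => exact runs_skip u
  | cons a w ih => exact ih.seq (runs_push a _)

theorem PT.const (b : β) : PT fun _ : α => b := by
  refine PT.of_poly (.seq dropTree (pushWord (eword b)))
    (g := fun s => 5 * s + 3 + (esize b + 1)) ?_ (fun x => by omega) fun x => ?_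
  · exact (((IsPoly.const 5).mul .id).add (.const 3)).add (.const _)
  · refine Runs.seq (v := []) ?_ ?_
    · simpa [eword, esize] using runs_drop (Enc.enc x) []
    · have := runs_pushWord (eword b) []
      rwa [length_eword, List.append_nil] at this

theorem PT.pair {f : α → β} {g : α → γ} (hf : PT f) (hg : PT g) : PT fun x => (f x, g x) := by
  obtain ⟨p, a, hp⟩ := hf
  obtain ⟨q, b, hq⟩ := hg
  refine PT.of_poly (.seq dupTree (.seq q (.seq swapTrees (.seq p (.push .main 1)))))
    (g := fun s => (12 * s + 9) + ((s + 2) ^ b + ((7 * ((s + 2) ^ b + s) + 10) +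
      ((s + 2) ^ a + 1)))) ?_ ?_ ?_
  · have h := IsPoly.id.add (.const 2)
    exact (((IsPoly.const 12).mul .id).add (.const 9)).add ((h.pow b).add
      ((((IsPoly.const 7).mul ((h.pow b).add .id)).add (.const 10)).add ((h.pow a).add (.const 1))))
  · intro x
    have h₁ := (hp x).1
    have h₂ := (hq x).1
    simp only [esize_pair]
    omega
  · intro x
    refine (runs_dup (Enc.enc x)).seq (((hq x).2.append_right (eword x)).seq (Runs.seq ?_
      (((hp x).2.append_right (eword (g x))).seq (runs_push 1 _))))
    refine (runs_swap (Enc.enc (g x)) (Enc.enc x)).mono ?_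
    have h₂ := (hq x).1
    unfold esize at *
    omega

theorem PT.fst : PT (Prod.fst : α × β → α) := by
  refine PT.of_poly (.seq popMain (.seq swapTrees dropTree))
    (g := fun s => 2 + ((7 * s + 10) + (5 * s + 3)))
    ?_ ?_ ?_
  · exact (IsPoly.const 2).add ((((IsPoly.const 7).mul .id).add (.const 10)).add
      (((IsPoly.const 5).mul .id).add (.const 3)))
  · rintro ⟨a, b⟩
    simp only [esize_pair]
    omega
  · rintro ⟨a, b⟩
    rw [eword_pair]
    refine (runs_pop _ _).seq (Runs.seq ((runs_swap (Enc.enc a) (Enc.enc b)).mono ?_)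
      ((runs_drop (Enc.enc b) _).mono ?_))
    · rw [esize_pair]; unfold esize; omega
    · rw [esize_pair]; unfold esize; omega

theorem PT.snd : PT (Prod.snd : α × β → β) := by
  refine PT.of_poly (.seq popMain dropTree) (g := fun s => 2 + (5 * s + 3)) ?_ ?_ ?_
  · exact (IsPoly.const 2).add (((IsPoly.const 5).mul .id).add (.const 3))
  · rintro ⟨a, b⟩
    simp only [esize_pair]
    omega
  · rintro ⟨a, b⟩
    rw [eword_pair]
    refine (runs_pop _ _).seq ((runs_drop (Enc.enc a) _).mono ?_)
    rw [esize_pair]; unfold esize; omega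

theorem PT.cons {f : α → β} {g : α → List β} (hf : PT f) (hg : PT g) :
    PT fun x => f x :: g x :=
  PT.comp (f := fun p : β × List β => p.1 :: p.2) (PT.of_enc_eq fun _ => rfl) (hf.pair hg)

/-- The first letter of the word of a list shows whether the list is empty. With the list paired in
front of the argument, one pop selects the branch, and a swap restores the argument order that `h`
expects. -/
theorem PT.list_cases {l : α → List β} {g : α → γ} {h : α × β × List β → γ}
    (hl : PT l) (hg : PT g) (hh : PT h) :
    PT fun x => match l x with
      | [] => g x
      | b :: t => h (x, b, t) := by
  obtain ⟨p, a, hp⟩ := hg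
  obtain ⟨q, c, hq⟩ := hh
  suffices hF : PT fun y : List β × α => match y.1 with
      | [] => g y.2
      | b :: t => h (y.2, b, t) from hF.comp (hl.pair PT.id)
  have h2 := IsPoly.id.add (.const 2)
  refine PT.of_poly (.seq popMain (.case .main fun r => match r with
    | some 1 => .seq (.push .main 1) (.seq swapTrees (.seq (.push .main 1) q))
    | _ => p)) (g := fun s => 2 + ((s + 2) ^ a + 1 + ((1 + ((7 * s + 10) + (1 + (s + 2) ^ c))) + 1)))
    ?_ ?_ ?_
  · exact (IsPoly.const 2).add (((h2.pow a).add (.const 1)).add (((IsPoly.const 1).add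
      ((((IsPoly.const 7).mul .id).add (.const 10)).add ((IsPoly.const 1).add (h2.pow c)))).add
      (.const 1)))
  · rintro ⟨_ | ⟨b, t⟩, x⟩
    · have h₁ := (hp x).1
      have h₂ : (esize x + 2) ^ a ≤ (esize (([] : List β), x) + 2) ^ a :=
        Nat.pow_le_pow_left (by simp; omega) a
      dsimp only
      omega
    · have h₁ := (hq (x, b, t)).1
      have h₂ : esize (x, b, t) = esize (b :: t, x) := by simp; omega
      rw [h₂] at h₁
      dsimp only
      omega
  · rintro ⟨_ | ⟨b, t⟩, x⟩
    · have h₂ : (esize x + 2) ^ a ≤ (esize (([] : List β), x) + 2) ^ a :=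
        Nat.pow_le_pow_left (by simp; omega) a
      refine ((runs_pop _ _).seq (runs_case (a := 0) (hp x).2)).mono ?_
      omega
    · have h₂ : esize (x, b, t) = esize (b :: t, x) := by simp; omega
      have hq' := (hq (x, b, t)).2
      rw [h₂] at hq'
      refine ((runs_pop _ _).seq (runs_case (a := 1) ((runs_push 1 _).seq
        (((runs_swap (Enc.enc (b, t)) (Enc.enc x)).mono (T' := 7 * esize (b :: t, x) + 10) ?_).seq
          ((runs_push 1 _).seq hq'))))).mono ?_
      · have : (Enc.enc (b, t)).size + (Enc.enc x).size + 1 = esize (b :: t, x) := by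
          simp only [esize_pair, esize_list_cons]
          change esize (b, t) + esize x + 1 = _
          simp only [esize_pair]
        omega
      · omega

/-- A loop over the elements of a list, for a state of polynomially bounded size. -/
theorem PT.foldl_of_bound {f : β × σ → σ} (hf : PT f) {g : ℕ → ℕ} (hg : IsPoly g)
    (hb : ∀ (l₁ l₂ : List β) (s : σ),
      esize (l₁.foldl (fun s b => f (b, s)) s) ≤ g (esize (l₁ ++ l₂, s))) :
    PT fun y : List β × σ => y.1.foldl (fun s b => f (b, s)) y.2 := by
  obtain ⟨p, a, hp⟩ := hf
  -- With `b`, the rest `l` and the state `s` on the stack, swapping `l` and `s` below `b` makes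
  -- `(b, s)` available to `p`; the final swap returns `l` to the top.
  let body : WProg := .seq (dip swapTrees) (.seq (.push .main 1) (.seq p swapTrees))
  let loop : WProg := .loop .main (fun r => decide (r ≠ some 1)) fun _ => body
  -- all intermediate data is bounded by `B`
  let τ : ℕ → ℕ := fun B => ((7 * (B + B) + 10) + (7 * B + 5)) + (1 + ((B + B + 3) ^ a +
    (7 * (B + B) + 10))) + 1
  have key : ∀ (B : ℕ) (l : List β) (s : σ), esize l ≤ B →
      (∀ l₁ l₂, l = l₁ ++ l₂ → esize (l₁.foldl (fun s b => f (b, s)) s) ≤ B) →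
      Runs loop (eword l ++ eword s) (eword (l.foldl (fun s b => f (b, s)) s))
        (l.length * τ B + 1) := by
    intro B l
    induction l with
    | nil =>
      intro s _ _ m x y c i o
      refine ⟨1, by omega, ?_⟩
      exact Exec.loop_exit_cons (k := WK.main) (a := (0 : Sym)) (l := eword s ++ m)
        rfl (update_stB_main _ _ _ _ _ _ _ _) (by decide)
    | cons b l ih =>
      intro s hl hs m x y c i o
      have hb' : esize b + esize l + 1 ≤ B := by simpa using hl
      have hs0 : esize s ≤ B := hs [] (b :: l) rfl
      have hs1 : esize (f (b, s)) ≤ B := hs [b] l rfl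
      have hbody : Runs body (eword b ++ (eword l ++ eword s)) (eword l ++ eword (f (b, s)))
          (τ B - 1) := by
        have h₁ := (runs_dip (runs_swap (Enc.enc l) (Enc.enc s)) (Enc.enc b)).mono
          (T' := (7 * (B + B) + 10) + (7 * B + 5)) (by unfold esize at *; omega)
        have h₂ := runs_push 1 (eword b ++ (eword s ++ eword l))
        have h₃ := ((hp (b, s)).2.mono (T' := (B + B + 3) ^ a)
          (Nat.pow_le_pow_left (by simp; omega) a)).append_right (eword l)
        have h₄ := (runs_swap (Enc.enc (f (b, s))) (Enc.enc l)).mono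
          (T' := 7 * (B + B) + 10) (by unfold esize at *; omega)
        rw [eword_pair, List.cons_append, List.append_assoc] at h₃
        exact h₁.seq (h₂.seq (h₃.seq h₄))
      obtain ⟨n₁, hn₁, e₁⟩ := hbody m x y c i o
      obtain ⟨n₂, hn₂, e₂⟩ := ih (f (b, s)) (by omega)
        (fun l₁ l₂ h => by simpa using hs (b :: l₁) l₂ (by simp [h])) m x y c i o
      refine ⟨n₁ + n₂ + 1, ?_, ?_⟩
      · have : 1 ≤ τ B := by simp only [τ]; omega
        simp only [List.length_cons, Nat.add_mul, Nat.one_mul]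
        omega
      · refine Exec.loop_step_cons (k := WK.main) (a := (1 : Sym))
          (l := (eword b ++ (eword l ++ eword s)) ++ m) ?_ (update_stB_main _ _ _ _ _ _ _ _)
          (by decide) e₁ e₂
        rw [eword_cons]
        simp
  have hG : IsPoly fun s => g s + s := hg.add .id
  refine PT.of_poly (.seq popMain loop)
    (g := fun s => (g s + s) + (2 + (s * τ (g s + s) + 1))) ?_ ?_ ?_
  · exact hG.add ((IsPoly.const 2).add ((IsPoly.id.mul
      ((((((IsPoly.const 7).mul (hG.add hG)).add (.const 10)).add
      (((IsPoly.const 7).mul hG).add (.const 5))).add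
      ((IsPoly.const 1).add ((((hG.add hG).add (.const 3)).pow a).add
      (((IsPoly.const 7).mul (hG.add hG)).add (.const 10))))).add (.const 1))).add (.const 1)))
  · rintro ⟨l, s⟩
    have := hb l [] s
    rw [List.append_nil] at this
    dsimp only
    omega
  · rintro ⟨l, s⟩
    have h := key (g (esize (l, s)) + esize (l, s)) l s (by simp; omega) fun l₁ l₂ hl => by
      have := hb l₁ l₂ s
      rw [← hl] at this
      omega
    refine ((runs_pop _ _).seq h).mono ?_
    have h₁ : l.length ≤ esize (l, s) := by
      have := length_lt_esize l
      simp; omega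
    have := Nat.mul_le_mul_right (τ (g (esize (l, s)) + esize (l, s))) h₁
    omega

/-- A loop over the elements of a list with a parameter, for a state whose growth in each step is
bounded in terms of the parameter and the list element. -/
theorem PT.foldl {f : α → σ → β → σ} {l : α → List β} {s : α → σ}
    (hf : PT fun y : α × σ × β => f y.1 y.2.1 y.2.2) {g : ℕ → ℕ} (hg : IsPoly g)
    (hgrow : ∀ x s b, esize (f x s b) ≤ esize s + g (esize x + esize b))
    (hl : PT l) (hs : PT s) : PT fun x => (l x).foldl (f x) (s x) := by
  obtain ⟨c, hc⟩ := hg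
  have hF : PT fun y : β × (α × σ) => (y.2.1, f y.2.1 y.2.2 y.1) :=
    (PT.fst.comp PT.snd).pair (hf.comp ((PT.fst.comp PT.snd).pair
      ((PT.snd.comp PT.snd).pair PT.fst)))
  have hfold : ∀ (l : List β) (x : α) (s : σ),
      l.foldl (fun z b => (fun y : β × (α × σ) => (y.2.1, f y.2.1 y.2.2 y.1)) (b, z)) (x, s) =
        (x, l.foldl (f x) s) := by
    intro l
    induction l with
    | nil => intro x s; rfl
    | cons b l ih => intro x s; exact ih x (f x s b)
  -- The parameter is fixed along the fold, so every step adds at most `(B + 2) ^ c`. The growth is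
  -- additive, hence polynomial after `l₁.length` steps.
  have hsz : ∀ (l₁ l₂ : List β) (x : α) (s : σ) (B : ℕ), esize x + esize (l₁ ++ l₂) ≤ B →
      esize (l₁.foldl (f x) s) ≤ esize s + l₁.length * (B + 2) ^ c := by
    intro l₁
    induction l₁ with
    | nil => intro l₂ x s B _; simp
    | cons b l₁ ih =>
      intro l₂ x s B hB
      simp only [List.cons_append, esize_list_cons] at hB
      have h₁ := ih l₂ x (f x s b) B (by omega)
      have h₂ := hgrow x s b
      have h₃ := hc (esize x + esize b)
      have h₄ : (esize x + esize b + 2) ^ c ≤ (B + 2) ^ c := Nat.pow_le_pow_left (by omega) c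
      simp only [List.foldl_cons, List.length_cons, Nat.add_mul, Nat.one_mul]
      omega
  have main := PT.foldl_of_bound (σ := α × σ) hF (g := fun s => s + s * (s + 2) ^ c + s + 1)
    (((IsPoly.id.add (IsPoly.id.mul ((IsPoly.id.add (.const 2)).pow c))).add .id).add (.const 1))
    (by
      rintro l₁ l₂ ⟨x, s⟩
      rw [hfold]
      have h₁ := hsz l₁ l₂ x s (esize (l₁ ++ l₂, (x, s))) (by simp; omega)
      have h₂ : l₁.length ≤ esize (l₁ ++ l₂, (x, s)) := by
        have := length_lt_esize (l₁ ++ l₂)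
        simp at this ⊢; omega
      have h₃ := Nat.mul_le_mul_right ((esize (l₁ ++ l₂, (x, s)) + 2) ^ c) h₂
      have h₄ : esize s ≤ esize (l₁ ++ l₂, (x, s)) := by simp; omega
      have h₅ : esize x ≤ esize (l₁ ++ l₂, (x, s)) := by simp; omega
      rw [esize_pair (a := x)]
      omega)
  have := PT.snd.comp (main.comp (hl.pair (PT.id.pair hs)))
  simpa only [hfold] using this

end

/-! ### Basic functions that are computable in polynomial time -/

namespace PT

variable {α β γ σ : Type} [Enc α] [Enc β] [Enc γ] [Enc σ]

theorem of_eq {f g : α → β} (hf : PT f) (h : ∀ x, f x = g x) : PT g := by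
  rwa [← funext h]

theorem cond {b : α → Bool} {f g : α → β} (hb : PT b) (hf : PT f) (hg : PT g) :
    PT fun x => bif b x then f x else g x := by
  have hl : PT fun x => (bif b x then [()] else [] : List Unit) :=
    PT.comp (f := fun b : Bool => (bif b then [()] else [] : List Unit))
      (PT.of_enc_eq fun b => by cases b <;> rfl) hb
  refine (PT.list_cases (h := fun y : α × Unit × List Unit => f y.1) hl hg
    (hf.comp PT.fst)).of_eq fun x => ?_
  cases b x <;> rfl

theorem ite {b : α → Prop} [DecidablePred b] {f g : α → β} (hb : PT fun x => decide (b x))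
    (hf : PT f) (hg : PT g) : PT fun x => if b x then f x else g x := by
  refine (hb.cond hf hg).of_eq fun x => ?_
  by_cases h : b x <;> simp [h]

theorem not {b : α → Bool} (hb : PT b) : PT fun x => !(b x) := by
  refine (hb.cond (PT.const false) (PT.const true)).of_eq fun x => ?_
  cases b x <;> rfl

theorem option_cases {o : α → Option β} {g : α → γ} {h : α × β → γ} (ho : PT o) (hg : PT g)
    (hh : PT h) : PT fun x => match o x with
      | none => g x
      | some b => h (x, b) := by
  have hl : PT fun x => (o x).toList :=
    PT.comp (f := Option.toList) (PT.of_enc_eq fun o => by cases o <;> rfl) ho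
  refine (PT.list_cases (h := fun y : α × β × List β => h (y.1, y.2.1)) hl hg
    (hh.comp (PT.fst.pair (PT.fst.comp PT.snd)))).of_eq fun x => ?_
  cases o x <;> rfl

theorem some {f : α → β} (hf : PT f) : PT fun x => some (f x) :=
  PT.comp (f := fun l : List β × Unit => (match l.1 with | [] => none | b :: _ => Option.some b))
    (PT.list_cases (h := fun y : (List β × Unit) × β × List β => Option.some y.2.1) PT.fst
      (PT.const none) (PT.comp (f := fun b : β × Unit => Option.some b.1)
        (PT.of_enc_eq fun _ => rfl) ((PT.fst.comp PT.snd).pair (PT.const ()))))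
    ((hf.cons (PT.const [])).pair (PT.const ()))

theorem units : PT fun n : ℕ => List.replicate n () := by
  refine PT.of_enc_eq fun n => ?_
  induction n with
  | zero => rfl
  | succ n ih =>
    change D.cons .nil (Enc.enc (List.replicate n ())) = D.cons .nil (encNat n)
    rw [ih]; rfl

theorem of_units {f : α → List Unit} (hf : PT f) : PT fun x => (f x).length := by
  refine PT.comp (f := fun l : List Unit => l.length) (PT.of_enc_eq fun l => ?_) hf
  induction l with
  | nil => rfl
  | cons a l ih =>
    change D.cons .nil (Enc.enc l.length) = D.cons .nil (Enc.enc l)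
    rw [ih]

theorem succ {f : α → ℕ} (hf : PT f) : PT fun x => f x + 1 :=
  (of_units ((PT.const ()).cons (units.comp hf))).of_eq fun x => by simp

theorem tail {f : α → List β} (hf : PT f) : PT fun x => (f x).tail := by
  refine (PT.list_cases (h := fun y : α × β × List β => y.2.2) hf (PT.const [])
    (PT.snd.comp PT.snd)).of_eq fun x => ?_
  cases f x <;> rfl

theorem pred {f : α → ℕ} (hf : PT f) : PT fun x => f x - 1 :=
  (of_units (units.comp hf).tail).of_eq fun x => by simp

theorem isEmpty {f : α → List β} (hf : PT f) : PT fun x => (f x).isEmpty := by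
  refine (PT.list_cases (h := fun _ : α × β × List β => false) hf (PT.const true)
    (PT.const _)).of_eq fun x => ?_
  cases f x <;> rfl

theorem eq_zero {f : α → ℕ} (hf : PT f) : PT fun x => decide (f x = 0) := by
  refine (units.comp hf).isEmpty.of_eq fun x => ?_
  cases f x <;> rfl

/-- An iteration is a fold over a list of `n x` units; this is affordable because numbers are unary.
-/
theorem nat_iterate {f : α → σ → σ} {n : α → ℕ} {s : α → σ}
    (hf : PT fun y : α × σ => f y.1 y.2) {g : ℕ → ℕ} (hg : IsPoly g) (hm : Monotone g)
    (hgrow : ∀ x s, esize (f x s) ≤ esize s + g (esize x)) (hn : PT n) (hs : PT s) :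
    PT fun x => (f x)^[n x] (s x) := by
  have := PT.foldl (f := fun x s (_ : Unit) => f x s) (l := fun x => List.replicate (n x) ())
    (s := s) (hf.comp (PT.fst.pair (PT.fst.comp PT.snd))) hg
    (fun x s b => (hgrow x s).trans (Nat.add_le_add_left (hm (by omega)) _)) (units.comp hn) hs
  refine this.of_eq fun x => ?_
  generalize s x = a
  induction n x generalizing a with
  | zero => rfl
  | succ m ih => exact ih _

theorem add {f g : α → ℕ} (hf : PT f) (hg : PT g) : PT fun x => f x + g x := by
  refine (nat_iterate (f := fun _ (s : ℕ) => s + 1) (succ PT.snd) (IsPoly.const 2)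
    monotone_const (fun x s => by simp only [esize_nat]; omega) hg hf).of_eq fun x => ?_
  induction g x with
  | zero => rfl
  | succ n ih => rw [Function.iterate_succ_apply', ih]; rfl

theorem sub {f g : α → ℕ} (hf : PT f) (hg : PT g) : PT fun x => f x - g x := by
  refine (nat_iterate (f := fun _ (s : ℕ) => s - 1) (pred PT.snd) (IsPoly.const 0)
    monotone_const (fun x s => by simp only [esize_nat]; omega) hg hf).of_eq fun x => ?_
  induction g x with
  | zero => rfl
  | succ n ih => rw [Function.iterate_succ_apply', ih]; omega

theorem mul {f g : α → ℕ} (hf : PT f) (hg : PT g) : PT fun x => f x * g x := by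
  have h : PT fun y : ℕ × ℕ => y.1 * y.2 := by
    refine (nat_iterate (α := ℕ × ℕ) (f := fun y (s : ℕ) => s + y.1)
      (add PT.snd (PT.fst.comp PT.fst)) IsPoly.id monotone_id
      (fun x s => ?_) PT.snd (PT.const 0)).of_eq fun x => ?_
    · obtain ⟨a, b⟩ := x
      simp; omega
    · obtain ⟨a, b⟩ := x
      dsimp only
      induction b with
      | zero => rfl
      | succ n ih => rw [Function.iterate_succ_apply', ih]; rfl
  exact h.comp (hf.pair hg)

theorem max {f g : α → ℕ} (hf : PT f) (hg : PT g) : PT fun x => max (f x) (g x) :=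
  (hf.add (hg.sub hf)).of_eq fun x => by omega

theorem min {f g : α → ℕ} (hf : PT f) (hg : PT g) : PT fun x => min (f x) (g x) :=
  (hf.sub (hf.sub hg)).of_eq fun x => by omega

theorem nat_eq {f g : α → ℕ} (hf : PT f) (hg : PT g) : PT fun x => decide (f x = g x) :=
  (eq_zero ((hf.sub hg).add (hg.sub hf))).of_eq fun x => by
    rw [decide_eq_decide]; omega

theorem nat_lt {f g : α → ℕ} (hf : PT f) (hg : PT g) : PT fun x => decide (f x < g x) :=
  (eq_zero (hf.succ.sub hg)).of_eq fun x => by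
    rw [decide_eq_decide]; omega

theorem div_const {f : α → ℕ} (hf : PT f) (c : ℕ) (hc : 1 ≤ c) : PT fun x => f x / c := by
  have := nat_iterate (f := fun _ (s : ℕ × ℕ) => if s.1 + 1 = c then (0, s.2 + 1) else (s.1 + 1, s.2))
    (PT.ite (nat_eq (succ (PT.fst.comp PT.snd)) (PT.const c))
      ((PT.const 0).pair (succ (PT.snd.comp PT.snd)))
      ((succ (PT.fst.comp PT.snd)).pair (PT.snd.comp PT.snd))) (IsPoly.const 2)
    monotone_const (fun x s => by
      obtain ⟨a, b⟩ := s
      dsimp only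
      split_ifs <;> simp <;> omega) hf (PT.const (0, 0))
  refine (PT.snd.comp this).of_eq fun x => ?_
  -- The state is the pair of remainder and quotient, updated while counting up to `n`.
  suffices h : ∀ n : ℕ, (fun s : ℕ × ℕ => if s.1 + 1 = c then (0, s.2 + 1) else (s.1 + 1, s.2))^[n]
      (0, 0) = (n % c, n / c) by rw [h]
  intro n
  induction n with
  | zero => simp
  | succ n ih =>
    rw [Function.iterate_succ_apply', ih]
    dsimp only
    have h₁ := Nat.div_add_mod n c
    have h₂ := Nat.mod_lt n (show 0 < c by omega)
    split_ifs with h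
    · have : n + 1 = c * (n / c + 1) := by rw [Nat.mul_add]; omega
      rw [this, Nat.mul_mod_right, Nat.mul_div_cancel_left _ (by omega)]
    · have : n + 1 = (n % c + 1) + c * (n / c) := by omega
      have hlt : n % c + 1 < c := by omega
      conv_rhs => rw [this]
      rw [Nat.add_mul_mod_self_left, Nat.add_mul_div_left _ _ (by omega),
        Nat.mod_eq_of_lt hlt, Nat.div_eq_of_lt hlt, Nat.zero_add]

theorem reverse {f : α → List β} (hf : PT f) : PT fun x => (f x).reverse := by
  have := PT.foldl (α := α) (f := fun _ (s : List β) (b : β) => b :: s) (l := f) (s := fun _ => [])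
    ((PT.snd.comp PT.snd).cons (PT.fst.comp PT.snd)) (g := fun s => s + 1)
    (IsPoly.id.add (.const 1)) (fun x s b => by simp; omega) hf (PT.const [])
  refine this.of_eq fun x => ?_
  simp

theorem append {f g : α → List β} (hf : PT f) (hg : PT g) : PT fun x => f x ++ g x := by
  have := PT.foldl (α := α) (f := fun _ (s : List β) (b : β) => b :: s)
    (l := fun x => (f x).reverse) (s := g)
    ((PT.snd.comp PT.snd).cons (PT.fst.comp PT.snd)) (g := fun s => s + 1)
    (IsPoly.id.add (.const 1)) (fun x s b => by simp; omega) hf.reverse hg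
  refine this.of_eq fun x => ?_
  simp [List.foldl_reverse]

theorem flatMap {l : α → List β} {g : α → β → List γ} (hl : PT l)
    (hg : PT fun y : α × β => g y.1 y.2) : PT fun x => (l x).flatMap (g x) := by
  obtain ⟨p, c, hc⟩ := _root_.id hg
  have := PT.foldl (α := α) (f := fun x (s : List γ) (b : β) => s ++ g x b)
    (l := l) (s := fun _ => [])
    ((PT.fst.comp PT.snd).append (hg.comp (PT.fst.pair (PT.snd.comp PT.snd))))
    (g := fun s => (s + 1 + 2) ^ c) (((IsPoly.id.add (.const 1)).add (.const 2)).pow c)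
    (fun x s b => by
      have h₁ := (hc (x, b)).1
      have h₂ := esize_append s (g x b)
      rw [esize_pair] at h₁
      dsimp only at h₁ ⊢
      omega) hl (PT.const [])
  refine this.of_eq fun x => ?_
  have h : ∀ (m : List β) (s : List γ), m.foldl (fun s b => s ++ g x b) s = s ++ m.flatMap (g x) := by
    intro m
    induction m with
    | nil => intro s; simp
    | cons b m ih => intro s; simp [ih]
  simpa using h (l x) []

theorem map {l : α → List β} {g : α → β → γ} (hl : PT l) (hg : PT fun y : α × β => g y.1 y.2) :
    PT fun x => (l x).map (g x) :=
  (hl.flatMap (g := fun x b => [g x b]) (hg.cons (PT.const []))).of_eq fun x => by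
    induction l x <;> simp_all

theorem length {l : α → List β} (hl : PT l) : PT fun x => (l x).length :=
  (of_units (hl.map (g := fun _ _ => ()) (PT.const ()))).of_eq fun x => by simp

theorem any {l : α → List β} {g : α → β → Bool} (hl : PT l) (hg : PT fun y : α × β => g y.1 y.2) :
    PT fun x => (l x).any (g x) :=
  (isEmpty (hl.flatMap (g := fun x b => bif g x b then [()] else [])
    (hg.cond (PT.const [()]) (PT.const [])))).not.of_eq fun x => by
    induction l x with
    | nil => simp
    | cons b l ih => cases h : g x b <;> simp_all

theorem all {l : α → List β} {g : α → β → Bool} (hl : PT l) (hg : PT fun y : α × β => g y.1 y.2) :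
    PT fun x => (l x).all (g x) :=
  (hl.any (g := fun x b => !(g x b)) hg.not).not.of_eq fun x => by
    induction l x <;> simp_all

theorem drop {l : α → List β} (hl : PT l) (k : ℕ) : PT fun x => (l x).drop k := by
  induction k with
  | zero => simpa using hl
  | succ k ih => exact ih.tail.of_eq fun x => by simp

theorem range {n : α → ℕ} (hn : PT n) : PT fun x => List.range (n x) := by
  -- The minimum with `n` never takes effect on the actual run. It bounds the growth on arbitrary
  -- states, as `nat_iterate` requires.
  have h := nat_iterate (α := ℕ) (f := fun n (s : List ℕ) => Min.min s.length n :: s)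
    (((length PT.snd).min PT.fst).cons PT.snd) (g := fun s => s + 1)
    (IsPoly.id.add (.const 1)) (fun a b h => by dsimp only; omega)
    (fun x s => by simp; omega) PT.id (PT.const [])
  refine (h.comp hn).reverse.of_eq fun x => ?_
  suffices h : ∀ m ≤ n x, (fun s : List ℕ => Min.min s.length (n x) :: s)^[m] [] =
      (List.range m).reverse by rw [h _ le_rfl, List.reverse_reverse]
  intro m hm
  induction m with
  | zero => rfl
  | succ m ih =>
    rw [Function.iterate_succ_apply', ih (by omega), List.range_succ]
    simp
    omega

end PT

/-! ### Reading a formula -/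

/-- The letters of formulas as numbers. -/
def CNFSym.toNat : CNFSym → ℕ
  | .tick => 0
  | .sign false => 1
  | .sign true => 2
  | .clauseEnd => 3

/-- One step of the parser, which reads a word from right to left. -/
def parseStep (o : Option CNF) (c : ℕ) : Option CNF :=
  match o with
  | none => none
  | some α =>
    if c = 3 then some ([] :: α) else
    match α with
    | [] => none
    | C :: α =>
      if c = 1 then some (((0, false) :: C) :: α) else
      if c = 2 then some (((0, true) :: C) :: α) else
      match C with
      | [] => none
      | l :: C => some (((l.1 + 1, l.2) :: C) :: α)

/-- The parser, applied to the reversed word. -/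
def parse (w : List ℕ) : Option CNF := w.foldl parseStep (some [])

/-- The letters of a word as numbers, in reversed order. -/
def revCode (w : List CNFSym) : List ℕ := (w.map CNFSym.toNat).reverse

theorem parse_revCode_cons (a : CNFSym) (w : List CNFSym) :
    parse (revCode (a :: w)) = parseStep (parse (revCode w)) a.toNat := by
  simp [parse, revCode]

/-- Together with `parse_encode` this shows that the parser accepts exactly the codes of formulas,
so that every other word can be rejected. -/
theorem encode_of_parse {w : List CNFSym} : ∀ {α : CNF}, parse (revCode w) = some α →
    α.encode = w := by
  induction w with
  | nil =>
    intro α h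
    have : α = [] := by simpa [parse, revCode, eq_comm] using h
    subst this
    rfl
  | cons a w ih =>
    intro α h
    rw [parse_revCode_cons] at h
    cases hp : parse (revCode w) with
    | none => simp [hp, parseStep] at h
    | some β =>
      rw [hp] at h
      have hβ := ih hp
      rcases a with _ | γ | _
      · rcases β with _ | ⟨_ | ⟨l, C⟩, β⟩
        · simp [parseStep, CNFSym.toNat] at h
        · simp [parseStep, CNFSym.toNat] at h
        · simp only [parseStep, CNFSym.toNat, OfNat.zero_ne_ofNat, if_false, zero_ne_one,
            Option.some.injEq] at h
          subst h
          subst hβ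
          simp [CNF.encode, Clause.encode, Literal.encode, List.replicate_succ]
      · rcases β with _ | ⟨C, β⟩
        · cases γ <;> simp [parseStep, CNFSym.toNat] at h
        · have : α = ((0, γ) :: C) :: β := by
            cases γ <;> simpa [parseStep, CNFSym.toNat, eq_comm] using h
          subst this
          subst hβ
          simp [CNF.encode, Clause.encode, Literal.encode]
      · have : α = [] :: β := by simpa [parseStep, CNFSym.toNat, eq_comm] using h
        subst this
        subst hβ
        simp [CNF.encode, Clause.encode]

theorem parse_literal (l : Literal) {w : List CNFSym} {C : Clause} {α : CNF}
    (h : parse (revCode w) = some (C :: α)) :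
    parse (revCode (Literal.encode l ++ w)) = some ((l :: C) :: α) := by
  obtain ⟨i, γ⟩ := l
  induction i with
  | zero =>
    have : Literal.encode (0, γ) ++ w = .sign γ :: w := by simp [Literal.encode]
    rw [this, parse_revCode_cons, h]
    cases γ <;> simp [parseStep, CNFSym.toNat]
  | succ i ih =>
    have : Literal.encode (i + 1, γ) ++ w = .tick :: (Literal.encode (i, γ) ++ w) := by
      simp [Literal.encode, List.replicate_succ]
    rw [this, parse_revCode_cons, ih]
    simp [parseStep, CNFSym.toNat]

theorem parse_encode (α : CNF) : parse (revCode α.encode) = some α := by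
  induction α with
  | nil => rfl
  | cons C α ih =>
    have h : CNF.encode (C :: α) = C.flatMap Literal.encode ++ .clauseEnd :: CNF.encode α := by
      simp [CNF.encode, Clause.encode]
    rw [h]
    induction C with
    | nil =>
      rw [List.flatMap_nil, List.nil_append, parse_revCode_cons, ih]
      simp [parseStep, CNFSym.toNat]
    | cons l C ihC =>
      rw [List.flatMap_cons, List.append_assoc]
      refine parse_literal l (ihC ?_)
      simp [CNF.encode, Clause.encode]

theorem pt_parse : PT parse := by
  refine (PT.foldl (α := List ℕ) (f := fun _ o c => parseStep o c) (l := fun w => w)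
    (s := fun _ => some []) ?_ (g := fun _ => 8) (.const 8) ?_ PT.id (PT.const _)).of_eq
    fun x => rfl
  · -- the parameters are the word, the state and the letter
    let X := List ℕ × Option CNF × ℕ
    have hc : PT fun y : X => y.2.2 := PT.snd.comp PT.snd
    have hlit : PT fun y : ((X × CNF) × Clause × CNF) × Literal × Clause =>
        some (((y.2.1.1 + 1, y.2.1.2) :: y.2.2) :: y.1.2.2) :=
      PT.some ((((PT.succ (PT.fst.comp (PT.fst.comp PT.snd))).pair
        (PT.snd.comp (PT.fst.comp PT.snd))).cons (PT.snd.comp PT.snd)).cons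
        (PT.snd.comp (PT.snd.comp PT.fst)))
    have hcl : PT fun y : (X × CNF) × Clause × CNF =>
        if y.1.1.2.2 = 1 then some (((0, false) :: y.2.1) :: y.2.2) else
        if y.1.1.2.2 = 2 then some (((0, true) :: y.2.1) :: y.2.2) else
        match y.2.1 with
        | [] => none
        | l :: C => some (((l.1 + 1, l.2) :: C) :: y.2.2) := by
      have hc' : PT fun y : (X × CNF) × Clause × CNF => y.1.1.2.2 :=
        hc.comp (PT.fst.comp PT.fst)
      refine PT.ite (hc'.nat_eq (PT.const 1))
        (PT.some (((PT.const (0, false)).cons (PT.fst.comp PT.snd)).cons (PT.snd.comp PT.snd)))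
        (PT.ite (hc'.nat_eq (PT.const 2))
        (PT.some (((PT.const (0, true)).cons (PT.fst.comp PT.snd)).cons (PT.snd.comp PT.snd))) ?_)
      refine (PT.list_cases (PT.fst.comp PT.snd) (PT.const none) hlit).of_eq ?_
      rintro ⟨y, _ | ⟨l, C⟩, α⟩ <;> rfl
    have hsome : PT fun y : X × CNF => if y.1.2.2 = 3 then some ([] :: y.2) else
        match y.2 with
        | [] => none
        | C :: α =>
          if y.1.2.2 = 1 then some (((0, false) :: C) :: α) else
          if y.1.2.2 = 2 then some (((0, true) :: C) :: α) else
          match C with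
          | [] => none
          | l :: C => some (((l.1 + 1, l.2) :: C) :: α) := by
      refine PT.ite ((hc.comp PT.fst).nat_eq (PT.const 3))
        (PT.some ((PT.const []).cons PT.snd)) ?_
      refine (PT.list_cases PT.snd (PT.const none) hcl).of_eq ?_
      rintro ⟨y, _ | ⟨C, α⟩⟩ <;> rfl
    refine (PT.option_cases (PT.fst.comp PT.snd) (PT.const none) hsome).of_eq ?_
    rintro ⟨w, _ | α, c⟩ <;> rfl
  -- One letter adds at most a new empty clause, a new literal with index `0`, or one unit to an
  -- index: a bounded amount.
  · intro w o c
    have hb : ∀ b : Bool, esize (0, b) ≤ 5 := fun b => by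
      have := esize_bool_le b
      simp only [esize_pair, esize_zero]; omega
    rcases o with _ | α
    · simp [parseStep]
    · have h₁ := hb false
      have h₂ := hb true
      simp only [parseStep]
      rcases α with _ | ⟨C, α⟩
      · split_ifs <;> simp
      · rcases C with _ | ⟨⟨i, γ⟩, C⟩
        · split_ifs <;> simp_all <;> omega
        · split_ifs <;> simp_all <;> omega

/-! ### The size parameter of a formula -/

/-- The largest index of a variable. -/
def maxVar (α : CNF) : ℕ := (α.flatMap fun C => C.map Prod.fst).foldl max 0

theorem foldl_max_le {l : List ℕ} {a b : ℕ} (ha : a ≤ b) (h : ∀ x ∈ l, x ≤ b) :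
    l.foldl max a ≤ b := by
  induction l generalizing a with
  | nil => exact ha
  | cons x l ih => exact ih (max_le ha (h x (by simp))) fun y hy => h y (by simp [hy])

theorem le_foldl_max (l : List ℕ) (a : ℕ) : a ≤ l.foldl max a ∧ ∀ x ∈ l, x ≤ l.foldl max a := by
  induction l generalizing a with
  | nil => simp
  | cons y l ih =>
    obtain ⟨h₁, h₂⟩ := ih (max a y)
    refine ⟨(le_max_left _ _).trans h₁, fun x hx => ?_⟩
    rcases List.mem_cons.1 hx with rfl | hx
    · exact (le_max_right _ _).trans h₁
    · exact h₂ x hx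

theorem le_maxVar {α : CNF} {C : Clause} (hC : C ∈ α) {l : Literal} (hl : l ∈ C) :
    l.1 ≤ maxVar α :=
  (le_foldl_max _ 0).2 _ (List.mem_flatMap.2 ⟨C, hC, List.mem_map.2 ⟨l, hl, rfl⟩⟩)

theorem maxVar_le {α : CNF} {b : ℕ} (h : ∀ C ∈ α, ∀ l ∈ C, l.1 ≤ b) : maxVar α ≤ b := by
  refine foldl_max_le (Nat.zero_le _) fun x hx => ?_
  obtain ⟨C, hC, hx⟩ := List.mem_flatMap.1 hx
  obtain ⟨l, hl, rfl⟩ := List.mem_map.1 hx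
  exact h C hC l hl

theorem pt_maxVar : PT maxVar :=
  PT.foldl (α := CNF) (f := fun _ s b => max s b) (s := fun _ => 0)
    ((PT.fst.comp PT.snd).max (PT.snd.comp PT.snd)) IsPoly.id
    (fun x s b => by simp only [esize_nat]; omega)
    (PT.flatMap (α := CNF) PT.id (g := fun _ (C : Clause) => C.map Prod.fst)
      (PT.map (α := CNF × Clause) PT.snd (g := fun _ (l : Literal) => l.1) (PT.fst.comp PT.snd)))
    (PT.const 0)

/-- The number of blocks of `q` variables for a formula with at most `Ct` clauses per variable. -/
def blocks (Ct q : ℕ) (α : CNF) : ℕ := max (maxVar α / q) (α.length / (Ct * q)) + 1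

theorem pt_blocks {Ct q : ℕ} (hCt : 1 ≤ Ct) (hq : 1 ≤ q) : PT (blocks Ct q) :=
  ((pt_maxVar.div_const q hq).max ((PT.length PT.id).div_const (Ct * q)
    (Nat.mul_pos hCt hq))).succ

theorem lt_blocks {Ct q : ℕ} (hq : 1 ≤ q) {α : CNF} {C : Clause} (hC : C ∈ α)
    {l : Literal} (hl : l ∈ C) : l.1 < q * blocks Ct q α := by
  have h₁ := le_maxVar hC hl
  have h₂ := Nat.lt_mul_div_succ (maxVar α) (show 0 < q by omega)
  have h₃ : q * (maxVar α / q + 1) ≤ q * blocks Ct q α :=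
    Nat.mul_le_mul_left _ (Nat.succ_le_succ (le_max_left _ _))
  omega

theorem length_le_blocks {Ct q : ℕ} (hCt : 1 ≤ Ct) (hq : 1 ≤ q) (α : CNF) :
    α.length ≤ Ct * (q * blocks Ct q α) := by
  have h₂ := Nat.lt_mul_div_succ α.length (show 0 < Ct * q from Nat.mul_pos hCt hq)
  have h₃ : Ct * q * (α.length / (Ct * q) + 1) ≤ Ct * q * blocks Ct q α :=
    Nat.mul_le_mul_left _ (Nat.succ_le_succ (le_max_right _ _))
  rw [← Nat.mul_assoc]
  omega

/-- The number of blocks is computed from the formula alone. For sparse formulas, rounding up to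
full blocks adds at most `q` variables to `n`, which later costs only a constant factor. -/
theorem blocks_le {k Ct q n : ℕ} (hCt : 1 ≤ Ct) {α : CNF} (hα : α ∈ sparseCNF k Ct n) :
    blocks Ct q α ≤ n / q + 1 := by
  obtain ⟨-, h₁, h₂⟩ := hα
  refine Nat.succ_le_succ (max_le ?_ ?_)
  · exact Nat.div_le_div_right (maxVar_le fun C hC l hl => (h₁ C hC l hl).le)
  · refine (Nat.div_le_div_right h₂).trans ?_
    rw [Nat.mul_div_mul_left _ _ (by omega)]

/-! ### The word of the network of a formula -/

/-- The word of a layer with `m` inputs and `h` outputs, as a list of numbers: the numbers up to `6`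
stand for weights, `7` ends a row and `8` ends the layer. -/
def layerCode (e : ℕ → ℕ → ℕ) (b : ℕ → ℕ) (h m : ℕ) : List ℕ :=
  ((List.range h).flatMap fun i => (List.range m).map (e i) ++ [b i, 7]) ++ [8]

theorem PT.layerCode {α : Type} [Enc α] {e : α → ℕ → ℕ → ℕ} {b : α → ℕ → ℕ} {h m : α → ℕ}
    (he : PT fun y : (α × ℕ) × ℕ => e y.1.1 y.1.2 y.2) (hb : PT fun y : α × ℕ => b y.1 y.2)
    (hh : PT h) (hm : PT m) : PT fun x => layerCode (e x) (b x) (h x) (m x) :=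
  PT.append (PT.flatMap (PT.range hh)
    (g := fun x i => (List.range (m x)).map (e x i) ++ [b x i, 7])
    (PT.append (PT.map (PT.range (hm.comp PT.fst)) (g := fun (y : α × ℕ) j => e y.1 y.2 j) he)
      (hb.cons (PT.const [7])))) (PT.const [8])

/-- The first layer: the two parts of the hat function, twice each, at the last coordinate. -/
def firstEntry (d i j : ℕ) : ℕ := if j + 1 = d then (if i < 2 then 2 else if i < 4 then 1 else 0) else 0

/-- Letters are those of `weightVal`: `1, …, 6` stand for `1`, `-1`, `δ`, `-(1 - δ)`, `δ⁻¹`, `-δ⁻¹`.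
Neurons `0`, `1` hold the ramp `max 0 (δ - t)` and neurons `2`, `3` the ramp `max 0 (t - (1 - δ))`.
They are duplicated to produce the factor `2 * δ⁻¹` from the weight `δ⁻¹`. -/
def firstBias (i : ℕ) : ℕ := if i < 2 then 3 else if i < 4 then 4 else 0

/-- One more application of the hat function; the previous values are shifted. -/
def shiftEntry (i j : ℕ) : ℕ :=
  if i < 2 then (if j = 0 then 5 else if j = 2 then 5 else 0) else
  if i < 4 then (if j = 0 then 6 else if j = 2 then 6 else 0) else
  if i = 4 then (if j < 4 then 6 else 0) else
  if i = 5 then (if j < 4 then 5 else 0) else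
  if j + 2 = i then 1 else 0

/-- With `s = 1 - δ⁻¹ * (x 0 + x 2)` the next iterate, rows `0` to `3` give `δ - s` and `s - (1 -
δ)`. Rows `4` and `5` sum both copies and give `2 * s - 1` and `1 - 2 * s`; the later rows move
earlier values on by two places. -/
def shiftBias (i : ℕ) : ℕ :=
  if i < 2 then 4 else if i < 4 then 3 else if i = 4 then 1 else if i = 5 then 2 else 0

/-- Multiplication by `δ⁻¹`. -/
def ampEntry (i j : ℕ) : ℕ := if i = j then 5 else 0

/-- The map `x ↦ 1 - x`. -/
def negEntry (i j : ℕ) : ℕ := if i = j then 2 else 0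

/-- The neuron of a literal. -/
def litIndex (l : Literal) : ℕ := 4 + 2 * l.1 + (bif l.2 then 0 else 1)

/-- Violation of the clauses. -/
def clauseEntry (α : CNF) (i j : ℕ) : ℕ :=
  match α.drop i with
  | [] => 0
  | C :: _ => if (C.any fun l => decide (litIndex l = j)) = true then 2 else 0

def clauseBias (α : CNF) (i : ℕ) : ℕ :=
  match α.drop i with
  | [] => 0
  | _ :: _ => 1

/-- The conjunction of the clauses. -/
def conjEntry (i : ℕ) (_ : ℕ) : ℕ := if i = 0 then 2 else 0

def conjBias (i : ℕ) : ℕ := if i = 0 then 1 else 0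

def lastEntry (_ j : ℕ) : ℕ := if j = 0 then 1 else 0

/-- The word of the network of a formula, for input dimension `d`, hidden width `W`, `n` variables
and `a` amplification layers. -/
def netCode (d W n a : ℕ) (α : CNF) : List ℕ :=
  layerCode (firstEntry d) firstBias W d ++
  ((List.replicate n ()).flatMap (fun _ => layerCode shiftEntry shiftBias W W) ++
  ((List.replicate a ()).flatMap (fun _ => layerCode ampEntry (fun _ => 0) W W) ++
  (layerCode negEntry (fun _ => 1) W W ++ (layerCode negEntry (fun _ => 1) W W ++
  (layerCode (clauseEntry α) (clauseBias α) W W ++ (layerCode conjEntry conjBias W W ++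
  layerCode lastEntry (fun _ => 0) 1 W))))))

section

variable {X : Type} [Enc X]

theorem PT.drop_nat {β : Type} [Enc β] {l : X → List β} {n : X → ℕ} (hl : PT l) (hn : PT n) :
    PT fun x => (l x).drop (n x) := by
  refine (PT.nat_iterate (f := fun _ (s : List β) => s.tail) (PT.tail PT.snd) (IsPoly.const 0)
    monotone_const (fun x s => ?_) hn hl).of_eq fun x => ?_
  · cases s <;> simp; omega
  · generalize l x = m
    induction n x generalizing m with
    | zero => rfl
    | succ k ih => rw [Function.iterate_succ_apply, ih]; simp

theorem PT.litIndex {f : X → Literal} (hf : PT f) : PT fun x => litIndex (f x) :=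
  ((PT.const 4).add ((PT.const 2).mul (PT.fst.comp hf))).add
    ((PT.snd.comp hf).cond (PT.const 0) (PT.const 1))

theorem PT.firstEntry (d : ℕ) {f g : X → ℕ} (hf : PT f) (hg : PT g) :
    PT fun x => firstEntry d (f x) (g x) :=
  PT.ite (hg.succ.nat_eq (PT.const d)) (PT.ite (hf.nat_lt (PT.const 2)) (PT.const 2)
    (PT.ite (hf.nat_lt (PT.const 4)) (PT.const 1) (PT.const 0))) (PT.const 0)

theorem PT.firstBias {f : X → ℕ} (hf : PT f) : PT fun x => firstBias (f x) :=
  PT.ite (hf.nat_lt (PT.const 2)) (PT.const 3)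
    (PT.ite (hf.nat_lt (PT.const 4)) (PT.const 4) (PT.const 0))

theorem PT.shiftEntry {f g : X → ℕ} (hf : PT f) (hg : PT g) :
    PT fun x => shiftEntry (f x) (g x) :=
  PT.ite (hf.nat_lt (PT.const 2)) (PT.ite (hg.nat_eq (PT.const 0)) (PT.const 5)
      (PT.ite (hg.nat_eq (PT.const 2)) (PT.const 5) (PT.const 0)))
    (PT.ite (hf.nat_lt (PT.const 4)) (PT.ite (hg.nat_eq (PT.const 0)) (PT.const 6)
      (PT.ite (hg.nat_eq (PT.const 2)) (PT.const 6) (PT.const 0)))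
    (PT.ite (hf.nat_eq (PT.const 4)) (PT.ite (hg.nat_lt (PT.const 4)) (PT.const 6) (PT.const 0))
    (PT.ite (hf.nat_eq (PT.const 5)) (PT.ite (hg.nat_lt (PT.const 4)) (PT.const 5) (PT.const 0))
    (PT.ite ((hg.add (PT.const 2)).nat_eq hf) (PT.const 1) (PT.const 0)))))

theorem PT.shiftBias {f : X → ℕ} (hf : PT f) : PT fun x => shiftBias (f x) :=
  PT.ite (hf.nat_lt (PT.const 2)) (PT.const 4) (PT.ite (hf.nat_lt (PT.const 4)) (PT.const 3)
    (PT.ite (hf.nat_eq (PT.const 4)) (PT.const 1)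
      (PT.ite (hf.nat_eq (PT.const 5)) (PT.const 2) (PT.const 0))))

theorem PT.clauseEntry {α : X → CNF} {f g : X → ℕ} (hα : PT α) (hf : PT f) (hg : PT g) :
    PT fun x => clauseEntry (α x) (f x) (g x) := by
  refine (PT.list_cases (h := fun y : X × Clause × CNF =>
    if (y.2.1.any fun l => decide (NNQuad.litIndex l = g y.1)) = true then 2 else 0)
    (hα.drop_nat hf) (PT.const 0) ?_).of_eq fun x => ?_
  · refine PT.ite ?_ (PT.const 2) (PT.const 0)
    refine (PT.any (α := X × Clause × CNF) (PT.fst.comp PT.snd)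
      (g := fun y l => decide (NNQuad.litIndex l = g y.1))
      ((PT.litIndex PT.snd).nat_eq (hg.comp (PT.fst.comp PT.fst)))).of_eq fun x => ?_
    simp
  · unfold NNQuad.clauseEntry
    cases List.drop (f x) (α x) <;> rfl

theorem PT.clauseBias {α : X → CNF} {f : X → ℕ} (hα : PT α) (hf : PT f) :
    PT fun x => clauseBias (α x) (f x) := by
  refine (PT.list_cases (h := fun _ : X × Clause × CNF => 1) (hα.drop_nat hf) (PT.const 0)
    (PT.const 1)).of_eq fun x => ?_
  unfold NNQuad.clauseBias
  cases List.drop (f x) (α x) <;> rfl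

theorem PT.netCode (d : ℕ) {W n a : X → ℕ} {α : X → CNF} (hW : PT W) (hn : PT n) (ha : PT a)
    (hα : PT α) : PT fun x => netCode d (W x) (n x) (a x) (α x) := by
  have hi {Y : Type} [Enc Y] : PT fun y : (Y × ℕ) × ℕ => y.1.2 := PT.snd.comp PT.fst
  have hj {Y : Type} [Enc Y] : PT fun y : (Y × ℕ) × ℕ => y.2 := PT.snd
  have hb {Y : Type} [Enc Y] : PT fun y : Y × ℕ => y.2 := PT.snd
  have hneg : PT fun x => NNQuad.layerCode negEntry (fun _ => 1) (W x) (W x) :=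
    PT.layerCode (e := fun _ => negEntry) (b := fun _ _ => 1)
      (PT.ite (hi.nat_eq hj) (PT.const 2) (PT.const 0)) (PT.const 1) hW hW
  refine PT.append (PT.layerCode (e := fun _ => NNQuad.firstEntry d)
    (b := fun _ => NNQuad.firstBias) (PT.firstEntry d hi hj) (PT.firstBias hb) hW (PT.const d))
    (PT.append (PT.flatMap (PT.units.comp hn)
      (g := fun x _ => NNQuad.layerCode NNQuad.shiftEntry NNQuad.shiftBias (W x) (W x))
      (PT.comp (f := fun x => NNQuad.layerCode NNQuad.shiftEntry NNQuad.shiftBias (W x) (W x))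
      (PT.layerCode (e := fun _ => NNQuad.shiftEntry) (b := fun _ => NNQuad.shiftBias)
        (PT.shiftEntry hi hj) (PT.shiftBias hb) hW hW) PT.fst))
    (PT.append (PT.flatMap (PT.units.comp ha)
      (g := fun x _ => NNQuad.layerCode ampEntry (fun _ => 0) (W x) (W x))
      (PT.comp (f := fun x => NNQuad.layerCode ampEntry (fun _ => 0) (W x) (W x))
      (PT.layerCode (e := fun _ => ampEntry) (b := fun _ _ => 0)
        (PT.ite (hi.nat_eq hj) (PT.const 5) (PT.const 0)) (PT.const 0) hW hW) PT.fst))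
    (PT.append hneg (PT.append hneg
    (PT.append (PT.layerCode (e := fun x => NNQuad.clauseEntry (α x))
      (b := fun x => NNQuad.clauseBias (α x))
      (PT.clauseEntry (hα.comp (PT.fst.comp PT.fst)) hi hj)
      (PT.clauseBias (hα.comp PT.fst) hb) hW hW)
    (PT.append (PT.layerCode (e := fun _ => conjEntry) (b := fun _ => conjBias)
      (PT.ite (hi.nat_eq (PT.const 0)) (PT.const 2) (PT.const 0))
      (PT.ite (hb.nat_eq (PT.const 0)) (PT.const 1) (PT.const 0)) hW hW)
    (PT.layerCode (e := fun _ => lastEntry) (b := fun _ _ => 0)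
      (PT.ite (hj.nat_eq (PT.const 0)) (PT.const 1) (PT.const 0)) (PT.const 0)
      (PT.const 1) hW)))))))

end

/-- The constants of the reduction. With `u` blocks of variables, there are `q * u` variables, the
network belongs to the class with parameter `(q + 1) * u + e₁`, and the integral is compared with
`2 ^ (-(p * u + e₀))`. -/
structure RedParams where
  d : ℕ
  k : ℕ
  Ct : ℕ
  q : ℕ
  p : ℕ
  e₀ : ℕ
  e₁ : ℕ
  B : ℕ
  a₀ : ℕ
  hCt : 1 ≤ Ct
  hq : 1 ≤ q

namespace RedParams

variable (P : RedParams)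

/-- The number of blocks. -/
def u (α : CNF) : ℕ := blocks P.Ct P.q α

/-- The index of the class to which the network belongs. -/
def N (α : CNF) : ℕ := (P.q + 1) * P.u α + P.e₁

/-- The binary exponent of the threshold. -/
def E (α : CNF) : ℕ := P.p * P.u α + P.e₀

/-- The word of the network. -/
def netWord (α : CNF) : List ℕ :=
  netCode P.d (P.B * P.N α) (P.q * P.u α) (P.u α + P.a₀) α

/-- The reduction: a word is either rejected or mapped to the reversed word of a network and to the
exponent of the threshold. -/
def reduce (w : List ℕ) : Option (List ℕ × ℕ) :=
  match parse w with
  | none => none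
  | some α => if α.all fun C => (C.drop P.k).isEmpty then
      some ((P.netWord α).reverse, P.E α) else none

theorem pt_reduce : PT P.reduce := by
  have hu : PT P.u := pt_blocks P.hCt P.hq
  have hN : PT P.N := ((PT.const _).mul hu).add (PT.const _)
  have hw : PT P.netWord := PT.netCode P.d ((PT.const _).mul hN) ((PT.const _).mul hu)
    (hu.add (PT.const _)) PT.id
  have hE : PT P.E := ((PT.const _).mul hu).add (PT.const _)
  have hall : PT fun α : CNF => α.all fun C => (C.drop P.k).isEmpty :=
    PT.all (α := CNF) PT.id (g := fun _ (C : Clause) => (C.drop P.k).isEmpty) ((PT.snd.drop P.k).isEmpty)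
  have hs : PT fun α : CNF => if (α.all fun C => (C.drop P.k).isEmpty) = true then
      some ((P.netWord α).reverse, P.E α) else none :=
    PT.ite (hall.of_eq fun x => by rw [Bool.decide_eq_true]) (PT.some (hw.reverse.pair hE)) (PT.const none)
  refine (PT.option_cases pt_parse (PT.const none) (hs.comp PT.snd)).of_eq fun w => ?_
  unfold reduce
  cases parse w <;> rfl

theorem reduce_encode {α : CNF} (h : α.IsKCNF P.k) :
    P.reduce (revCode α.encode) = some ((P.netWord α).reverse, P.E α) := by
  unfold reduce
  rw [parse_encode]
  refine if_pos ?_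
  rw [List.all_eq_true]
  intro C hC
  simpa using h C hC

theorem reduce_eq_none {w : List CNFSym} (h : ¬ ∃ α : CNF, α.IsKCNF P.k ∧ α.encode = w) :
    P.reduce (revCode w) = none := by
  unfold reduce
  cases hp : parse (revCode w) with
  | none => rfl
  | some α =>
    refine if_neg fun hall => h ⟨α, fun C hC => ?_, encode_of_parse hp⟩
    simpa using (List.all_eq_true.1 hall) C hC

end RedParams

/-! ### Comparison of binary fractions -/

/-- Compares the lower digits of two binary numbers, as long as the first one has digits. -/
def cmpLow : List Bool → List Bool → Bool → Bool
  | [], _, c => c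
  | a :: as, bs, c => cmpLow as bs.tail (if a = bs.head?.getD false then c else a)

/-- Takes the remaining digits of the second number into account. -/
def cmpHigh (bs : List Bool) (c : Bool) : Bool := bs.foldl (fun c b => if b then false else c) c

/-- Compares two binary numbers, least significant digits first; `c` is the result in the case of
equality. -/
def cmpBits (as bs : List Bool) (c : Bool) : Bool := cmpHigh (bs.drop as.length) (cmpLow as bs c)

@[simp] theorem binVal_nil : binVal [] = 0 := rfl

@[simp] theorem binVal_cons (b : Bool) (p : List Bool) :
    binVal (b :: p) = (if b then 1 else 0) + 2 * binVal p := by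
  simp [binVal, Nat.ofDigits_cons]

theorem binVal_replicate (n : ℕ) (p : List Bool) :
    binVal (List.replicate n false ++ p) = 2 ^ n * binVal p := by
  induction n with
  | zero => simp
  | succ n ih => simp [List.replicate_succ, ih, pow_succ]; ring

theorem cmpHigh_eq (bs : List Bool) (c : Bool) :
    cmpHigh bs c = true ↔ binVal bs = 0 ∧ c = true := by
  induction bs generalizing c with
  | nil => simp [cmpHigh]
  | cons b bs ih =>
    have : cmpHigh (b :: bs) c = cmpHigh bs (if b then false else c) := rfl
    rw [this, ih]
    cases b <;> simp

/-- Going up from the least significant digit, `c` holds the outcome so far: a differing digit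
overrides it and an equal one keeps it. Missing digits count as zeros. -/
theorem cmpBits_eq (as bs : List Bool) (c : Bool) : cmpBits as bs c = true ↔
    binVal bs < binVal as ∨ (binVal bs = binVal as ∧ c = true) := by
  induction as generalizing bs c with
  | nil => simp [cmpBits, cmpLow, cmpHigh_eq]
  | cons a as ih =>
    have h : cmpBits (a :: as) bs c =
        cmpBits as bs.tail (if a = bs.head?.getD false then c else a) := by
      simp [cmpBits, cmpLow]
    rw [h, ih]
    cases bs with
    | nil => cases a <;> simp [eq_comm, Nat.pos_iff_ne_zero, em']
    | cons b bs => cases a <;> cases b <;> simp <;> omega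

/-- The binary digits at the beginning of a word, and what follows after the next letter. -/
def splitDigits : List RatSym → List Bool × List RatSym
  | [] => ([], [])
  | .digit b :: u => (b :: (splitDigits u).1, (splitDigits u).2)
  | .sign _ :: u => ([], u)
  | .slash :: u => ([], u)

/-- Whether a letter is the digit one. -/
def isOne : RatSym → Bool
  | .digit b => b
  | _ => false

/-- The decision that is made on the basis of the output `u` of a quadrature algorithm: it is compared
with `2 ^ (-E)`. -/
def verdict (u : List RatSym) (E : ℕ) : Bool :=
  match u with
  | .sign false :: u => cmpBits (List.replicate E false ++ (splitDigits u).1)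
      ((splitDigits u).2.map isOne) true
  | _ => false

theorem splitDigits_append (p : List Bool) (u : List RatSym) :
    splitDigits (p.map RatSym.digit ++ .slash :: u) = (p, u) := by
  induction p with
  | nil => rfl
  | cons b p ih => simp [splitDigits, ih]

/-- A fraction `p / q` is at least `2⁻¹ ^ E` exactly if `q ≤ 2 ^ E * p`, and multiplication by `2 ^
E` puts `E` zeros in front of the digits of `p`. No division and no reduced fraction is needed. -/
theorem verdict_eq_true {u : List RatSym} {x : ℝ} (h : Represents u x) {E : ℕ}
    (hx : (2 : ℝ)⁻¹ ^ E ≤ x) : verdict u E = true := by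
  obtain ⟨s, p, q, rfl, hq, rfl⟩ := h
  have hq' : (0 : ℝ) < binVal q := by exact_mod_cast Nat.pos_of_ne_zero hq
  cases s with
  | true =>
    exfalso
    have h₁ : (0 : ℝ) < (2 : ℝ)⁻¹ ^ E := by positivity
    have h₂ : (0 : ℝ) ≤ (binVal p : ℝ) / binVal q := by positivity
    simp only [if_true] at hx
    linarith
  | false =>
    simp only [verdict, splitDigits_append, List.map_map]
    have hid : isOne ∘ RatSym.digit = id := rfl
    rw [hid, List.map_id, cmpBits_eq, binVal_replicate]
    simp only [Bool.false_eq_true, if_false, one_mul, inv_pow] at hx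
    rw [le_div_iff₀ hq', inv_mul_le_iff₀ (by positivity)] at hx
    have : binVal q ≤ 2 ^ E * binVal p := by exact_mod_cast hx
    simp
    omega

theorem verdict_eq_false {u : List RatSym} {x : ℝ} (h : Represents u x) {E : ℕ}
    (hx : x < (2 : ℝ)⁻¹ ^ E) : verdict u E = false := by
  obtain ⟨s, p, q, rfl, hq, rfl⟩ := h
  have hq' : (0 : ℝ) < binVal q := by exact_mod_cast Nat.pos_of_ne_zero hq
  cases s with
  | true => rfl
  | false =>
    simp only [verdict, splitDigits_append, List.map_map]
    have hid : isOne ∘ RatSym.digit = id := rfl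
    rw [hid, List.map_id, ← Bool.not_eq_true, cmpBits_eq, binVal_replicate]
    simp only [Bool.false_eq_true, if_false, one_mul, inv_pow] at hx
    rw [div_lt_iff₀ hq', lt_inv_mul_iff₀ (by positivity)] at hx
    have : 2 ^ E * binVal p < binVal q := by exact_mod_cast hx
    simp
    omega

/-! ### Loading the input -/

/-- The letters of formulas as letters of the work stacks. -/
def CNFSym.toSym : CNFSym → Sym
  | .tick => 0
  | .sign false => 1
  | .sign true => 2
  | .clauseEnd => 3

/-- Moves the input to the main stack. -/
def loadLoop : WProg :=
  .loop .inp (fun r => r.isNone) fun r => match r with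
    | some a => pushWord (1 :: eword (a : ℕ))
    | none => .skip

/-- The letter `0` is the word of the empty list. Letters are then put in front of it, which
reverses the input, as the parser expects. -/
def loadProg : WProg := .seq (.push .main 0) loadLoop

theorem exec_loadLoop (w : List CNFSym) : ∀ (l : List ℕ) (x y c o : List Sym),
    ∃ n ≤ 11 * w.length + 1, Exec loadLoop (st (eword l) x y c (w.map CNFSym.toSym) o)
      (st (eword (revCode w ++ l)) x y c [] o) n := by
  induction w with
  | nil =>
    intro l x y c o
    exact ⟨1, by simp, Exec.loop_exit_nil (k := WK.inp) (by simp) rfl⟩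
  | cons a w ih =>
    intro l x y c o
    obtain ⟨n₁, hn₁, e₁⟩ := runs_pushWord (1 :: eword a.toNat) (eword l) [] x y c
      (w.map CNFSym.toSym) o
    obtain ⟨n₂, hn₂, e₂⟩ := ih (a.toNat :: l) x y c o
    have hsz : (1 :: eword a.toNat).length ≤ 8 := by
      rw [List.length_cons, length_eword, esize_nat]
      rcases a with _ | (_ | _) | _ <;> simp [CNFSym.toNat]
    have hval : ((a.toSym : Sym) : ℕ) = a.toNat := by rcases a with _ | (_ | _) | _ <;> rfl
    refine ⟨n₁ + n₂ + 1, by simp only [List.length_cons] at *; omega, ?_⟩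
    refine Exec.loop_step_cons (k := WK.inp) (a := a.toSym) (l := w.map CNFSym.toSym)
      (s' := st (eword (a.toNat :: l)) x y c (w.map CNFSym.toSym) o)
      (by simp) (update_stB_inp _ _ _ _ _ _ _ _) rfl ?_ ?_
    · simp only [hval]
      simpa [eword_cons] using e₁
    · have : revCode (a :: w) ++ l = revCode w ++ a.toNat :: l := by simp [revCode]
      rw [this]
      exact e₂

theorem exec_loadProg (w : List CNFSym) : ∃ n ≤ 11 * w.length + 2,
    Exec loadProg (st [] [] [] [] (w.map CNFSym.toSym) [])
      (st (eword (revCode w)) [] [] [] [] []) n := by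
  obtain ⟨n, hn, e⟩ := exec_loadLoop w [] [] [] [] []
  refine ⟨1 + n, by omega, .seq (exec_push_main _ _ _ _ _ _ _ _) ?_⟩
  rw [List.append_nil] at e
  exact e

/-! ### Handing over to a quadrature algorithm and evaluating its output -/

section Machine

variable {I : Type} (A : ProbTM I RatSym) (dec : ℕ → I)

/-- The alphabets of the work stacks and the stacks of `A`. -/
abbrev MΓ : WK ⊕ A.K → Type := SumΓ WΓ A.Γ

/-- The work stacks and the stacks of `A`, with `l` on the stack `κ` of `A`. -/
def jst (m x y c i o : List Sym) (t : ∀ k, List (A.Γ k)) : ∀ k, List (MΓ A k) :=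
  joinStk (st m x y c i o) t

section

variable (m x y c i o v : List Sym) (t : ∀ k, List (A.Γ k))

@[simp] theorem jst_main : jst A m x y c i o t (.inl .main) = m := rfl
@[simp] theorem jst_left : jst A m x y c i o t (.inl .left) = x := rfl
@[simp] theorem jst_right : jst A m x y c i o t (.inl .right) = y := rfl
@[simp] theorem jst_out : jst A m x y c i o t (.inl .out) = o := rfl
@[simp] theorem jst_inr (k : A.K) : jst A m x y c i o t (.inr k) = t k := rfl

@[simp] theorem update_jst_main :
    Function.update (jst A m x y c i o t) (.inl .main) v = jst A v x y c i o t := by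
  unfold jst; rw [update_joinStk_inl, update_stB_main]
@[simp] theorem update_jst_left :
    Function.update (jst A m x y c i o t) (.inl .left) v = jst A m v y c i o t := by
  unfold jst; rw [update_joinStk_inl]; exact congrArg (joinStk · t) (update_stB_store true _ _ _ _ _ _ _)
@[simp] theorem update_jst_right :
    Function.update (jst A m x y c i o t) (.inl .right) v = jst A m x v c i o t := by
  unfold jst; rw [update_joinStk_inl]; exact congrArg (joinStk · t) (update_stB_store false _ _ _ _ _ _ _)
@[simp] theorem update_jst_cnt :
    Function.update (jst A m x y c i o t) (.inl .cnt) v = jst A m x y v i o t := by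
  unfold jst; rw [update_joinStk_inl, update_stB_cnt]
@[simp] theorem update_jst_out :
    Function.update (jst A m x y c i o t) (.inl .out) v = jst A m x y c i v t := by
  unfold jst; rw [update_joinStk_inl, update_stB_out]
@[simp] theorem update_jst_inr (k : A.K) (l : List (A.Γ k)) :
    Function.update (jst A m x y c i o t) (.inr k) l =
      jst A m x y c i o (Function.update t k l) := by
  unfold jst; rw [update_joinStk_inr]

end

/-- Reads a number below the given bound from the main stack and pushes the corresponding letter on
the input stack of `A`. -/
def readLetter : ℕ → ℕ → Prog (MΓ A)
  | 0, _ => .skip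
  | f + 1, j => .case (.inl .main) fun r : Option Sym =>
      if r = some 1 then .case (.inl .main) fun _ => readLetter f (j + 1)
      else .push (.inr A.k₀) (A.inp (dec j))

/-- The position in the program serves as memory: `j` counts the units read, and `f` bounds the
unfolding. There are only nine letter codes, so `f = 9` suffices. -/
theorem exec_readLetter (f : ℕ) : ∀ (j a : ℕ), a < f →
    ∀ (m x y c i o : List Sym) (t : ∀ k, List (A.Γ k)),
    Exec (readLetter A dec f j) (jst A (eword a ++ m) x y c i o t)
      (jst A m x y c i o (Function.update t A.k₀ (A.inp (dec (j + a)) :: t A.k₀))) (2 * a + 2) := by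
  induction f with
  | zero => intro j a ha; omega
  | succ f ih =>
    intro j a ha m x y c i o t
    cases a with
    | zero =>
      refine Exec.case_cons (k := Sum.inl WK.main) (a := (0 : Sym)) (l := m) rfl
        (update_jst_main _ _ _ _ _ _ _ _ _) ?_
      rw [if_neg (fun h => by injection h with h; exact absurd h (by simp))]
      exact Exec.push_eq (update_jst_inr _ _ _ _ _ _ _ _ _ _)
    | succ a =>
      refine Exec.case_cons (k := Sum.inl WK.main) (a := (1 : Sym)) (l := 0 :: (eword a ++ m)) rfl
        (update_jst_main _ _ _ _ _ _ _ _ _) ?_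
      rw [if_pos rfl]
      refine Exec.case_cons (k := Sum.inl WK.main) (a := (0 : Sym)) (l := eword a ++ m) rfl
        (update_jst_main _ _ _ _ _ _ _ _ _) ?_
      have := ih (j + 1) a (by omega) m x y c i o t
      rwa [show j + 1 + a = j + (a + 1) by omega] at this

/-- Writes the input of `A`. -/
def writeLoop : Prog (MΓ A) :=
  .loop (.inl .main) (fun r : Option Sym => decide (r ≠ some 1)) fun _ => readLetter A dec 9 0

def writeProg : Prog (MΓ A) := .seq (.case (.inl .main) fun _ => .skip) (writeLoop A dec)

/-- Writing to a stack reverses the word. The reduction delivers the reversed network word to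
compensate for this. -/
theorem exec_writeLoop (l : List ℕ) : ∀ (t : ∀ k, List (A.Γ k)) (m x y c i o : List Sym),
    (∀ a ∈ l, a < 9) → ∃ n ≤ 2 * esize l,
    Exec (writeLoop A dec) (jst A (eword l ++ m) x y c i o t) (jst A m x y c i o
      (Function.update t A.k₀ ((l.reverse.map dec).map A.inp ++ t A.k₀))) n := by
  induction l with
  | nil =>
    intro t m x y c i o _
    refine ⟨1, by simp, ?_⟩
    refine Exec.loop_exit_cons (k := Sum.inl WK.main) (a := (0 : Sym)) (l := m) rfl ?_ rfl
    simp
  | cons a l ih =>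
    intro t m x y c i o h
    have e₁ := exec_readLetter A dec 9 0 a (h a (by simp)) (eword l ++ m) x y c i o t
    obtain ⟨n, hn, e₂⟩ := ih (Function.update t A.k₀ (A.inp (dec (0 + a)) :: t A.k₀)) m x y c i o
      fun b hb => h b (by simp [hb])
    refine ⟨(2 * a + 2) + n + 1, by simp only [esize_list_cons, esize_nat]; omega, ?_⟩
    refine Exec.loop_step_cons (k := Sum.inl WK.main) (a := (1 : Sym))
      (l := eword a ++ (eword l ++ m)) ?_ (update_jst_main _ _ _ _ _ _ _ _ _) rfl e₁ ?_
    · rw [jst_main, eword_cons]; simp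
    · change Exec (writeLoop A dec) _ _ _
      simpa using e₂

theorem exec_writeProg (l : List ℕ) (E : ℕ) (t : ∀ k, List (A.Γ k)) (m x y c i o : List Sym)
    (h : ∀ a ∈ l, a < 9) : ∃ n ≤ 2 * esize l + 2,
    Exec (writeProg A dec) (jst A (eword (l, E) ++ m) x y c i o t) (jst A (eword E ++ m) x y c i o
      (Function.update t A.k₀ ((l.reverse.map dec).map A.inp ++ t A.k₀))) n := by
  obtain ⟨n, hn, e⟩ := exec_writeLoop A dec l t (eword E ++ m) x y c i o h
  refine ⟨(1 + 1) + n, by omega, .seq ?_ e⟩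
  refine Exec.case_cons (k := Sum.inl WK.main) (a := (1 : Sym))
    (l := eword l ++ (eword E ++ m)) ?_ (update_jst_main _ _ _ _ _ _ _ _ _) (Exec.skip _)
  rw [jst_main, eword_pair]; simp

/-- The digit on top of the output stack. -/
def digitOf (r : Option (A.Γ A.k₁)) : Option Bool :=
  match r.map A.out with
  | some (.digit b) => some b
  | _ => none

/-- Truth values as letters of the work stacks. -/
def bsym (b : Bool) : Sym := bif b then 1 else 0

/-- Moves the digits on top of the output stack of `A` to a storage stack. -/
def digitLoop : Prog (MΓ A) :=
  .loop (.inr A.k₁) (fun r => (digitOf A r).isNone) fun r =>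
    .push (.inl .left) (bsym ((digitOf A r).getD false))

/-- The letter that ends the loop is popped as well, in agreement with `splitDigits`, so that the
denominator is on top afterwards. -/
theorem exec_digitLoop (l : List (A.Γ A.k₁)) : ∀ (t : ∀ k, List (A.Γ k)) (m x y c i o : List Sym),
    t A.k₁ = l → ∃ (l' : List (A.Γ A.k₁)) (n : ℕ),
      l'.map A.out = (splitDigits (l.map A.out)).2 ∧ l'.length ≤ l.length ∧ n ≤ 2 * l.length + 1 ∧
      (splitDigits (l.map A.out)).1.length ≤ l.length ∧
      Exec (digitLoop A) (jst A m x y c i o t)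
        (jst A m ((splitDigits (l.map A.out)).1.reverse.map bsym ++ x) y c i o
          (Function.update t A.k₁ l')) n := by
  induction l with
  | nil =>
    intro t m x y c i o ht
    refine ⟨[], 1, rfl, le_rfl, by omega, le_rfl, ?_⟩
    have hu : Function.update t A.k₁ [] = t := by rw [← ht, Function.update_eq_self]
    rw [hu]
    exact Exec.loop_exit_nil (k := Sum.inr A.k₁) (by simp [ht]) rfl
  | cons a l ih =>
    intro t m x y c i o ht
    have hend : (digitOf A (some a)) = none → splitDigits ((a :: l).map A.out) = ([], l.map A.out) →
        ∃ (l' : List (A.Γ A.k₁)) (n : ℕ),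
        l'.map A.out = (splitDigits ((a :: l).map A.out)).2 ∧ l'.length ≤ (a :: l).length ∧
        n ≤ 2 * (a :: l).length + 1 ∧
        (splitDigits ((a :: l).map A.out)).1.length ≤ (a :: l).length ∧
        Exec (digitLoop A) (jst A m x y c i o t)
        (jst A m ((splitDigits ((a :: l).map A.out)).1.reverse.map bsym ++ x) y c i o
          (Function.update t A.k₁ l')) n := by
      intro h₁ h₂
      refine ⟨l, 1, by rw [h₂], by simp, by omega, by rw [h₂]; simp, ?_⟩
      rw [h₂]
      exact Exec.loop_exit_cons (k := Sum.inr A.k₁) (a := a) (l := l) (by simp [ht])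
        (update_jst_inr _ _ _ _ _ _ _ _ _ _) (by simp [h₁])
    cases ha : A.out a with
    | sign s => exact hend (by simp [digitOf, ha]) (by simp [splitDigits, ha])
    | slash => exact hend (by simp [digitOf, ha]) (by simp [splitDigits, ha])
    | digit b =>
      have hd : digitOf A (some a) = some b := by simp [digitOf, ha]
      obtain ⟨l', n, h₁, h₂, h₃, h₄, e⟩ := ih (Function.update t A.k₁ l) m (bsym b :: x) y c i o
        (by simp)
      refine ⟨l', 1 + n + 1, ?_, by simp; omega, by simp; omega, ?_, ?_⟩
      · simpa [splitDigits, ha] using h₁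
      · simpa [splitDigits, ha] using h₄
      · refine Exec.loop_step_cons (k := Sum.inr A.k₁) (a := a) (l := l) (by simp [ht])
          (update_jst_inr _ _ _ _ _ _ _ _ _ _) (by simp [hd])
          (Exec.push_eq (k := Sum.inl WK.left) (update_jst_left _ _ _ _ _ _ _ _ _)) ?_
        change Exec (digitLoop A) _ _ _
        simpa [splitDigits, ha, hd] using e

/-- Empties the first storage stack to the second one. -/
def flipLoop : Prog (MΓ A) :=
  .loop (.inl .left) (fun r => r.isNone) fun r : Option Sym => .push (.inl .right) (r.getD 0)

theorem exec_flipLoop (x : List Sym) : ∀ (t : ∀ k, List (A.Γ k)) (m y c i o : List Sym),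
    ∃ n ≤ 2 * x.length + 1, Exec (flipLoop A) (jst A m x y c i o t)
      (jst A m [] (x.reverse ++ y) c i o t) n := by
  induction x with
  | nil =>
    intro t m y c i o
    exact ⟨1, by simp, Exec.loop_exit_nil (k := Sum.inl WK.left) rfl rfl⟩
  | cons a x ih =>
    intro t m y c i o
    obtain ⟨n, hn, e⟩ := ih t m (a :: y) c i o
    refine ⟨1 + n + 1, by simp; omega, ?_⟩
    refine Exec.loop_step_cons (k := Sum.inl WK.left) (a := a) (l := x) rfl
      (update_jst_left _ _ _ _ _ _ _ _ _) rfl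
      (Exec.push_eq (k := Sum.inl WK.right) (update_jst_right _ _ _ _ _ _ _ _ _)) ?_
    change Exec (flipLoop A) _ _ _
    simpa using e

/-- Pushes as many zeros as the number on the main stack says. -/
def zeroLoop : Prog (MΓ A) :=
  .loop (.inl .main) (fun r : Option Sym => decide (r ≠ some 1)) fun _ =>
    .seq (.case (.inl .main) fun _ => .skip) (.push (.inl .right) (0 : Sym))

theorem exec_zeroLoop (E : ℕ) : ∀ (t : ∀ k, List (A.Γ k)) (m x y c i o : List Sym),
    ∃ n ≤ 4 * E + 1, Exec (zeroLoop A) (jst A (eword E ++ m) x y c i o t)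
      (jst A m x (List.replicate E 0 ++ y) c i o t) n := by
  induction E with
  | zero =>
    intro t m x y c i o
    exact ⟨1, by simp, Exec.loop_exit_cons (k := Sum.inl WK.main) (a := (0 : Sym)) (l := m) rfl
      (update_jst_main _ _ _ _ _ _ _ _ _) rfl⟩
  | succ E ih =>
    intro t m x y c i o
    obtain ⟨n, hn, e⟩ := ih t m x (0 :: y) c i o
    refine ⟨(1 + 1 + 1) + n + 1, by omega, ?_⟩
    refine Exec.loop_step_cons (k := Sum.inl WK.main) (a := (1 : Sym)) (l := 0 :: (eword E ++ m)) rfl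
      (update_jst_main _ _ _ _ _ _ _ _ _) rfl
      (.seq (Exec.case_cons (k := Sum.inl WK.main) (a := (0 : Sym)) (l := eword E ++ m) rfl
        (update_jst_main _ _ _ _ _ _ _ _ _) (Exec.skip _))
      (Exec.push_eq (k := Sum.inl WK.right) (update_jst_right _ _ _ _ _ _ _ _ _))) ?_
    have : List.replicate (E + 1) (0 : Sym) ++ y = List.replicate E 0 ++ 0 :: y := by
      rw [List.replicate_succ']; simp
    rw [this]
    exact e

/-- Replaces the truth value on the counter. -/
def setCnt (b : Bool) : Prog (MΓ A) := .case (.inl .cnt) fun _ => .push (.inl .cnt) (bsym b)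

theorem exec_setCnt (b : Bool) (a : Sym) (m x y c i o : List Sym) (t : ∀ k, List (A.Γ k)) :
    Exec (setCnt A b) (jst A m x y (a :: c) i o t) (jst A m x y (bsym b :: c) i o t) (1 + 1) :=
  Exec.case_cons (k := Sum.inl WK.cnt) (a := a) (l := c) rfl (update_jst_cnt _ _ _ _ _ _ _ _ _)
    (Exec.push_eq (k := Sum.inl WK.cnt) (update_jst_cnt _ _ _ _ _ _ _ _ _))

/-- Compares the number on the second storage stack with the one on the output stack of `A`. -/
def lowLoop : Prog (MΓ A) :=
  .loop (.inl .right) (fun r => r.isNone) fun r : Option Sym =>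
    .case (.inr A.k₁) fun r' =>
      if decide (r = some 1) = (digitOf A r').getD false then .skip
      else setCnt A (decide (r = some 1))

theorem digitOf_some (a : A.Γ A.k₁) : (digitOf A (some a)).getD false = isOne (A.out a) := by
  simp only [digitOf, Option.map_some]
  cases A.out a <;> rfl

theorem exec_lowLoop (as : List Bool) : ∀ (l : List (A.Γ A.k₁)) (b : Bool)
    (t : ∀ k, List (A.Γ k)) (m x i o : List Sym), t A.k₁ = l →
    ∃ n ≤ 4 * as.length + 1, Exec (lowLoop A) (jst A m x (as.map bsym) [bsym b] i o t)
      (jst A m x [] [bsym (cmpLow as (l.map fun a => isOne (A.out a)) b)] i o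
        (Function.update t A.k₁ (l.drop as.length))) n := by
  induction as with
  | nil =>
    intro l b t m x i o ht
    refine ⟨1, by simp, ?_⟩
    simp only [List.length_nil, List.drop_zero, ← ht, Function.update_eq_self]
    exact Exec.loop_exit_nil (k := Sum.inl WK.right) rfl rfl
  | cons a as ih =>
    intro l b t m x i o ht
    have hb : decide (some (bsym a) = some (1 : Sym)) = a := by cases a <;> rfl
    have hstep : ∀ (a' : Bool) (t' : ∀ k, List (A.Γ k)), ∃ n ≤ 2,
        Exec (if decide (some (bsym a) = some (1 : Sym)) = a' then Prog.skip
          else setCnt A (decide (some (bsym a) = some (1 : Sym))))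
          (jst A m x (as.map bsym) [bsym b] i o t')
          (jst A m x (as.map bsym) [bsym (if a = a' then b else a)] i o t') n := by
      intro a' t'
      rw [hb]
      by_cases h : a = a'
      · rw [if_pos h, if_pos h]
        exact ⟨1, by omega, .skip _⟩
      · rw [if_neg h, if_neg h]
        exact ⟨2, le_rfl, exec_setCnt A _ _ _ _ _ _ _ _ _⟩
    cases l with
    | nil =>
      obtain ⟨n₁, hn₁, e₁⟩ := hstep false t
      obtain ⟨n₂, hn₂, e₂⟩ := ih [] (if a = false then b else a) t m x i o ht
      refine ⟨(n₁ + 1) + n₂ + 1, by simp; omega, ?_⟩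
      refine Exec.loop_step_cons (k := Sum.inl WK.right) (a := bsym a) (l := as.map bsym) rfl
        (update_jst_right _ _ _ _ _ _ _ _ _) rfl
        (Exec.case_nil (k := Sum.inr A.k₁) (by simp [ht]) e₁) ?_
      change Exec (lowLoop A) _ _ _
      simpa [cmpLow] using e₂
    | cons a' l =>
      obtain ⟨n₁, hn₁, e₁⟩ := hstep (isOne (A.out a')) (Function.update t A.k₁ l)
      obtain ⟨n₂, hn₂, e₂⟩ := ih l (if a = isOne (A.out a') then b else a)
        (Function.update t A.k₁ l) m x i o (by simp)
      refine ⟨(n₁ + 1) + n₂ + 1, by simp; omega, ?_⟩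
      refine Exec.loop_step_cons (k := Sum.inl WK.right) (a := bsym a) (l := as.map bsym) rfl
        (update_jst_right _ _ _ _ _ _ _ _ _) rfl
        (s' := jst A m x (as.map bsym) [bsym (if a = isOne (A.out a') then b else a)] i o
          (Function.update t A.k₁ l))
        (Exec.case_cons (k := Sum.inr A.k₁) (a := a') (l := l) (by simp [ht])
          (update_jst_inr _ _ _ _ _ _ _ _ _ _) ?_) ?_
      · rw [digitOf_some]
        exact e₁
      · change Exec (lowLoop A) _ _ _
        simpa [cmpLow] using e₂

def highLoop : Prog (MΓ A) :=
  .loop (.inr A.k₁) (fun r => r.isNone) fun r =>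
    if (digitOf A r).getD false then setCnt A false else .skip

theorem exec_highLoop (l : List (A.Γ A.k₁)) : ∀ (b : Bool)
    (t : ∀ k, List (A.Γ k)) (m x y i o : List Sym), t A.k₁ = l →
    ∃ n ≤ 3 * l.length + 1, Exec (highLoop A) (jst A m x y [bsym b] i o t)
      (jst A m x y [bsym (cmpHigh (l.map fun a => isOne (A.out a)) b)] i o
        (Function.update t A.k₁ [])) n := by
  induction l with
  | nil =>
    intro b t m x y i o ht
    refine ⟨1, by simp, ?_⟩
    have hu : Function.update t A.k₁ [] = t := by rw [← ht, Function.update_eq_self]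
    rw [hu]
    exact Exec.loop_exit_nil (k := Sum.inr A.k₁) (by simp [ht]) rfl
  | cons a l ih =>
    intro b t m x y i o ht
    have hstep : ∃ n ≤ 2, Exec (if (digitOf A (some a)).getD false then setCnt A false else .skip)
        (jst A m x y [bsym b] i o (Function.update t A.k₁ l))
        (jst A m x y [bsym (if isOne (A.out a) then false else b)] i o
          (Function.update t A.k₁ l)) n := by
      rw [digitOf_some]
      by_cases h : isOne (A.out a) = true
      · rw [if_pos h, if_pos h]
        exact ⟨2, le_rfl, exec_setCnt A _ _ _ _ _ _ _ _ _⟩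
      · rw [if_neg h, if_neg h]
        exact ⟨1, by omega, .skip _⟩
    obtain ⟨n₁, hn₁, e₁⟩ := hstep
    obtain ⟨n₂, hn₂, e₂⟩ := ih (if isOne (A.out a) then false else b)
      (Function.update t A.k₁ l) m x y i o (by simp)
    refine ⟨n₁ + n₂ + 1, by simp; omega, ?_⟩
    refine Exec.loop_step_cons (k := Sum.inr A.k₁) (a := a) (l := l) (by simp [ht])
      (update_jst_inr _ _ _ _ _ _ _ _ _ _) rfl e₁ ?_
    rw [Function.update_idem] at e₂
    exact e₂

/-- Evaluates the output of `A` if it is nonnegative. -/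
def cmpProg : Prog (MΓ A) :=
  .seq (digitLoop A) (.seq (flipLoop A) (.seq (zeroLoop A) (.seq (.push (.inl .cnt) (1 : Sym))
    (.seq (lowLoop A) (.seq (highLoop A)
      (.case (.inl .cnt) fun r : Option Sym => .push (.inl .out) (r.getD 0)))))))

/-- Evaluates the output of `A`. -/
def postProg : Prog (MΓ A) :=
  .case (.inr A.k₁) fun r => match r.map A.out with
    | some (.sign false) => cmpProg A
    | _ => .push (.inl .out) (0 : Sym)

theorem exec_cmpProg (E : ℕ) (t : ∀ k, List (A.Γ k)) (l : List (A.Γ A.k₁)) (ht : t A.k₁ = l)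
    (m i : List Sym) : ∃ s', ∃ n ≤ 12 * (l.length + E) + 10,
      Exec (cmpProg A) (jst A (eword E ++ m) [] [] [] i [] t) s' n ∧
      s' (.inl .out) = [bsym (cmpBits (List.replicate E false ++ (splitDigits (l.map A.out)).1)
        ((splitDigits (l.map A.out)).2.map isOne) true)] := by
  obtain ⟨l', n₁, hl', hlen, hn₁, hlen', e₁⟩ := exec_digitLoop A l t (eword E ++ m) [] [] [] i [] ht
  set ds := (splitDigits (l.map A.out)).1
  set t₁ := Function.update t A.k₁ l'
  obtain ⟨n₂, hn₂, e₂⟩ := exec_flipLoop A (ds.reverse.map bsym ++ []) t₁ (eword E ++ m) [] [] i []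
  obtain ⟨n₃, hn₃, e₃⟩ := exec_zeroLoop A E t₁ m [] ((ds.reverse.map bsym ++ []).reverse ++ []) []
    i []
  -- The two reversals cancel, and the zeros in front multiply the numerator by `2 ^ E`.
  have hy : List.replicate E (0 : Sym) ++ ((ds.reverse.map bsym ++ []).reverse ++ []) =
      (List.replicate E false ++ ds).map bsym := by
    simp [bsym]
  rw [hy] at e₃
  -- The comparison starts with `true`, the outcome in the case of equality.
  obtain ⟨n₅, hn₅, e₅⟩ := exec_lowLoop A (List.replicate E false ++ ds) l' true t₁ m [] i []
    (by simp [t₁])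
  obtain ⟨n₆, hn₆, e₆⟩ := exec_highLoop A (l'.drop (List.replicate E false ++ ds).length)
    (cmpLow (List.replicate E false ++ ds) (l'.map fun a => isOne (A.out a)) true)
    (Function.update t₁ A.k₁ (l'.drop (List.replicate E false ++ ds).length)) m [] [] i [] (by simp)
  refine ⟨_, n₁ + (n₂ + (n₃ + (1 + (n₅ + (n₆ + (1 + 1)))))), ?_, .seq e₁ (.seq e₂ (.seq e₃
    (.seq (Exec.push_eq (k := Sum.inl WK.cnt) (update_jst_cnt _ _ _ _ _ _ _ _ _))
    (.seq e₅ (.seq e₆ (Exec.case_cons (k := Sum.inl WK.cnt) rfl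
      (update_jst_cnt _ _ _ _ _ _ _ _ _)
      (Exec.push_eq (k := Sum.inl WK.out) (update_jst_out _ _ _ _ _ _ _ _ _)))))))), ?_⟩
  · simp only [List.length_append, List.length_map, List.length_reverse, List.length_replicate,
      List.length_nil, List.length_drop] at hn₂ hn₅ hn₆
    omega
  · have h : ((splitDigits (l.map A.out)).2.map isOne) = l'.map fun a => isOne (A.out a) := by
      rw [← hl', List.map_map]; rfl
    rw [jst_out, h, cmpBits, List.map_drop]
    rfl

theorem exec_postProg (E : ℕ) (t : ∀ k, List (A.Γ k)) (m i : List Sym) :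
    ∃ s', ∃ n ≤ 12 * ((t A.k₁).length + E) + 11,
      Exec (postProg A) (jst A (eword E ++ m) [] [] [] i [] t) s' n ∧
      s' (.inl .out) = [bsym (verdict ((t A.k₁).map A.out) E)] := by
  cases hl : t A.k₁ with
  | nil =>
    refine ⟨_, 1 + 1, by omega, Exec.case_nil (k := Sum.inr A.k₁) (by simp [hl])
      (Exec.push_eq (k := Sum.inl WK.out) (update_jst_out _ _ _ _ _ _ _ _ _)), rfl⟩
  | cons a l =>
    by_cases ha : A.out a = .sign false
    · obtain ⟨s', n, hn, e, h⟩ := exec_cmpProg A E (Function.update t A.k₁ l) l (by simp) m i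
      refine ⟨s', n + 1, by simp; omega, Exec.case_cons (k := Sum.inr A.k₁) (a := a) (l := l)
        (by simp [hl]) (update_jst_inr _ _ _ _ _ _ _ _ _ _) ?_, ?_⟩
      · simpa [ha] using e
      · rw [h, List.map_cons, ha]; rfl
    · refine ⟨_, 1 + 1, by omega, Exec.case_cons (k := Sum.inr A.k₁) (a := a) (l := l)
        (by simp [hl]) (update_jst_inr _ _ _ _ _ _ _ _ _ _)
        (s' := jst A (eword E ++ m) [] [] [] i [0] (Function.update t A.k₁ l)) ?_, ?_⟩
      · rcases h : A.out a with (_ | _) | _ | _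
        · exact absurd h ha
        all_goals
          simp only [Option.map_some, h]
          exact Exec.push_eq (k := Sum.inl WK.out) (update_jst_out _ _ _ _ _ _ _ _ _)
      · rcases h : A.out a with (_ | _) | _ | _
        · exact absurd h ha
        all_goals
          simp [h, verdict, bsym]

end Machine

/-! ### Runs of probabilistic machines -/

namespace ProbTM

variable {I O : Type} (M : ProbTM I O)

theorem step_of_halted {c : M.Cfg} (h : c.l = none) (b : Bool) : M.step b c = c := by
  obtain ⟨l, v, s⟩ := c
  subst h
  rfl

theorem run_of_halted {c : M.Cfg} (h : c.l = none) (t : ℕ) : M.run t c = PMF.pure c := by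
  induction t with
  | zero => rfl
  | succ t ih =>
    simp only [run, M.step_of_halted h, ih]
    exact PMF.bind_const _ _

/-- When both outcomes of a flip lead to the same configuration, averaging over the coin has no
effect. -/
theorem run_of_reach {n : ℕ} {c c' : M.Cfg} (h : Reach M.step n c c') (t : ℕ) :
    M.run (n + t) c = M.run t c' := by
  induction h with
  | refl c => rw [Nat.zero_add]
  | head h₁ _ ih =>
    rw [Nat.add_right_comm]
    simp only [run, h₁, ih]
    exact PMF.bind_const _ _

/-- The probability that the machine has halted with an output in `S` after `t` steps. -/
noncomputable def haltProb (t : ℕ) (c : M.Cfg) (S : Set (List O)) : ℝ≥0∞ :=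
  (M.run t c).toOuterMeasure {c | c.l = none ∧ M.output c ∈ S}

theorem haltProb_zero_of_not {c : M.Cfg} {S : Set (List O)} (h : ¬ (c.l = none ∧ M.output c ∈ S)) :
    M.haltProb 0 c S = 0 := by
  classical
  rw [haltProb, run, PMF.toOuterMeasure_pure_apply]
  exact if_neg h

theorem haltProb_of_halted {c : M.Cfg} {S : Set (List O)} (h : c.l = none) (t : ℕ)
    (hS : M.output c ∈ S) : M.haltProb t c S = 1 := by
  classical
  rw [haltProb, M.run_of_halted h, PMF.toOuterMeasure_pure_apply]
  exact if_pos ⟨h, hS⟩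

theorem haltProb_le_one (t : ℕ) (c : M.Cfg) (S : Set (List O)) : M.haltProb t c S ≤ 1 := by
  refine (measure_mono (Set.subset_univ _)).trans ?_
  rw [(PMF.toOuterMeasure_apply_eq_one_iff _ _).2 (Set.subset_univ _)]

theorem haltProb_succ (t : ℕ) (c : M.Cfg) (S : Set (List O)) : M.haltProb (t + 1) c S =
    ∑' b, PMF.uniformOfFintype Bool b * M.haltProb t (M.step b c) S := by
  rw [haltProb, run, PMF.toOuterMeasure_bind_apply]
  rfl

theorem haltProb_succ_le {I' O' : Type} {M' : ProbTM I' O'} {t t' : ℕ} {c : M.Cfg} {c' : M'.Cfg}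
    {S : Set (List O)} {S' : Set (List O')}
    (h : ∀ b, M.haltProb t (M.step b c) S ≤ M'.haltProb t' (M'.step b c') S') :
    M.haltProb (t + 1) c S ≤ M'.haltProb (t' + 1) c' S' := by
  rw [haltProb_succ, haltProb_succ]
  exact ENNReal.tsum_le_tsum fun b => mul_le_mul_right (h b) _

/-- Halted configurations persist, so additional time never lowers the probability. Hence only upper
bounds for the durations of the phases are needed. -/
theorem haltProb_mono (c : M.Cfg) (S : Set (List O)) : Monotone fun t => M.haltProb t c S := by
  refine monotone_nat_of_le_succ fun t => ?_
  induction t generalizing c with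
  | zero =>
    by_cases h : c.l = none ∧ M.output c ∈ S
    · rw [M.haltProb_of_halted h.1 (0 + 1) h.2]
      exact M.haltProb_le_one 0 c S
    · rw [M.haltProb_zero_of_not h]
      exact zero_le
  | succ t ih => exact M.haltProb_succ_le fun b => ih (M.step b c)

theorem haltProb_of_reach {n : ℕ} {c c' : M.Cfg} (h : Reach M.step n c c') (t : ℕ)
    (S : Set (List O)) : M.haltProb (n + t) c S = M.haltProb t c' S := by
  rw [haltProb, haltProb, M.run_of_reach h]

theorem haltProb_le_prob (t : ℕ) (w : List I) (S : Set (List O)) :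
    M.haltProb t (M.init w) S ≤ M.prob w S := le_iSup (fun t => M.haltProb t (M.init w) S) t

theorem mem_support_run_succ {t : ℕ} {c c' : M.Cfg} :
    c' ∈ (M.run (t + 1) c).support ↔ ∃ b, c' ∈ (M.run t (M.step b c)).support := by
  simp [run]

/-- The number of letters that a statement pushes. -/
def pushes {K : Type} {Γ : K → Type} {Λ σ : Type} : Turing.TM2.Stmt Γ Λ σ → ℕ
  | .push _ _ q => pushes q + 1
  | .peek _ _ q => pushes q
  | .pop _ _ q => pushes q
  | .load _ q => pushes q
  | .branch _ q₁ q₂ => pushes q₁ + pushes q₂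
  | .goto _ => 0
  | .halt => 0

/-- After `t` steps of an algorithm its output has grown by at most a constant times `t`, which
keeps the evaluation of the output linear in its running time. -/
theorem length_stepAux {K : Type} [DecidableEq K] {Γ : K → Type} {Λ σ : Type}
    (q : Turing.TM2.Stmt Γ Λ σ) (v : σ) (S : ∀ k, List (Γ k)) (k : K) :
    ((Turing.TM2.stepAux q v S).stk k).length ≤ (S k).length + pushes q := by
  induction q generalizing v S with
  | push k' f q ih =>
    refine (ih _ _).trans ?_
    by_cases h : k = k'
    · subst h; simp [pushes]; omega
    · rw [Function.update_of_ne h]; simp only [pushes]; omega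
  | peek k' f q ih => exact ih _ _
  | pop k' f q ih =>
    refine (ih _ _).trans ?_
    by_cases h : k = k'
    · subst h; simp [pushes]
    · rw [Function.update_of_ne h]; simp only [pushes]; omega
  | load a q ih => exact ih _ _
  | branch f q₁ q₂ ih₁ ih₂ =>
    rw [Turing.TM2.stepAux]
    have h₁ := ih₁ v S
    have h₂ := ih₂ v S
    cases f v <;> simp only [pushes, cond_true, cond_false] <;> omega
  | goto l => simp [Turing.TM2.stepAux]
  | halt => simp [Turing.TM2.stepAux]

/-- A bound for the growth of the stacks in one step. -/
def growth : ℕ := ∑ b : Bool, ∑ l : M.Λ, pushes (M.prog b l)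

theorem length_step (b : Bool) (c : M.Cfg) (k : M.K) :
    ((M.step b c).stk k).length ≤ (c.stk k).length + M.growth := by
  obtain ⟨l, v, s⟩ := c
  cases l with
  | none => exact Nat.le_add_right _ _
  | some l =>
    refine (length_stepAux (M.prog b l) v s k).trans (Nat.add_le_add_left ?_ _)
    exact (Finset.single_le_sum (f := fun l => pushes (M.prog b l)) (fun _ _ => Nat.zero_le _)
      (Finset.mem_univ l)).trans
      (Finset.single_le_sum (f := fun b => ∑ l : M.Λ, pushes (M.prog b l))
        (fun _ _ => Nat.zero_le _) (Finset.mem_univ b))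

end ProbTM

/-! ### The reduction machine -/

section Machine

/-- The statements of a machine, seen as statements of a machine with more stacks. -/
def liftStmt {K₁ K₂ : Type} {Γ₁ : K₁ → Type} {Γ₂ : K₂ → Type} {Λ₂ Λ σ ρ : Type}
    (emb : Λ₂ → Λ) (exit : Λ) :
    Turing.TM2.Stmt Γ₂ Λ₂ σ → Turing.TM2.Stmt (SumΓ Γ₁ Γ₂) Λ (σ × ρ)
  | .push k f q => .push (.inr k) (fun v => f v.1) (liftStmt emb exit q)
  | .peek k f q => .peek (.inr k) (fun v r => (f v.1 r, v.2)) (liftStmt emb exit q)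
  | .pop k f q => .pop (.inr k) (fun v r => (f v.1 r, v.2)) (liftStmt emb exit q)
  | .load a q => .load (fun v => (a v.1, v.2)) (liftStmt emb exit q)
  | .branch f q₁ q₂ => .branch (fun v => f v.1) (liftStmt emb exit q₁) (liftStmt emb exit q₂)
  | .goto l => .goto fun v => emb (l v.1)
  | .halt => .goto fun _ => exit

/-- The lifted machine moves in lock step with the original one, except that halting becomes a jump
to `exit`. -/
theorem stepAux_liftStmt {K₁ K₂ : Type} [DecidableEq K₁] [DecidableEq K₂] {Γ₁ : K₁ → Type}
    {Γ₂ : K₂ → Type} {Λ₂ Λ σ ρ : Type} (emb : Λ₂ → Λ) (exit : Λ) (q : Turing.TM2.Stmt Γ₂ Λ₂ σ)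
    (v : σ) (r : ρ) (s : ∀ k, List (Γ₁ k)) (t : ∀ k, List (Γ₂ k)) :
    Turing.TM2.stepAux (liftStmt emb exit q) (v, r) (joinStk s t) =
      ⟨some ((Turing.TM2.stepAux q v t).l.elim exit emb), ((Turing.TM2.stepAux q v t).var, r),
        joinStk s (Turing.TM2.stepAux q v t).stk⟩ := by
  induction q generalizing v t with
  | push k f q ih =>
    simp only [liftStmt, Turing.TM2.stepAux, joinStk_inr, update_joinStk_inr]
    exact ih _ _
  | peek k f q ih => exact ih _ _
  | pop k f q ih =>
    simp only [liftStmt, Turing.TM2.stepAux, joinStk_inr, update_joinStk_inr]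
    exact ih _ _
  | load a q ih => exact ih _ _
  | branch f q₁ q₂ ih₁ ih₂ =>
    simp only [liftStmt, Turing.TM2.stepAux]
    cases f v
    · exact ih₂ _ _
    · exact ih₁ _ _
  | goto l => rfl
  | halt => rfl

variable {I : Type} (A : ProbTM I RatSym) (dec : ℕ → I) (pt : WProg)

instance finite_MΓ : (k : WK ⊕ A.K) → Finite (MΓ A k)
  | .inl _ => inferInstanceAs (Finite Sym)
  | .inr k => inferInstanceAs (Finite (A.Γ k))

/-- The first part of the reduction: the input is loaded and processed on the main stack. -/
def preProg : Prog (MΓ A) := (Prog.seq loadProg pt).lift A.Γ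

/-- The control points of the reduction machine. -/
abbrev RedLab : Type :=
  ((preProg A pt).Lab ⊕ (writeProg A dec).Lab) ⊕ ((A.Λ ⊕ (postProg A).Lab) ⊕ Bool)

/-- The program of the reduction machine. -/
def redCode (b : Bool) : RedLab A dec pt →
    Turing.TM2.Stmt (MΓ A) (RedLab A dec pt) (A.σ × (∀ k, Option (MΓ A k)))
  | .inl (.inl l) => (preProg A pt).code (fun l => .inl (.inl l)) (.inr (.inr true)) l
  | .inl (.inr l) =>
      (writeProg A dec).code (fun l => .inl (.inr l)) (.inr (.inl (.inl A.main))) l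
  | .inr (.inl (.inl l)) => liftStmt (fun l => .inr (.inl (.inl l)))
      (.inr (.inl (.inr (postProg A).entry))) (A.prog b l)
  | .inr (.inl (.inr l)) =>
      (postProg A).code (fun l => .inr (.inl (.inr l))) (.inr (.inr false)) l
  | .inr (.inr true) => .pop (.inl WK.main) (fun v r => (v.1, Function.update v.2 (.inl WK.main) r))
      (.goto fun v => if (v.2 (.inl WK.main) : Option Sym) = some 1 then
        .inl (.inr (writeProg A dec).entry) else .inr (.inr false))
  | .inr (.inr false) => .halt

/-- The machine that maps a formula to a network, runs the quadrature algorithm `A` on it, and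
evaluates the result. -/
noncomputable def redMachine : ProbTM CNFSym Bool :=
  letI : Fintype (preProg A pt).Lab := @Fintype.ofFinite _ (Prog.finite_lab _)
  letI : Fintype (writeProg A dec).Lab := @Fintype.ofFinite _ (Prog.finite_lab _)
  letI : Fintype (postProg A).Lab := @Fintype.ofFinite _ (Prog.finite_lab _)
  letI : ∀ k, Fintype (MΓ A k) := fun k => @Fintype.ofFinite _ (finite_MΓ A k)
  { K := WK ⊕ A.K
    k₀ := .inl .inp
    k₁ := .inl .out
    Γ := MΓ A
    Λ := RedLab A dec pt
    main := .inl (.inl (preProg A pt).entry)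
    σ := A.σ × (∀ k, Option (MΓ A k))
    initialState := (A.initialState, fun _ => none)
    prog := redCode A dec pt
    inp := CNFSym.toSym
    out := fun a : Sym => decide (a = 1) }

/-- Configurations of the reduction machine. -/
abbrev RedCfg : Type :=
  Turing.TM2.Cfg (MΓ A) (RedLab A dec pt) (A.σ × (∀ k, Option (MΓ A k)))

/-- The steps of the reduction machine. -/
def redStep (b : Bool) (c : RedCfg A dec pt) : RedCfg A dec pt := detStep (redCode A dec pt b) c

theorem redMachine_step : (redMachine A dec pt).step = redStep A dec pt := rfl

/-- The configuration of the reduction machine in which `A` is simulated in the configuration `c`. -/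
def simCfg (E : ℕ) (ρ : ∀ k, Option (MΓ A k)) (c : A.Cfg) : RedCfg A dec pt :=
  ⟨some (c.l.elim (.inr (.inl (.inr (postProg A).entry))) fun l => .inr (.inl (.inl l))),
    (c.var, ρ), jst A (eword E ++ [0]) [] [] [] [] [] c.stk⟩

/-- One step of `A` is one step of the simulation with the same coin. A halted configuration is
represented by the entry of the evaluation phase, hence the assumption on `c`. -/
theorem redStep_simCfg (E : ℕ) (ρ : ∀ k, Option (MΓ A k)) {c : A.Cfg} (h : c.l ≠ none)
    (b : Bool) : redStep A dec pt b (simCfg A dec pt E ρ c) =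
      simCfg A dec pt E ρ (A.step b c) := by
  obtain ⟨l, v, s⟩ := c
  cases l with
  | none => exact absurd rfl h
  | some l => exact stepAux_liftStmt _ _ (A.prog b l) v ρ _ s

theorem reach_post (E : ℕ) (ρ : ∀ k, Option (MΓ A k)) {c : A.Cfg} (h : c.l = none) :
    ∃ n ≤ 12 * ((c.stk A.k₁).length + E) + 12, ∃ c', Reach (redMachine A dec pt).step n
      (simCfg A dec pt E ρ c) c' ∧ c'.l = none ∧
      (redMachine A dec pt).output c' = [verdict (A.output c) E] := by
  obtain ⟨l, v, s⟩ := c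
  subst h
  obtain ⟨s', n, hn, e, hs'⟩ := exec_postProg A E s [0] []
  obtain ⟨ρ', h⟩ := e.reaches (redCode A dec pt) (fun l => .inr (.inl (.inr l))) (.inr (.inr false))
    (fun b l => rfl) (v, ρ)
  refine ⟨n + 1, Nat.succ_le_succ hn, ⟨none, (v, ρ'), s'⟩, h.trans (.head (fun b => rfl) (.refl _)),
    rfl, ?_⟩
  change (s' (.inl .out)).map (fun a : Sym => decide (a = 1)) = _
  rw [hs']
  change [decide (bsym _ = 1)] = _
  rw [ProbTM.output]
  cases verdict (s A.k₁ |>.map A.out) E <;> rfl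

/-- A bound for the number of steps after the simulation of `A`. -/
def postTime (E t : ℕ) (c : A.Cfg) : ℕ :=
  12 * ((c.stk A.k₁).length + A.growth * t + E) + 12

/-- A step may lengthen the output stack by `A.growth` but uses up one unit of `t`, so this
potential does not increase. -/
theorem postTime_step (E t : ℕ) (c : A.Cfg) (b : Bool) :
    postTime A E t (A.step b c) ≤ postTime A E (t + 1) c := by
  have := A.length_step b c A.k₁
  unfold postTime
  rw [Nat.mul_add A.growth t 1]
  omega

/-- Induction on the first coin flip. While `A` runs the flips are shared, and once it has halted
with output in `S`, the evaluation reaches the answer `a` with certainty. -/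
theorem haltProb_le_simCfg {E : ℕ} {S : Set (List RatSym)} {a : Bool}
    (hS : ∀ u ∈ S, verdict u E = a) (t : ℕ) : ∀ (c : A.Cfg) (ρ : ∀ k, Option (MΓ A k)),
    A.haltProb t c S ≤
      (redMachine A dec pt).haltProb (t + postTime A E t c) (simCfg A dec pt E ρ c) {[a]} := by
  have halted : ∀ (t : ℕ) (c : A.Cfg) (ρ : ∀ k, Option (MΓ A k)), c.l = none →
      A.haltProb t c S ≤
      (redMachine A dec pt).haltProb (t + postTime A E t c) (simCfg A dec pt E ρ c) {[a]} := by
    intro t c ρ hc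
    by_cases hout : A.output c ∈ S
    · obtain ⟨n, hn, c', hr, hc', ho⟩ := reach_post A dec pt E ρ hc
      have hle : n ≤ t + postTime A E t c := by unfold postTime; nlinarith
      obtain ⟨j, hj⟩ := Nat.exists_eq_add_of_le hle
      rw [hj]
      have : (redMachine A dec pt).haltProb (n + j) (simCfg A dec pt E ρ c) {[a]} = 1 := by
        exact (ProbTM.haltProb_of_reach _ hr _ _).trans
          (ProbTM.haltProb_of_halted _ hc' j (by rw [ho, hS _ hout]; rfl))
      rw [this]
      exact A.haltProb_le_one _ _ _
    · have h0 : A.haltProb t c S = 0 := by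
        rw [ProbTM.haltProb, A.run_of_halted hc]
        exact A.haltProb_zero_of_not fun h => hout h.2
      rw [h0]
      exact zero_le
  induction t with
  | zero =>
    intro c ρ
    by_cases hc : c.l = none
    · exact halted 0 c ρ hc
    · rw [A.haltProb_zero_of_not fun h => hc h.1]
      exact zero_le
  | succ t ih =>
    intro c ρ
    by_cases hc : c.l = none
    · exact halted (t + 1) c ρ hc
    · rw [Nat.add_right_comm]
      refine A.haltProb_succ_le fun b => (ih (A.step b c) ρ).trans ?_
      rw [redMachine_step, redStep_simCfg A dec pt E ρ hc]
      exact ProbTM.haltProb_mono _ _ _ (Nat.add_le_add_left (postTime_step A E t c b) t)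

/-- The paths of `A` halt at different times; the common bound `B` allows each of them to finish its
evaluation phase. -/
theorem halts_simCfg {E : ℕ} (t : ℕ) : ∀ (c : A.Cfg) (ρ : ∀ k, Option (MΓ A k)) (B : ℕ),
    postTime A E t c ≤ B → (∀ c' ∈ (A.run t c).support, c'.l = none) →
    ∀ c' ∈ ((redMachine A dec pt).run (t + B) (simCfg A dec pt E ρ c)).support, c'.l = none := by
  have halted : ∀ (t : ℕ) (c : A.Cfg) (ρ : ∀ k, Option (MΓ A k)) (B : ℕ), postTime A E t c ≤ B →
      c.l = none →
      ∀ c' ∈ ((redMachine A dec pt).run (t + B) (simCfg A dec pt E ρ c)).support,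
        c'.l = none := by
    intro t c ρ B hB hc c' hc'
    obtain ⟨n, hn, c₁, hr, hc₁, -⟩ := reach_post A dec pt E ρ hc
    have hle : n ≤ t + B := by unfold postTime at hB; nlinarith
    obtain ⟨j, hj⟩ := Nat.exists_eq_add_of_le hle
    rw [hj, ProbTM.run_of_reach _ hr, ProbTM.run_of_halted _ hc₁, PMF.support_pure,
      Set.mem_singleton_iff] at hc'
    rw [hc', hc₁]
  induction t with
  | zero =>
    intro c ρ B hB h
    exact halted 0 c ρ B hB (h c (by simp [ProbTM.run]))
  | succ t ih =>
    intro c ρ B hB h c' hc'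
    by_cases hc : c.l = none
    · exact halted (t + 1) c ρ B hB hc c' hc'
    · rw [Nat.add_right_comm] at hc'
      obtain ⟨b, hb⟩ := (ProbTM.mem_support_run_succ _).1 hc'
      rw [redMachine_step, redStep_simCfg A dec pt E ρ hc] at hb
      exact ih (A.step b c) ρ B ((postTime_step A E t c b).trans hB)
        (fun c'' hc'' => h c'' (A.mem_support_run_succ.2 ⟨b, hc''⟩)) c' hb

theorem init_redMachine (w : List CNFSym) : (redMachine A dec pt).init w =
    ⟨some (.inl (.inl (preProg A pt).entry)), (A.initialState, fun _ => none),
      jst A [] [] [] [] (w.map CNFSym.toSym) [] fun _ => []⟩ := by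
  refine congrArg (Turing.TM2.Cfg.mk _ _) ?_
  funext k
  rcases k with k | k
  · cases k <;> rfl
  · rfl

theorem esize_revCode_le (w : List CNFSym) : esize (revCode w) ≤ 8 * w.length + 1 := by
  have := esize_le_of_forall (l := revCode w) (B := 7) fun a ha => by
    simp only [revCode, List.mem_reverse, List.mem_map] at ha
    obtain ⟨s, -, rfl⟩ := ha
    rcases s with _ | (_ | _) | _ <;> simp [CNFSym.toNat]
  simpa [revCode] using this

/-! ### Behaviour of the reduction machine for a computed reduction `R` -/

section Reduction

variable {R : List ℕ → Option (List ℕ × ℕ)} {e : ℕ}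
  (hR : ∀ x, esize (R x) ≤ (esize x + 2) ^ e ∧ Runs pt (eword x) (eword (R x)) ((esize x + 2) ^ e))

include hR

theorem reach_pre (w : List CNFSym) : ∃ n ≤ 11 * w.length + 2 + (8 * w.length + 3) ^ e,
    ∃ ρ, Reach (redMachine A dec pt).step n ((redMachine A dec pt).init w)
      ⟨some (.inr (.inr true)), (A.initialState, ρ),
        jst A (eword (R (revCode w))) [] [] [] [] [] fun _ => []⟩ := by
  obtain ⟨n₁, hn₁, e₁⟩ := exec_loadProg w
  obtain ⟨n₂, hn₂, e₂⟩ := (hR (revCode w)).2 [] [] [] [] [] []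
  rw [List.append_nil, List.append_nil] at e₂
  have e₃ := (Exec.seq e₁ e₂).lift (Γ₂ := A.Γ) fun _ => []
  obtain ⟨ρ, h⟩ := e₃.reaches (redCode A dec pt) (fun l => .inl (.inl l)) (.inr (.inr true))
    (fun b l => rfl) (A.initialState, fun _ => none)
  refine ⟨n₁ + n₂, ?_, ρ, ?_⟩
  · have h₁ : (esize (revCode w) + 2) ^ e ≤ (8 * w.length + 3) ^ e :=
      Nat.pow_le_pow_left (by have := esize_revCode_le w; omega) e
    omega
  · rw [init_redMachine]
    exact h

/-- The reduction machine rejects invalid inputs. -/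
theorem redMachine_reject {w : List CNFSym} (h : R (revCode w) = none) (S : Set (List Bool))
    (hS : [] ∉ S) : (redMachine A dec pt).prob w S = 0 := by
  obtain ⟨n, -, ρ, hr⟩ := reach_pre A dec pt hR w
  rw [h] at hr
  -- The word of `none` is the single letter `0`; the machine then halts with an empty output stack.
  have hr' := hr.trans (.head (c₁ := ⟨some (.inr (.inr false)),
    (A.initialState, Function.update ρ (.inl WK.main) (some (0 : Sym))),
    jst A [] [] [] [] [] [] fun _ => []⟩) (fun b => ?_)
    (.head (c₁ := ⟨none, (A.initialState, Function.update ρ (.inl WK.main) (some (0 : Sym))),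
    jst A [] [] [] [] [] [] fun _ => []⟩) (fun b => rfl) (.refl _)))
  · refine le_antisymm (iSup_le fun t => ?_) zero_le
    refine (ProbTM.haltProb_mono _ _ _ (Nat.le_add_left t (n + (0 + 1 + 1)))).trans ?_
    change ProbTM.haltProb _ _ _ _ ≤ _
    rw [ProbTM.haltProb, ProbTM.run_of_reach _ hr', ProbTM.run_of_halted _ rfl]
    exact (ProbTM.haltProb_zero_of_not _ fun h => hS h.2).le
  · change Turing.TM2.stepAux (redCode A dec pt b (.inr (.inr true))) _ _ = _
    simp only [redCode, Turing.TM2.stepAux, Function.update_self]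
    have hhead : (jst A (eword (none : Option (List ℕ × ℕ))) [] [] [] [] [] (fun _ => [])
      (.inl WK.main)).head? = some (0 : Sym) := rfl
    rw [hhead, if_neg (fun h => by injection h with h; exact absurd h (by simp)), update_jst_main]
    rfl

/-- On valid inputs the reduction machine starts `A`. -/
theorem reach_sim {w : List CNFSym} {l : List ℕ} {E : ℕ} (h : R (revCode w) = some (l, E))
    (hl : ∀ a ∈ l, a < 9) : ∃ n ≤ 11 * w.length + 5 + 3 * (8 * w.length + 3) ^ e,
    ∃ ρ, Reach (redMachine A dec pt).step n ((redMachine A dec pt).init w)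
      (simCfg A dec pt E ρ (A.init (l.reverse.map dec))) := by
  obtain ⟨n, hn, ρ, hr⟩ := reach_pre A dec pt hR w
  have hsz := (hR (revCode w)).1
  rw [h] at hr hsz
  obtain ⟨n', hn', ex⟩ := exec_writeProg A dec l E (fun _ => []) [0] [] [] [] [] [] hl
  obtain ⟨ρ', hr'⟩ := ex.reaches (redCode A dec pt) (fun l => .inl (.inr l))
    (.inr (.inl (.inl A.main))) (fun b l => rfl)
    (A.initialState, Function.update ρ (.inl WK.main) (some (1 : Sym)))
  refine ⟨n + (n' + 1), ?_, ρ', hr.trans (.head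
    (c₁ := ⟨some (.inl (.inr (writeProg A dec).entry)),
      (A.initialState, Function.update ρ (.inl WK.main) (some (1 : Sym))),
      jst A (eword (l, E) ++ [0]) [] [] [] [] [] fun _ => []⟩) (fun b => ?_) ?_)⟩
  · have h₁ : (esize (revCode w) + 2) ^ e ≤ (8 * w.length + 3) ^ e :=
      Nat.pow_le_pow_left (by have := esize_revCode_le w; omega) e
    simp only [esize_some, esize_pair] at hsz
    omega
  · change Turing.TM2.stepAux (redCode A dec pt b (.inr (.inr true))) _ _ = _
    simp only [redCode, Turing.TM2.stepAux, Function.update_self]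
    have hhead : (jst A (eword (some (l, E))) [] [] [] [] [] (fun _ => [])
      (.inl WK.main)).head? = some (1 : Sym) := rfl
    rw [hhead, if_pos rfl, update_jst_main]
    rfl
  · have heq : simCfg A dec pt E ρ' (A.init (l.reverse.map dec)) =
        ⟨some (.inr (.inl (.inl A.main))), (A.initialState, ρ'),
          jst A (eword E ++ [0]) [] [] [] [] []
            (Function.update (fun _ => []) A.k₀ ((l.reverse.map dec).map A.inp))⟩ := rfl
    rw [heq]
    simp only [List.append_nil] at hr'
    exact hr'

/-- The reduction machine evaluates the output of `A`. -/
theorem prob_le_redMachine {w : List CNFSym} {l : List ℕ} {E : ℕ} (h : R (revCode w) = some (l, E))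
    (hl : ∀ a ∈ l, a < 9) {S : Set (List RatSym)} {a : Bool} (hS : ∀ u ∈ S, verdict u E = a) :
    A.prob (l.reverse.map dec) S ≤ (redMachine A dec pt).prob w {[a]} := by
  obtain ⟨n, -, ρ, hr⟩ := reach_sim A dec pt hR h hl
  refine iSup_le fun t => (haltProb_le_simCfg A dec pt hS t _ ρ).trans ?_
  refine le_trans (le_of_eq ?_) (ProbTM.haltProb_le_prob _
    (n + (t + postTime A E t (A.init (l.reverse.map dec)))) w {[a]})
  exact (ProbTM.haltProb_of_reach _ hr _ _).symm

/-- The running time of the reduction machine. -/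
theorem halts_redMachine {w : List CNFSym} {l : List ℕ} {E : ℕ} (h : R (revCode w) = some (l, E))
    (hl : ∀ a ∈ l, a < 9) {t : ℕ} (ht : A.HaltsWithin (l.reverse.map dec) t) :
    ∃ n ≤ 11 * w.length + 5 + 3 * (8 * w.length + 3) ^ e +
      (t + (12 * (l.length + A.growth * t + E) + 12)),
      (redMachine A dec pt).HaltsWithin w n := by
  obtain ⟨n, hn, ρ, hr⟩ := reach_sim A dec pt hR h hl
  -- Input and output stack of `A` may coincide, in which case the input counts towards the initial
  -- length.
  have hlen : ((A.init (l.reverse.map dec)).stk A.k₁).length ≤ l.length := by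
    rw [ProbTM.init]
    by_cases hk : A.k₁ = A.k₀
    · rw [hk]; simp
    · simp [Function.update_of_ne hk]
  refine ⟨n + (t + (12 * (l.length + A.growth * t + E) + 12)), Nat.add_le_add_right hn _, ?_⟩
  intro c hc
  rw [ProbTM.run_of_reach _ hr] at hc
  refine halts_simCfg A dec pt t _ ρ _ ?_ ht c hc
  unfold postTime
  omega

end Reduction

end Machine

/-! ### The network of a formula -/

/-- The weight that belongs to a letter code. -/
noncomputable def weightVal (δ : ℝ) : ℕ → ℝ
  | 1 => 1
  | 2 => -1
  | 3 => δ
  | 4 => -(1 - δ)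
  | 5 => δ⁻¹
  | 6 => -δ⁻¹
  | _ => 0

/-- The output of the neuron `i` of a layer with `m` inputs. -/
noncomputable def neuron (δ : ℝ) (e : ℕ → ℕ → ℕ) (b : ℕ → ℕ) (m : ℕ) (x : ℕ → ℝ) (i : ℕ) : ℝ :=
  max 0 (∑ j ∈ Finset.range m, weightVal δ (e i j) * x j + weightVal δ (b i))

section Build

variable {θ : Finset ℝ} {δ : ℝ} (hθ : cvWeights δ ⊆ θ)

include hθ in
theorem weightVal_mem (a : ℕ) : weightVal δ a ∈ θ := by
  rcases a with _ | _ | _ | _ | _ | _ | _ | a <;>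
    exact hθ (by simp [cvWeights, weightVal])

/-- The weight of a letter code as an element of `θ`. -/
noncomputable def decWeight (a : ℕ) : θ := ⟨weightVal δ a, weightVal_mem hθ a⟩

/-- The letter of a letter code. -/
noncomputable def decLetter (a : ℕ) : NetSym θ :=
  if a < 7 then .weight (decWeight hθ a) else if a = 7 then .rowEnd else .layerEnd

/-- The matrix with the given letter codes. -/
noncomputable def codeMatrix (h m : ℕ) (e : ℕ → ℕ → ℕ) : Matrix (Fin h) (Fin m) θ :=
  fun i j => decWeight hθ (e i j)

/-- The bias vector with the given letter codes. -/
noncomputable def codeBias (h : ℕ) (b : ℕ → ℕ) : Fin h → θ := fun i => decWeight hθ (b i)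

theorem ofFn_eq_map_range {β : Type} (n : ℕ) (f : ℕ → β) :
    List.ofFn (fun i : Fin n => f i) = (List.range n).map f := by
  rw [List.ofFn_eq_map, ← List.map_coe_finRange_eq_range, List.map_map]
  rfl

theorem encodeLayer_code (h m : ℕ) {e : ℕ → ℕ → ℕ} {b : ℕ → ℕ} (he : ∀ i j, e i j < 7)
    (hb : ∀ i, b i < 7) : encodeLayer (codeMatrix hθ h m e) (codeBias hθ h b) =
      (layerCode e b h m).map (decLetter hθ) := by
  have hrow : ∀ i, List.ofFn (fun j : Fin m => NetSym.weight (decWeight hθ (e i j))) ++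
      [NetSym.weight (decWeight hθ (b i)), NetSym.rowEnd] =
      ((List.range m).map (e i) ++ [b i, 7]).map (decLetter hθ) := fun i => by
    rw [ofFn_eq_map_range m fun j => NetSym.weight (decWeight hθ (e i j))]
    simp [decLetter, he, hb, Function.comp_def]
  unfold encodeLayer layerCode codeMatrix codeBias
  rw [ofFn_eq_map_range h fun i =>
    List.ofFn (fun j : Fin m => NetSym.weight (decWeight hθ (e i j))) ++
      [NetSym.weight (decWeight hθ (b i)), NetSym.rowEnd]]
  simp only [hrow, List.map_append, List.map_flatMap]
  simp [List.flatMap, decLetter]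

/-- A layer with the given letter codes in front of a network. -/
noncomputable def consCode {h m o : ℕ} (e : ℕ → ℕ → ℕ) (b : ℕ → ℕ) (Φ : Net θ h o) : Net θ m o :=
  .cons (codeMatrix hθ h m e) (codeBias hθ h b) Φ

theorem affine_code (h m : ℕ) (e : ℕ → ℕ → ℕ) (b : ℕ → ℕ) (x : ℕ → ℝ) (i : Fin h) :
    Net.affine (codeMatrix hθ h m e) (codeBias hθ h b) (fun j => x j) i =
      ∑ j ∈ Finset.range m, weightVal δ (e i j) * x j + weightVal δ (b i) := by
  rw [Finset.sum_range]
  rfl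

theorem realize_consCode {h m o : ℕ} (e : ℕ → ℕ → ℕ) (b : ℕ → ℕ) (Φ : Net θ h o) (x : ℕ → ℝ) :
    (consCode hθ (m := m) e b Φ).realize (fun j => x j) =
      Φ.realize (fun i => neuron δ e b m x i) := by
  rw [consCode, Net.realize]
  simp only [affine_code]
  rfl

theorem realize_iterate_consCode {h o : ℕ} (e : ℕ → ℕ → ℕ) (b : ℕ → ℕ) (Φ : Net θ h o) (n : ℕ)
    (x : ℕ → ℝ) : ((consCode hθ e b)^[n] Φ).realize (fun j => x j) =
      Φ.realize (fun i => (neuron δ e b h)^[n] x i) := by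
  induction n generalizing x with
  | zero => rfl
  | succ n ih =>
    rw [Function.iterate_succ_apply', realize_consCode, ih, Function.iterate_succ_apply]

theorem depth_iterate_consCode {h o : ℕ} (e : ℕ → ℕ → ℕ) (b : ℕ → ℕ) (Φ : Net θ h o) (n : ℕ) :
    ((consCode hθ e b)^[n] Φ).depth = Φ.depth + n := by
  induction n with
  | zero => rfl
  | succ n ih => rw [Function.iterate_succ_apply', consCode, Net.depth, ih, Nat.add_assoc]

theorem widthAtMost_iterate_consCode {h o w : ℕ} (e : ℕ → ℕ → ℕ) (b : ℕ → ℕ) {Φ : Net θ h o}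
    (hΦ : Φ.WidthAtMost w) (hh : 1 ≤ h ∧ h ≤ w) (n : ℕ) :
    ((consCode hθ e b)^[n] Φ).WidthAtMost w := by
  induction n with
  | zero => exact hΦ
  | succ n ih =>
    rw [Function.iterate_succ_apply', consCode, Net.WidthAtMost]
    exact ⟨hh, ih⟩

theorem encode_consCode {h m o : ℕ} {e : ℕ → ℕ → ℕ} {b : ℕ → ℕ} (he : ∀ i j, e i j < 7)
    (hb : ∀ i, b i < 7) (Φ : Net θ h o) : (consCode hθ (m := m) e b Φ).encode =
      (layerCode e b h m).map (decLetter hθ) ++ Φ.encode := by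
  rw [consCode, Net.encode, encodeLayer_code hθ h m he hb]

theorem encode_iterate_consCode {h o : ℕ} {e : ℕ → ℕ → ℕ} {b : ℕ → ℕ} (he : ∀ i j, e i j < 7)
    (hb : ∀ i, b i < 7) (Φ : Net θ h o) (n : ℕ) : ((consCode hθ e b)^[n] Φ).encode =
      ((List.replicate n ()).flatMap fun _ => layerCode e b h h).map (decLetter hθ) ++ Φ.encode := by
  induction n with
  | zero => rfl
  | succ n ih =>
    rw [Function.iterate_succ_apply', encode_consCode hθ he hb, ih, List.replicate_succ,
      List.flatMap_cons, List.map_append, List.append_assoc]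

/-- The network of a formula. -/
noncomputable def cnfNet (d W n a : ℕ) (α : CNF) : Net θ d 1 :=
  consCode hθ (h := W) (firstEntry d) firstBias
    ((consCode hθ shiftEntry shiftBias)^[n] ((consCode hθ ampEntry fun _ => 0)^[a]
      (consCode hθ (h := W) negEntry (fun _ => 1) (consCode hθ (h := W) negEntry (fun _ => 1)
        (consCode hθ (h := W) (clauseEntry α) (clauseBias α) (consCode hθ (h := W) conjEntry conjBias
          (.last (codeMatrix hθ 1 W lastEntry) (codeBias hθ 1 fun _ => 0))))))))

theorem firstEntry_lt (d i j : ℕ) : firstEntry d i j < 7 := by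
  unfold firstEntry; split_ifs <;> omega

theorem firstBias_lt (i : ℕ) : firstBias i < 7 := by
  unfold firstBias; split_ifs <;> omega

theorem shiftEntry_lt (i j : ℕ) : shiftEntry i j < 7 := by
  unfold shiftEntry; split_ifs <;> omega

theorem shiftBias_lt (i : ℕ) : shiftBias i < 7 := by
  unfold shiftBias; split_ifs <;> omega

theorem ampEntry_lt (i j : ℕ) : ampEntry i j < 7 := by
  unfold ampEntry; split_ifs <;> omega

theorem negEntry_lt (i j : ℕ) : negEntry i j < 7 := by
  unfold negEntry; split_ifs <;> omega

theorem clauseEntry_lt (α : CNF) (i j : ℕ) : clauseEntry α i j < 7 := by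
  unfold clauseEntry; split
  · omega
  · split_ifs <;> omega

theorem clauseBias_lt (α : CNF) (i : ℕ) : clauseBias α i < 7 := by
  unfold clauseBias; split <;> omega

theorem conjEntry_lt (i j : ℕ) : conjEntry i j < 7 := by
  unfold conjEntry; split_ifs <;> omega

theorem conjBias_lt (i : ℕ) : conjBias i < 7 := by
  unfold conjBias; split_ifs <;> omega

theorem lastEntry_lt (i j : ℕ) : lastEntry i j < 7 := by
  unfold lastEntry; split_ifs <;> omega

theorem encode_cnfNet (d W n a : ℕ) (α : CNF) :
    (cnfNet hθ d W n a α).encode = (netCode d W n a α).map (decLetter hθ) := by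
  have h0 : ∀ _ : ℕ, 0 < 7 := fun _ => by omega
  have h1 : ∀ _ : ℕ, 1 < 7 := fun _ => by omega
  rw [cnfNet, encode_consCode hθ (firstEntry_lt d) firstBias_lt,
    encode_iterate_consCode hθ shiftEntry_lt shiftBias_lt,
    encode_iterate_consCode hθ ampEntry_lt h0,
    encode_consCode hθ negEntry_lt h1, encode_consCode hθ negEntry_lt h1,
    encode_consCode hθ (clauseEntry_lt α) (clauseBias_lt α),
    encode_consCode hθ conjEntry_lt conjBias_lt, Net.encode,
    encodeLayer_code hθ 1 W lastEntry_lt h0]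
  simp only [netCode, List.map_append]

theorem layerCode_lt {e : ℕ → ℕ → ℕ} {b : ℕ → ℕ} (he : ∀ i j, e i j < 7)
    (hb : ∀ i, b i < 7) (h m : ℕ) : ∀ a ∈ layerCode e b h m, a < 9 := by
  intro a ha
  simp only [layerCode, List.mem_append, List.mem_flatMap, List.mem_map, List.mem_cons,
    List.not_mem_nil, or_false] at ha
  rcases ha with ⟨i, -, ⟨j, -, rfl⟩ | rfl | rfl⟩ | rfl
  · exact (he i j).trans (by omega)
  · exact (hb i).trans (by omega)
  · omega
  · omega

theorem netCode_lt (d W n a : ℕ) (α : CNF) : ∀ c ∈ netCode d W n a α, c < 9 := by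
  have h0 : ∀ _ : ℕ, 0 < 7 := fun _ => by omega
  have h1 : ∀ _ : ℕ, 1 < 7 := fun _ => by omega
  intro c hc
  simp only [netCode, List.mem_append, List.mem_flatMap] at hc
  rcases hc with h | ⟨-, -, h⟩ | ⟨-, -, h⟩ | h | h | h | h | h
  · exact layerCode_lt (firstEntry_lt d) firstBias_lt _ _ c h
  · exact layerCode_lt shiftEntry_lt shiftBias_lt _ _ c h
  · exact layerCode_lt ampEntry_lt h0 _ _ c h
  · exact layerCode_lt negEntry_lt h1 _ _ c h
  · exact layerCode_lt negEntry_lt h1 _ _ c h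
  · exact layerCode_lt (clauseEntry_lt α) (clauseBias_lt α) _ _ c h
  · exact layerCode_lt conjEntry_lt conjBias_lt _ _ c h
  · exact layerCode_lt lastEntry_lt h0 _ _ c h

/-- The six layers besides the `n` shifts and `a` amplifications are the first layer, two for the
truncation, one for the clauses, one for the conjunction, and the output layer. -/
theorem depth_cnfNet (d W n a : ℕ) (α : CNF) : (cnfNet hθ d W n a α).depth = n + a + 6 := by
  rw [cnfNet, consCode, Net.depth, depth_iterate_consCode, depth_iterate_consCode]
  simp only [consCode, Net.depth]
  omega

theorem widthAtMost_cnfNet {d W : ℕ} (hd : 1 ≤ d) (hdW : d ≤ W) (n a : ℕ) (α : CNF) :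
    (cnfNet hθ d W n a α).WidthAtMost W := by
  have hW : 1 ≤ W ∧ W ≤ W := ⟨hd.trans hdW, le_rfl⟩
  rw [cnfNet, consCode, Net.WidthAtMost]
  refine ⟨⟨hd, hdW⟩, widthAtMost_iterate_consCode hθ _ _
    (widthAtMost_iterate_consCode hθ _ _ ?_ hW _) hW _⟩
  simp only [consCode, Net.WidthAtMost]
  exact ⟨hW, hW, hW, hW, hW, le_rfl, hW.1⟩

end Build

/-! ### The realization of the network of a formula -/

section Realize

variable {δ : ℝ} (hδ0 : 0 < δ) (hδ1 : δ < 1 / 2)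

theorem sum_range_four {W : ℕ} (hW : 4 ≤ W) {f : ℕ → ℝ} (hf : ∀ j, 4 ≤ j → f j = 0) :
    ∑ j ∈ Finset.range W, f j = f 0 + f 1 + f 2 + f 3 := by
  rw [← Finset.sum_subset (Finset.range_mono hW) fun j _ hj => hf j (by simpa using hj)]
  simp [Finset.sum_range_succ]

theorem sum_range_single {W c : ℕ} (hc : c < W) (f : ℕ → ℝ) (a : ℕ) (e : ℕ → ℕ)
    (he : ∀ j, e j = if c = j then a else 0) :
    ∑ j ∈ Finset.range W, weightVal δ (e j) * f j = weightVal δ a * f c := by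
  rw [Finset.sum_eq_single c]
  · rw [he, if_pos rfl]
  · intro j _ hj
    rw [he, if_neg (Ne.symm hj)]
    simp [weightVal]
  · intro h
    exact absurd (Finset.mem_range.2 hc) h

include hδ0 hδ1 in
-- As `δ < 1 - δ`, at most one of the two ramps is nonzero. The formula holds on all of `ℝ`, not
-- only on the unit interval.
theorem hat_eq (t : ℝ) : hat δ t = 1 - δ⁻¹ * max 0 (δ - t) - δ⁻¹ * max 0 (t - (1 - δ)) := by
  unfold hat
  have h : δ⁻¹ * δ = 1 := inv_mul_cancel₀ hδ0.ne'
  split_ifs with h₁ h₂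
  · rw [max_eq_right (by linarith), max_eq_left (by linarith), div_eq_inv_mul]
    linear_combination h
  · rw [max_eq_left (by linarith), max_eq_left (by linarith)]
    ring
  · rw [max_eq_left (by linarith), max_eq_right (by linarith), div_eq_inv_mul]
    ring

/-- The values of the neurons after `n` applications of the hat function to `t`. -/
structure HatState (δ : ℝ) (W n : ℕ) (t : ℝ) (x : ℕ → ℝ) : Prop where
  zero : x 0 = max 0 (δ - (hat δ)^[n] t)
  one : x 1 = max 0 (δ - (hat δ)^[n] t)
  two : x 2 = max 0 ((hat δ)^[n] t - (1 - δ))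
  three : x 3 = max 0 ((hat δ)^[n] t - (1 - δ))
  pos : ∀ v < n, 4 + 2 * v < W → x (4 + 2 * v) = max 0 (2 * (hat δ)^[n - v] t - 1)
  neg : ∀ v < n, 5 + 2 * v < W → x (5 + 2 * v) = max 0 (1 - 2 * (hat δ)^[n - v] t)

theorem hatState_first {d : ℕ} (hd : 1 ≤ d) (W : ℕ) (x : ℕ → ℝ) :
    HatState δ W 0 (x (d - 1)) (neuron δ (firstEntry d) firstBias d x) := by
  have key : ∀ i a, (∀ j, firstEntry d i j = if d - 1 = j then a else 0) →
      neuron δ (firstEntry d) firstBias d x i =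
        max 0 (weightVal δ a * x (d - 1) + weightVal δ (firstBias i)) := by
    intro i a h
    rw [neuron, sum_range_single (by omega) x a _ h]
  have hj : ∀ j, (j + 1 = d) = (d - 1 = j) := fun j => by
    apply propext; omega
  -- No variable has been recorded yet, so the last two conditions are empty.
  refine ⟨?_, ?_, ?_, ?_, fun v hv => absurd hv (by omega), fun v hv => absurd hv (by omega)⟩
  · rw [key 0 2 fun j => by simp [firstEntry, hj]]
    simp [weightVal, firstBias, sub_eq_add_neg, add_comm]
  · rw [key 1 2 fun j => by simp [firstEntry, hj]]
    simp [weightVal, firstBias, sub_eq_add_neg, add_comm]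
  · rw [key 2 1 fun j => by simp [firstEntry, hj]]
    simp [weightVal, firstBias, sub_eq_add_neg]
  · rw [key 3 1 fun j => by simp [firstEntry, hj]]
    simp [weightVal, firstBias, sub_eq_add_neg]

include hδ0 hδ1 in
-- By `hat_eq` the next iterate is affine in the ramp neurons, hence so are the arguments of the new
-- ramps and of the new pair of literals. The older literals pass through the activation unchanged,
-- being nonnegative, and each variable number grows by one: variable `v` ends up with the iterate
-- of order `n - v`.
theorem HatState.shift {W n : ℕ} (hW : 4 ≤ W) {t : ℝ} {x : ℕ → ℝ} (h : HatState δ W n t x) :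
    HatState δ W (n + 1) t (neuron δ shiftEntry shiftBias W x) := by
  have hs := hat_eq hδ0 hδ1 ((hat δ)^[n] t)
  rw [← Function.iterate_succ_apply' (hat δ)] at hs
  rw [← h.zero, ← h.two] at hs
  have h1 : x 1 = x 0 := h.one.trans h.zero.symm
  have h3 : x 3 = x 2 := h.three.trans h.two.symm
  have four : ∀ i < 6, neuron δ shiftEntry shiftBias W x i =
      max 0 (weightVal δ (shiftEntry i 0) * x 0 + weightVal δ (shiftEntry i 1) * x 1 +
        weightVal δ (shiftEntry i 2) * x 2 + weightVal δ (shiftEntry i 3) * x 3 +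
        weightVal δ (shiftBias i)) := by
    intro i hi
    rw [neuron, sum_range_four hW]
    intro j hj
    have : shiftEntry i j = 0 := by
      unfold shiftEntry; split_ifs <;> omega
    rw [this]
    simp [weightVal]
  have tail : ∀ i, 6 ≤ i → i < W → neuron δ shiftEntry shiftBias W x i = max 0 (x (i - 2)) := by
    intro i hi hiW
    rw [neuron, sum_range_single (c := i - 2) (by omega) x 1]
    · have : shiftBias i = 0 := by unfold shiftBias; split_ifs <;> omega
      rw [this]
      simp [weightVal]
    · intro j
      unfold shiftEntry
      split_ifs <;> omega
  refine ⟨?_, ?_, ?_, ?_, fun v hv hvW => ?_, fun v hv hvW => ?_⟩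
  · rw [four 0 (by omega), hs]; congr 1; simp [shiftEntry, shiftBias, weightVal]; ring
  · rw [four 1 (by omega), hs]; congr 1; simp [shiftEntry, shiftBias, weightVal]; ring
  · rw [four 2 (by omega), hs]; congr 1; simp [shiftEntry, shiftBias, weightVal]; ring
  · rw [four 3 (by omega), hs]; congr 1; simp [shiftEntry, shiftBias, weightVal]; ring
  · cases v with
    | zero =>
      rw [four 4 (by omega), Nat.sub_zero, hs, h1, h3]; congr 1
      simp [shiftEntry, shiftBias, weightVal]; ring
    | succ v =>
      rw [tail _ (by omega) hvW, show 4 + 2 * (v + 1) - 2 = 4 + 2 * v by omega,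
        h.pos v (by omega) (by omega), Nat.add_sub_add_right]
      exact max_eq_right (le_max_left _ _)
  · cases v with
    | zero =>
      rw [four 5 (by omega), Nat.sub_zero, hs, h1, h3]; congr 1
      simp [shiftEntry, shiftBias, weightVal]; ring
    | succ v =>
      rw [tail _ (by omega) hvW, show 5 + 2 * (v + 1) - 2 = 5 + 2 * v by omega,
        h.neg v (by omega) (by omega), Nat.add_sub_add_right]
      exact max_eq_right (le_max_left _ _)

include hδ0 hδ1 in
theorem hatState_iterate {d W : ℕ} (hd : 1 ≤ d) (hW : 4 ≤ W) (x : ℕ → ℝ) (n : ℕ) :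
    HatState δ W n (x (d - 1)) ((neuron δ shiftEntry shiftBias W)^[n]
      (neuron δ (firstEntry d) firstBias d x)) := by
  induction n with
  | zero => exact hatState_first hd W x
  | succ n ih => rw [Function.iterate_succ_apply']; exact ih.shift hδ0 hδ1 hW

theorem neuron_amp {W i : ℕ} (hi : i < W) (x : ℕ → ℝ) :
    neuron δ ampEntry (fun _ => 0) W x i = max 0 (δ⁻¹ * x i) := by
  rw [neuron, sum_range_single hi x 5 (ampEntry i) fun j => rfl]
  simp [weightVal]

include hδ0 in
theorem iterate_neuron_amp {W i : ℕ} (hi : i < W) {x : ℕ → ℝ} (hx : 0 ≤ x i) (a : ℕ) :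
    (neuron δ ampEntry (fun _ => 0) W)^[a] x i = δ⁻¹ ^ a * x i := by
  induction a with
  | zero => simp
  | succ a ih =>
    rw [Function.iterate_succ_apply', neuron_amp hi, ih, max_eq_right (by positivity)]
    ring

theorem neuron_neg {W i : ℕ} (hi : i < W) (x : ℕ → ℝ) :
    neuron δ negEntry (fun _ => 1) W x i = max 0 (1 - x i) := by
  rw [neuron, sum_range_single hi x 2 (negEntry i) fun j => rfl]
  simp [weightVal, sub_eq_add_neg, add_comm]

theorem neuron_nonneg (e : ℕ → ℕ → ℕ) (b : ℕ → ℕ) (m : ℕ) (x : ℕ → ℝ) (i : ℕ) :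
    0 ≤ neuron δ e b m x i := le_max_left _ _

theorem neuron_clause {α : CNF} {i : ℕ} (hi : i < α.length) (W : ℕ) (x : ℕ → ℝ) :
    neuron δ (clauseEntry α) (clauseBias α) W x i =
      max 0 (1 - ∑ j ∈ Finset.range W, if ∃ l ∈ α[i], litIndex l = j then x j else 0) := by
  have hdrop : α.drop i = α[i] :: α.drop (i + 1) := List.drop_eq_getElem_cons hi
  have hb : clauseBias α i = 1 := by rw [clauseBias, hdrop]
  have he : ∀ j, weightVal δ (clauseEntry α i j) * x j =
      -(if ∃ l ∈ α[i], litIndex l = j then x j else 0) := by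
    intro j
    rw [clauseEntry, hdrop]
    simp only [List.any_eq_true, decide_eq_true_eq]
    split_ifs <;> simp [weightVal]
  rw [neuron, hb, Finset.sum_congr rfl fun j _ => he j, Finset.sum_neg_distrib]
  simp [weightVal, sub_eq_add_neg, add_comm]

theorem neuron_clause_of_le {α : CNF} {i : ℕ} (hi : α.length ≤ i) (W : ℕ) (x : ℕ → ℝ) :
    neuron δ (clauseEntry α) (clauseBias α) W x i = 0 := by
  simp [neuron, clauseEntry, clauseBias, List.drop_eq_nil_of_le hi, weightVal]

theorem neuron_conj_zero (W : ℕ) (x : ℕ → ℝ) :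
    neuron δ conjEntry conjBias W x 0 = max 0 (1 - ∑ j ∈ Finset.range W, x j) := by
  simp [neuron, conjEntry, conjBias, weightVal, sub_eq_add_neg, add_comm]

/-- The values of the literals in the network. -/
noncomputable def litNeuron (δ : ℝ) (d W n a : ℕ) (x : ℕ → ℝ) : ℕ → ℝ :=
  neuron δ negEntry (fun _ => 1) W (neuron δ negEntry (fun _ => 1) W
    ((neuron δ ampEntry (fun _ => 0) W)^[a] ((neuron δ shiftEntry shiftBias W)^[n]
      (neuron δ (firstEntry d) firstBias d x))))

theorem realize_cnfNet {θ : Finset ℝ} (hθ : cvWeights δ ⊆ θ) {d W : ℕ} (hW : 1 ≤ W) (n a : ℕ)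
    (α : CNF) (x : ℕ → ℝ) : (cnfNet hθ d W n a α).realize (fun j => x j) 0 =
      max 0 (1 - ∑ i ∈ Finset.range W,
        neuron δ (clauseEntry α) (clauseBias α) W (litNeuron δ d W n a x) i) := by
  rw [cnfNet, realize_consCode, realize_iterate_consCode, realize_iterate_consCode,
    realize_consCode, realize_consCode, realize_consCode, realize_consCode, Net.realize,
    affine_code]
  change ∑ j ∈ Finset.range W, weightVal δ (lastEntry 0 j) * neuron δ conjEntry conjBias W
    (neuron δ (clauseEntry α) (clauseBias α) W (litNeuron δ d W n a x)) j + weightVal δ 0 = _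
  rw [sum_range_single (c := 0) hW _ 1 _ fun j => by simp [lastEntry, eq_comm], neuron_conj_zero]
  simp [weightVal]

/-- The value of a literal at the parameter `t` of the curve. -/
noncomputable def litValue (δ : ℝ) (n : ℕ) (t : ℝ) (l : Literal) : ℝ :=
  if l.2 then 2 * (hat δ)^[n - l.1] t - 1 else 1 - 2 * (hat δ)^[n - l.1] t

include hδ0 hδ1 in
-- For nonnegative arguments, two applications of `x ↦ max 0 (1 - x)` truncate at `1`. The result is
-- the amplified literal cut off at `1`.
theorem litNeuron_eq {d W n : ℕ} (hd : 1 ≤ d) (hW : 4 + 2 * n ≤ W) (a : ℕ) (x : ℕ → ℝ) {l : Literal}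
    (hl : l.1 < n) : litNeuron δ d W n a x (litIndex l) =
      max 0 (1 - max 0 (1 - δ⁻¹ ^ a * max 0 (litValue δ n (x (d - 1)) l))) := by
  have hs := hatState_iterate hδ0 hδ1 hd (show 4 ≤ W by omega) x n
  have hlW : litIndex l < W := by
    unfold litIndex; cases l.2 <;> simp <;> omega
  have hx : (neuron δ shiftEntry shiftBias W)^[n] (neuron δ (firstEntry d) firstBias d x)
      (litIndex l) = max 0 (litValue δ n (x (d - 1)) l) := by
    obtain ⟨v, γ⟩ := l
    cases γ with
    | true => exact hs.pos v hl (by simp only at hl; omega)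
    | false =>
      have := hs.neg v hl (by simp only at hl; omega)
      rw [show 5 + 2 * v = litIndex (v, false) by simp [litIndex]; omega] at this
      simpa [litValue] using this
  rw [litNeuron, neuron_neg hlW, neuron_neg hlW, iterate_neuron_amp hδ0 hlW _ a, hx]
  rw [hx]
  exact le_max_left _ _

theorem litNeuron_nonneg (d W n a : ℕ) (x : ℕ → ℝ) (i : ℕ) : 0 ≤ litNeuron δ d W n a x i :=
  neuron_nonneg _ _ _ _ _

theorem realize_cnfNet_mem {θ : Finset ℝ} (hθ : cvWeights δ ⊆ θ) {d W : ℕ} (hW : 1 ≤ W) (n a : ℕ)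
    (α : CNF) (x : ℕ → ℝ) : 0 ≤ (cnfNet hθ d W n a α).realize (fun j => x j) 0 ∧
      (cnfNet hθ d W n a α).realize (fun j => x j) 0 ≤ 1 := by
  rw [realize_cnfNet hθ hW]
  refine ⟨le_max_left _ _, max_le zero_le_one ?_⟩
  have := Finset.sum_nonneg fun i (_ : i ∈ Finset.range W) =>
    neuron_nonneg (δ := δ) (clauseEntry α) (clauseBias α) W (litNeuron δ d W n a x) i
  linarith

include hδ0 hδ1 in
/-- The network of an unsatisfiable formula vanishes. -/
theorem realize_cnfNet_of_unsat {θ : Finset ℝ} (hθ : cvWeights δ ⊆ θ) {d W n : ℕ} (hd : 1 ≤ d)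
    (hW : 4 + 2 * n ≤ W) (a : ℕ) {α : CNF} (hα : α.length ≤ W) (hv : ∀ C ∈ α, ∀ l ∈ C, l.1 < n)
    (hu : ¬ α.Satisfiable) (x : ℕ → ℝ) : (cnfNet hθ d W n a α).realize (fun j => x j) 0 = 0 := by
  rw [realize_cnfNet hθ (by omega)]
  refine max_eq_left ?_
  by_contra hlt
  -- If the output at `x` were positive, rounding the iterates at `1/2` would satisfy the formula. A
  -- literal that is false under this assignment has value at most `0`.
  refine hu ⟨fun v => decide (1 / 2 < (hat δ)^[n - v] (x (d - 1))), fun C hC => ?_⟩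
  by_contra hne
  push Not at hne
  obtain ⟨i, hi, rfl⟩ := List.getElem_of_mem hC
  refine hlt (sub_nonpos.2 ?_)
  -- A violated clause contributes a full `1` to the sum of violations, which already annihilates
  -- the conjunction.
  refine le_trans (le_of_eq ?_) (Finset.single_le_sum (fun i _ => neuron_nonneg _ _ _ _ i)
    (Finset.mem_range.2 (hi.trans_le hα)))
  rw [neuron_clause hi, Finset.sum_eq_zero, sub_zero, max_eq_right zero_le_one]
  intro j _
  split_ifs with h
  · obtain ⟨l, hl, rfl⟩ := h
    have h0 : max 0 (litValue δ n (x (d - 1)) l) = 0 := by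
      refine max_eq_left ?_
      have := hne l hl
      unfold litValue
      cases hγ : l.2 with
      | true =>
        rw [hγ] at this
        simp only [ne_eq, decide_eq_true_eq, not_lt] at this
        simp only [if_true]
        linarith
      | false =>
        rw [hγ] at this
        simp only [ne_eq, decide_eq_false_iff_not, not_not] at this
        simp only [Bool.false_eq_true, if_false]
        linarith
    rw [litNeuron_eq hδ0 hδ1 hd hW a x (hv _ hC l hl), h0]
    norm_num
  · rfl

include hδ0 hδ1 in
/-- The network of a formula is `1` where the curve is close to a satisfying assignment. -/
theorem realize_cnfNet_of_sat {θ : Finset ℝ} (hθ : cvWeights δ ⊆ θ) {d W n a : ℕ} (hd : 1 ≤ d)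
    (hW : 4 + 2 * n ≤ W) (ha : 1 ≤ δ⁻¹ ^ a * (1 - 2 * δ)) {α : CNF}
    (hv : ∀ C ∈ α, ∀ l ∈ C, l.1 < n) {z : ℕ → Bool}
    (hz : ∀ C ∈ α, ∃ l ∈ C, z l.1 = l.2) {x : ℕ → ℝ}
    (hx : ∀ v < n, |bit (z v) - clamp ((hat δ)^[n - v] (x (d - 1)))| ≤ δ) :
    (cnfNet hθ d W n a α).realize (fun j => x j) 0 = 1 := by
  rw [realize_cnfNet hθ (by omega), Finset.sum_eq_zero, sub_zero, max_eq_right zero_le_one]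
  intro i _
  by_cases hi : i < α.length
  swap
  · exact neuron_clause_of_le (not_lt.1 hi) _ _
  obtain ⟨l, hl, hzl⟩ := hz _ (List.getElem_mem hi)
  have hln := hv _ (List.getElem_mem hi) l hl
  have hlW : litIndex l < W := by
    unfold litIndex; cases l.2 <;> simp <;> omega
  -- Closeness to the bit gives an iterate of at least `1 - δ` or at most `δ`. As `0 < δ < 1/2`,
  -- such a bound on the clamped value passes to the unclamped one.
  have h1 : 1 - 2 * δ ≤ litValue δ n (x (d - 1)) l := by
    have := abs_le.1 (hx l.1 hln)
    unfold litValue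
    generalize (hat δ)^[n - l.1] (x (d - 1)) = h at this
    rw [hzl] at this
    cases hγ : l.2 with
    | true =>
      rw [hγ] at this
      simp only [bit, if_true] at this ⊢
      have hc : 1 - δ ≤ clamp h := by linarith
      rw [clamp, le_max_iff] at hc
      rcases hc with hc | hc
      · linarith
      · linarith [hc.trans (min_le_right _ _)]
    | false =>
      rw [hγ] at this
      simp only [bit, Bool.false_eq_true, if_false] at this ⊢
      have hc : clamp h ≤ δ := by linarith
      have hc' := (le_max_right _ _).trans hc
      rcases min_le_iff.1 hc' with hc' | hc'
      · linarith
      · linarith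
  have h2 : litNeuron δ d W n a x (litIndex l) = 1 := by
    rw [litNeuron_eq hδ0 hδ1 hd hW a x hln]
    -- The amplification pushes the margin `1 - 2 * δ` beyond the truncation level.
    have h3 : 1 ≤ δ⁻¹ ^ a * max 0 (litValue δ n (x (d - 1)) l) :=
      ha.trans (mul_le_mul_of_nonneg_left (h1.trans (le_max_right _ _)) (by positivity))
    rw [max_eq_left (sub_nonpos.2 h3), sub_zero, max_eq_right zero_le_one]
  rw [neuron_clause hi]
  refine max_eq_left (sub_nonpos.2 ?_)
  refine le_trans (le_of_eq ?_) (Finset.single_le_sum (fun j _ => ?_) (Finset.mem_range.2 hlW))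
  · rw [if_pos ⟨l, hl, rfl⟩, h2]
  · split_ifs
    · exact litNeuron_nonneg _ _ _ _ _ _
    · exact le_rfl

theorem curve_succ (n : ℕ) (t : ℝ) (j : Fin (n + 1)) : curve δ (n + 1) t j = (hat δ)^[n - j] t := by
  induction n generalizing t with
  | zero =>
    obtain rfl : j = Fin.last 0 := Fin.ext (by omega)
    rw [curve, Fin.snoc_last]
    rfl
  | succ n ih =>
    refine Fin.lastCases ?_ (fun j => ?_) j
    · simp [curve]
    · rw [curve, Fin.snoc_castSucc, ih, ← Function.iterate_succ_apply, Fin.val_castSucc,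
        Nat.succ_sub (by omega)]

end Realize

/-! ### The integral of the network of a formula -/

section Integral

variable {δ : ℝ} (hδ0 : 0 < δ) (hδ1 : δ < 1 / 2)

theorem Net.continuous_realize {θ : Finset ℝ} {m o : ℕ} (Φ : Net θ m o) : Continuous Φ.realize := by
  induction Φ with
  | last W b => change Continuous (Net.affine W b); unfold Net.affine; fun_prop
  | cons W b rest ih =>
    refine ih.comp (continuous_pi fun i => continuous_const.max ?_)
    unfold Net.affine; fun_prop

/-- The extension of a vector by zeros. -/
theorem exists_extend {d : ℕ} (x : Fin d → ℝ) : ∃ y : ℕ → ℝ, x = fun j : Fin d => y j :=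
  ⟨fun j => if h : j < d then x ⟨j, h⟩ else 0, by ext j; simp⟩

include hδ0 hδ1 in
theorem integral_cnfNet_of_unsat {θ : Finset ℝ} (hθ : cvWeights δ ⊆ θ) {d W n : ℕ} (hd : 1 ≤ d)
    (hW : 4 + 2 * n ≤ W) (a : ℕ) {α : CNF} (hα : α.length ≤ W) (hv : ∀ C ∈ α, ∀ l ∈ C, l.1 < n)
    (hu : ¬ α.Satisfiable) (Ω : Set (Fin d → ℝ)) (μ : Measure (Fin d → ℝ)) :
    ∫ x in Ω, (cnfNet hθ d W n a α).realize x 0 ∂μ = 0 := by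
  rw [integral_congr_ae (g := fun _ => (0 : ℝ)), integral_zero]
  refine .of_forall fun x => ?_
  obtain ⟨y, rfl⟩ := exists_extend x
  exact realize_cnfNet_of_unsat hδ0 hδ1 hθ hd hW a hα hv hu y

theorem cnfNet_mem_unit {θ : Finset ℝ} (hθ : cvWeights δ ⊆ θ) {d W : ℕ} (hW : 1 ≤ W) (n a : ℕ)
    (α : CNF) (x : Fin d → ℝ) : 0 ≤ (cnfNet hθ d W n a α).realize x 0 ∧
      (cnfNet hθ d W n a α).realize x 0 ≤ 1 := by
  obtain ⟨y, rfl⟩ := exists_extend x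
  exact realize_cnfNet_mem hθ hW n a α y

include hδ0 hδ1 in
-- Markov's inequality at level `1`: the network equals `1` on the set `Qset` of a vertex that
-- extends a satisfying assignment, and the mass bound applies to this set.
theorem integral_cnfNet_of_sat {θ : Finset ℝ} (hθ : cvWeights δ ⊆ θ) {d W n a : ℕ} (hd : 1 ≤ d)
    (hn : 1 ≤ n) (hW : 4 + 2 * n ≤ W) (ha : 1 ≤ δ⁻¹ ^ a * (1 - 2 * δ)) {α : CNF}
    (hv : ∀ C ∈ α, ∀ l ∈ C, l.1 < n) (hs : α.Satisfiable) {Ω : Set (Fin d → ℝ)}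
    {μ : Measure (Fin d → ℝ)} [IsProbabilityMeasure μ] {C : ℝ}
    (hC : CurveMassBound δ C Ω μ) :
    C * δ ^ (n + d) ≤ ∫ x in Ω, (cnfNet hθ d W n a α).realize x 0 ∂μ := by
  obtain ⟨z, hz⟩ := hs
  set f : (Fin d → ℝ) → ℝ := fun x => (cnfNet hθ d W n a α).realize x 0 with hf
  have hfc : Continuous f := (continuous_apply (0 : Fin 1)).comp (Net.continuous_realize (cnfNet hθ d W n a α))
  have h01 : ∀ x, 0 ≤ f x ∧ f x ≤ 1 := cnfNet_mem_unit hθ (by omega) n a α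
  -- Only the last coordinate of `x` matters. The curve has `n + 1` components here, and the last of
  -- them, the parameter itself, is not used because each literal comes after at least one
  -- application of the hat function. With the `d - 1` other coordinates this explains the exponent
  -- `n + d`.
  let z' : Fin (n + d) → Bool := fun i => z (i - (d - 1))
  have hQ : Qset δ Ω z' ⊆ Ω ∩ {x | 1 ≤ f x} := by
    rintro x ⟨hxΩ, -, hx⟩
    refine ⟨hxΩ, ?_⟩
    obtain ⟨y, rfl⟩ := exists_extend x
    refine (realize_cnfNet_of_sat hδ0 hδ1 hθ hd hW ha hv hz fun v hvn => ?_).ge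
    have := hx ⟨d - 1 + v, by omega⟩ ⟨d - 1, by omega⟩ ⟨v, by omega⟩ (by simp; omega) rfl
    simp only [z'] at this
    rw [Nat.add_sub_cancel_left, curve_succ] at this
    simpa using this
  have hint : Integrable f (μ.restrict Ω) := by
    refine Integrable.of_bound (C := 1) hfc.aestronglyMeasurable (.of_forall fun x => ?_)
    rw [Real.norm_eq_abs, abs_of_nonneg (h01 x).1]
    exact (h01 x).2
  have hmeas : MeasurableSet {x | 1 ≤ f x} := hfc.measurable measurableSet_Ici
  calc C * δ ^ (n + d) ≤ μ.real (Qset δ Ω z') := hC (n + d) (by omega) z'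
    _ ≤ μ.real (Ω ∩ {x | 1 ≤ f x}) := measureReal_mono hQ
    _ = (μ.restrict Ω).real {x | 1 ≤ f x} := by
      rw [measureReal_def, measureReal_def, Measure.restrict_apply hmeas, Set.inter_comm]
    _ ≤ ∫ x in Ω, f x ∂μ := by
      have := mul_meas_ge_le_integral_of_nonneg (μ := μ.restrict Ω) (f := f)
        (.of_forall fun x => (h01 x).1) hint 1
      rwa [one_mul] at this

end Integral

/-! ### Correctness of the reduction -/

theorem Net.one_le_depth {θ : Finset ℝ} {m o : ℕ} (Φ : Net θ m o) : 1 ≤ Φ.depth := by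
  cases Φ <;> simp [Net.depth]

theorem Net.WidthAtMost.one_le {θ : Finset ℝ} {m o w : ℕ} {Φ : Net θ m o} (h : Φ.WidthAtMost w) :
    1 ≤ w := by
  cases Φ with
  | last W b => exact h.1.1.trans h.1.2
  | cons W b rest => exact h.1.1.trans h.1.2

theorem Net.WidthAtMost.mono {θ : Finset ℝ} {m o w w' : ℕ} {Φ : Net θ m o} (h : Φ.WidthAtMost w)
    (hw : w ≤ w') : Φ.WidthAtMost w' := by
  induction Φ with
  | last W b => exact ⟨⟨h.1.1, h.1.2.trans hw⟩, h.2.1, h.2.2.trans hw⟩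
  | cons W b rest ih => exact ⟨⟨h.1.1, h.1.2.trans hw⟩, ih h.2⟩

theorem inputClass_mono (θ : Finset ℝ) (d k Ct wr Lr : ℕ) :
    Monotone (inputClass θ d k Ct wr Lr) := by
  rintro n n' h Φ ⟨⟨hw, hL⟩, h01⟩
  have hmax : max n d ≤ max n' d := max_le_max_right d h
  exact ⟨⟨hw.mono (Nat.mul_le_mul_left _ hmax), hL.trans (by omega)⟩, h01⟩

namespace RedParams

/-- The parameters of the reduction fit to the width `w` and the depth `L` of a network. -/
structure Fits (P : RedParams) (δ C : ℝ) (w L : ℕ) : Prop where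
  hd : 1 ≤ P.d
  hB : P.B = max 2 (P.Ct * w * P.k)
  hw : 1 ≤ w
  hk : 1 ≤ P.k
  hL : 1 ≤ L
  le_e₁ : P.d + 7 ≤ P.e₁
  a₀_eq : P.a₀ = 3 * L + (P.e₁ - (P.d + 7))
  amp : δ ^ P.a₀ ≤ 1 - 2 * δ
  lower : δ ^ (P.q + 1) ≤ 2⁻¹ ^ P.p
  upper : 2⁻¹ ^ P.p ≤ δ ^ P.q
  lower₀ : C * δ ^ P.e₁ / 2 ≤ 2⁻¹ ^ P.e₀
  upper₀ : 2⁻¹ ^ P.e₀ ≤ C * δ ^ P.d / 2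

theorem exists_fits {d k Ct q w L : ℕ} (hd : 1 ≤ d) (hk : 1 ≤ k) (hCt : 1 ≤ Ct) (hq : 1 ≤ q)
    (hw : 1 ≤ w) (hL : 1 ≤ L) {δ C : ℝ} (hδ0 : 0 < δ) (hδ1 : δ < 1 / 2) (hC : 0 < C) :
    ∃ P : RedParams, P.Fits δ C w L ∧ P.d = d ∧ P.k = k ∧ P.Ct = Ct ∧ P.q = q := by
  have h2 : (0 : ℝ) < 2⁻¹ := by norm_num
  have h2' : (2⁻¹ : ℝ) < 1 := by norm_num
  -- The exponent is `p + 1`: `2⁻¹ ^ (p + 1) < δ ^ q ≤ 2⁻¹ ^ p`, and multiplying the second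
  -- inequality by `δ < 2⁻¹` gives `δ ^ (q + 1) ≤ 2⁻¹ ^ (p + 1)`.
  obtain ⟨p, hp₁, hp₂⟩ := exists_nat_pow_near_of_lt_one (pow_pos hδ0 q)
    (pow_le_one₀ hδ0.le (by linarith)) h2 h2'
  obtain ⟨e₀, he₀⟩ := exists_pow_lt_of_lt_one (show 0 < C * δ ^ d / 2 by positivity) h2'
  -- `J` is a constant reserve of index and depth: it makes the amplification effective and the
  -- error bound smaller than the threshold constant `2⁻¹ ^ e₀`.
  obtain ⟨J, hJ⟩ := exists_pow_lt_of_lt_one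
    (show 0 < min (1 - 2 * δ) (2⁻¹ ^ e₀ * 2 / C) from lt_min (by linarith) (by positivity))
    (show δ < 1 by linarith)
  have hJ₁ := (hJ.trans_le (min_le_left _ _)).le
  have hJ₂ := (hJ.trans_le (min_le_right _ _)).le
  rw [le_div_iff₀ hC] at hJ₂
  refine ⟨⟨d, k, Ct, q, p + 1, e₀, d + 7 + J, max 2 (Ct * w * k), 3 * L + J, hCt, hq⟩,
    ⟨hd, rfl, hw, hk, hL, by simp, by simp, ?_, ?_, hp₁.le, ?_, he₀.le⟩, rfl, rfl, rfl, rfl⟩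
  · refine le_trans ?_ hJ₁
    exact pow_le_pow_of_le_one hδ0.le (by linarith) (Nat.le_add_left _ _)
  · change δ ^ (q + 1) ≤ 2⁻¹ ^ (p + 1)
    rw [pow_succ, pow_succ]
    exact mul_le_mul hp₂ (by linarith) hδ0.le (by positivity)
  · have : δ ^ (d + 7 + J) ≤ δ ^ J :=
      pow_le_pow_of_le_one hδ0.le (by linarith) (Nat.le_add_left _ _)
    change C * δ ^ (d + 7 + J) / 2 ≤ _
    nlinarith

/-- The network to which a formula is mapped. -/
noncomputable def net (P : RedParams) {δ : ℝ} {θ : Finset ℝ} (hθ : cvWeights δ ⊆ θ) (α : CNF) :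
    Net θ P.d 1 :=
  cnfNet hθ P.d (P.B * P.N α) (P.q * P.u α) (P.u α + P.a₀) α

theorem encode_net (P : RedParams) {δ : ℝ} {θ : Finset ℝ} (hθ : cvWeights δ ⊆ θ) (α : CNF) :
    (P.net hθ α).encode = (P.netWord α).map (decLetter hθ) := encode_cnfNet _ _ _ _ _ _

/-! ### Membership in the class and separation by the threshold -/

section Class

variable {P : RedParams} {δ C : ℝ} {w L : ℕ} (hP : P.Fits δ C w L) {θ : Finset ℝ}
  (hθ : cvWeights δ ⊆ θ) (α : CNF)

include hP

theorem le_width : 4 + 2 * (P.q * P.u α) ≤ P.B * P.N α := by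
  have h2 : 2 ≤ P.B := hP.hB ▸ le_max_left _ _
  have hN : P.q * P.u α + 2 ≤ P.N α := by
    have := hP.le_e₁
    unfold N
    rw [Nat.add_mul]
    omega
  calc 4 + 2 * (P.q * P.u α) = 2 * (P.q * P.u α + 2) := by ring
    _ ≤ P.B * P.N α := Nat.mul_le_mul h2 hN

theorem d_le_N : P.d + 7 ≤ P.N α := hP.le_e₁.trans (Nat.le_add_left _ _)

theorem length_le_width : α.length ≤ P.B * P.N α := by
  refine (length_le_blocks P.hCt P.hq α).trans (Nat.mul_le_mul ?_ ?_)
  · rw [hP.hB]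
    refine le_trans ?_ (le_max_right _ _)
    calc P.Ct = P.Ct * 1 * 1 := by ring
      _ ≤ P.Ct * w * P.k := Nat.mul_le_mul (Nat.mul_le_mul_left _ hP.hw) hP.hk
  · change P.q * P.u α ≤ P.N α
    unfold N
    rw [Nat.add_mul]
    omega

/-- By the choice of `a₀` the depth equals the bound of class `N` exactly. As the bound of class `N
- 1` is smaller by one, the network does not belong to it, and the accuracy for index `N` is
guaranteed. -/
theorem net_mem : P.net hθ α ∈ inputClass θ P.d P.k P.Ct w L (P.N α) \
    inputClass θ P.d P.k P.Ct w L (P.N α - 1) := by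
  have hN := d_le_N hP α
  have hw := le_width hP α
  have h2 : 2 ≤ P.B := hP.hB ▸ le_max_left _ _
  have hdepth : (P.net hθ α).depth = P.q * P.u α + (P.u α + P.a₀) + 6 := depth_cnfNet _ _ _ _ _ _
  have hNe : P.N α = P.q * P.u α + P.u α + P.e₁ := by unfold N; ring
  have ha := hP.a₀_eq
  have he := hP.le_e₁
  have hL := hP.hL
  refine ⟨⟨⟨?_, ?_⟩, fun x => cnfNet_mem_unit hθ (by omega) _ _ α x⟩, fun h => ?_⟩
  · rw [max_eq_left (show P.d ≤ P.N α by omega), ← hP.hB]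
    refine widthAtMost_cnfNet hθ hP.hd ?_ _ _ _
    calc P.d ≤ 1 * P.N α := by omega
      _ ≤ P.B * P.N α := Nat.mul_le_mul_right _ (by omega)
  · rw [hdepth, max_eq_left (show P.d ≤ P.N α by omega)]
    omega
  · have := h.1.2
    rw [hdepth, max_eq_left (show P.d ≤ P.N α - 1 by omega)] at this
    omega

variable (hδ0 : 0 < δ)

include hδ0

/-- The inequality `lower` is raised to the number of blocks, and the constants are compared by
`lower₀`. An answer for an unsatisfiable formula thus lies below the threshold. -/
theorem lower_le_threshold (hC : 0 < C) : C * δ ^ P.N α / 2 ≤ 2⁻¹ ^ P.E α := by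
  have h := pow_le_pow_left₀ (by positivity) hP.lower (P.u α)
  unfold N E
  rw [pow_add, pow_mul, pow_add (2⁻¹ : ℝ), pow_mul]
  calc C * ((δ ^ (P.q + 1)) ^ P.u α * δ ^ P.e₁) / 2
      = (δ ^ (P.q + 1)) ^ P.u α * (C * δ ^ P.e₁ / 2) := by ring
    _ ≤ (2⁻¹ ^ P.p) ^ P.u α * 2⁻¹ ^ P.e₀ := mul_le_mul h hP.lower₀ (by positivity) (by positivity)

theorem threshold_le_upper : 2⁻¹ ^ P.E α ≤ C * δ ^ (P.q * P.u α + P.d) / 2 := by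
  have h := pow_le_pow_left₀ (by positivity) hP.upper (P.u α)
  unfold E
  rw [pow_add, pow_mul, pow_add, pow_mul]
  calc (2⁻¹ ^ P.p : ℝ) ^ P.u α * 2⁻¹ ^ P.e₀ ≤ (δ ^ P.q) ^ P.u α * (C * δ ^ P.d / 2) :=
        mul_le_mul h hP.upper₀ (by positivity) (by positivity)
    _ = C * ((δ ^ P.q) ^ P.u α * δ ^ P.d) / 2 := by ring

variable (hC : 0 < C) (hδ1 : δ < 1 / 2) {Ω : Set (Fin P.d → ℝ)} {μ : Measure (Fin P.d → ℝ)}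

include hC hδ1

theorem verdict_of_unsat (hα : ¬ α.Satisfiable) {v : List RatSym} {x : ℝ} (hv : Represents v x)
    (hx : |x - ∫ y in Ω, (P.net hθ α).realize y 0 ∂μ| < C * δ ^ P.N α / 2) :
    verdict v (P.E α) = false := by
  refine verdict_eq_false hv ((abs_lt.1 ?_).2.trans_le (lower_le_threshold hP α hδ0 hC))
  rwa [net, integral_cnfNet_of_unsat hδ0 hδ1 hθ hP.hd (le_width hP α) _ (length_le_width hP α)
    (fun _ hC _ hl => lt_blocks P.hq hC hl) hα, sub_zero] at hx

theorem verdict_of_sat [IsProbabilityMeasure μ] (hμ : CurveMassBound δ C Ω μ)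
    (hα : α.Satisfiable) {v : List RatSym} {x : ℝ} (hv : Represents v x)
    (hx : |x - ∫ y in Ω, (P.net hθ α).realize y 0 ∂μ| < C * δ ^ P.N α / 2) :
    verdict v (P.E α) = true := by
  have hint : C * δ ^ (P.q * P.u α + P.d) ≤ ∫ y in Ω, (P.net hθ α).realize y 0 ∂μ := by
    refine integral_cnfNet_of_sat hδ0 hδ1 hθ hP.hd (Nat.mul_pos P.hq (Nat.succ_pos _))
      (le_width hP α) ?_ (fun _ hC _ hl => lt_blocks P.hq hC hl) hα hμ
    rw [inv_pow, inv_mul_eq_div, one_le_div (by positivity)]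
    exact (pow_le_pow_of_le_one hδ0.le (by linarith) (Nat.le_add_left _ _)).trans hP.amp
  refine verdict_eq_true hv ((threshold_le_upper hP α hδ0).trans ?_)
  -- The error is at most half of the lower bound for the integral, so the answer keeps the other
  -- half, which is at least the threshold.
  have h₁ := (abs_lt.1 hx).1
  have h₂ : δ ^ P.N α ≤ δ ^ (P.q * P.u α + P.d) := by
    refine pow_le_pow_of_le_one hδ0.le (by linarith) ?_
    have := hP.le_e₁
    unfold N
    rw [Nat.add_mul]
    omega
  have h₃ := mul_le_mul_of_nonneg_left h₂ hC.le
  linarith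

end Class

end RedParams

/-! ### The running time of the reduction -/

/-- A finite infimum of natural numbers is attained. The maximum with `0` reflects the truncation in
`ENNReal.ofReal`. -/
theorem ProbTM.exists_halts_of_time_le {I O : Type} {M : ProbTM I O} {w : List I} {b : ℝ}
    (h : ((M.time w : ℕ∞) : ℝ≥0∞) ≤ ENNReal.ofReal b) : ∃ t : ℕ, M.HaltsWithin w t ∧ (t : ℝ) ≤ max b 0 := by
  classical
  by_cases hex : ∃ t, M.HaltsWithin w t
  · have heq : M.time w = (Nat.find hex : ℕ∞) := by
      refine le_antisymm (iInf₂_le _ (Nat.find_spec hex)) (le_iInf₂ fun t ht => ?_)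
      exact_mod_cast Nat.find_min' hex ht
    refine ⟨Nat.find hex, Nat.find_spec hex, ?_⟩
    rw [heq] at h
    have h' := ENNReal.toReal_mono ENNReal.ofReal_ne_top h
    rw [ENNReal.toReal_ofReal'] at h'
    simpa using h'
  · have htop : M.time w = ⊤ := by
      rw [ProbTM.time, iInf₂_eq_top]
      exact fun t ht => absurd ⟨t, ht⟩ hex
    rw [htop] at h
    simp at h

theorem length_encode_le {k Ct n : ℕ} {α : CNF} (hα : α ∈ sparseCNF k Ct n) :
    (CNF.encode α).length ≤ Ct * n * (k * n + 1) := by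
  obtain ⟨hk, hv, hl⟩ := hα
  have hC : ∀ C ∈ α, (Clause.encode C).length ≤ k * n + 1 := by
    intro C hC
    have hlit : ∀ l ∈ C, (Literal.encode l).length ≤ n := fun l hl => by
      have := hv C hC l hl
      simp only [Literal.encode, List.length_append, List.length_replicate, List.length_singleton]
      omega
    rw [Clause.encode, List.length_append, List.length_flatMap, List.length_singleton]
    refine Nat.succ_le_succ ((List.sum_le_card_nsmul _ n ?_).trans ?_)
    · intro m hm
      obtain ⟨l, hl, rfl⟩ := List.mem_map.1 hm
      exact hlit l hl
    · rw [List.length_map, smul_eq_mul]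
      exact Nat.mul_le_mul_right _ (hk C hC)
  rw [CNF.encode, List.length_flatMap]
  refine (List.sum_le_card_nsmul _ (k * n + 1) ?_).trans ?_
  · intro m hm
    obtain ⟨C, hC', rfl⟩ := List.mem_map.1 hm
    exact hC C hC'
  · rw [List.length_map, smul_eq_mul]
    exact Nat.mul_le_mul_right _ hl

theorem eventually_pow_le_two_rpow (m : ℕ) {s : ℝ} (hs : 0 < s) :
    ∀ᶠ n : ℕ in atTop, (n : ℝ) ^ m ≤ (2 : ℝ) ^ (s * n) := by
  have hr : |((2 : ℝ) ^ (-s))| < 1 := by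
    rw [abs_of_pos (by positivity)]
    exact Real.rpow_lt_one_of_one_lt_of_neg one_lt_two (by linarith)
  have := tendsto_pow_const_mul_const_pow_of_abs_lt_one m hr
  filter_upwards [this.eventually (gt_mem_nhds zero_lt_one)] with n hn
  rw [← Real.rpow_natCast ((2 : ℝ) ^ (-s)), ← Real.rpow_mul zero_le_two, neg_mul,
    Real.rpow_neg zero_le_two, ← div_eq_mul_inv, div_lt_one (by positivity)] at hn
  exact hn.le

/-- The overhead of the reduction is negligible. -/
theorem eventually_overhead_le (k Ct e : ℕ) {s : ℝ} (hs : 0 < s) : ∀ᶠ n : ℕ in atTop,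
    ∀ l ≤ Ct * n * (k * n + 1), ((11 * l + 17 + 27 * (8 * l + 3) ^ e : ℕ) : ℝ) ≤ (2 : ℝ) ^ (s * n) := by
  filter_upwards [eventually_pow_le_two_rpow (3 * (e + 1) + 1) hs,
    eventually_ge_atTop (8 * (Ct * (k + 1)) + 55)] with n hn hn' l hl
  refine le_trans ?_ hn
  have h1 : 1 ≤ n := by omega
  have h₁ : 8 * l + 3 ≤ n ^ 3 := by
    have : l ≤ Ct * (k + 1) * n ^ 2 := hl.trans (by nlinarith [Nat.zero_le (Ct * n)])
    calc 8 * l + 3 ≤ (8 * (Ct * (k + 1)) + 3) * n ^ 2 := by nlinarith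
      _ ≤ n * n ^ 2 := Nat.mul_le_mul_right _ (by omega)
      _ = n ^ 3 := by ring
  have h₂ : (8 * l + 3) ^ e ≤ (8 * l + 3) ^ (e + 1) := Nat.pow_le_pow_right (by omega) (by omega)
  have h₃ : 8 * l + 3 ≤ (8 * l + 3) ^ (e + 1) := Nat.le_self_pow (by omega) _
  have h₄ : (8 * l + 3) ^ (e + 1) ≤ n ^ (3 * (e + 1)) := by
    rw [pow_mul]
    exact Nat.pow_le_pow_left h₁ _
  -- The additional factor `n` absorbs all constants.
  have h₅ : 50 * n ^ (3 * (e + 1)) ≤ n ^ (3 * (e + 1) + 1) := by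
    rw [pow_succ, mul_comm]
    exact Nat.mul_le_mul_left _ (by omega)
  exact_mod_cast (show 11 * l + 17 + 27 * (8 * l + 3) ^ e ≤ n ^ (3 * (e + 1) + 1) by omega)

theorem ProbTM.worstTime_le {I O : Type} {M : ProbTM I O} {X : Set (List I)} {b : ℝ} (hb : 0 ≤ b)
    (h : ∀ w ∈ X, ∃ t : ℕ, M.HaltsWithin w t ∧ (t : ℝ) ≤ b) :
    ((M.worstTime X : ℕ∞) : ℝ≥0∞) ≤ ENNReal.ofReal b := by
  have hle : M.worstTime X ≤ (⌊b⌋₊ : ℕ∞) := by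
    refine iSup₂_le fun w hw => ?_
    obtain ⟨t, ht, htb⟩ := h w hw
    refine (iInf₂_le t ht).trans ?_
    exact_mod_cast Nat.le_floor htb
  calc ((M.worstTime X : ℕ∞) : ℝ≥0∞) ≤ ((⌊b⌋₊ : ℕ∞) : ℝ≥0∞) := by exact_mod_cast hle
    _ = ENNReal.ofReal (⌊b⌋₊ : ℝ) := by simp
    _ ≤ ENNReal.ofReal b := ENNReal.ofReal_le_ofReal (Nat.floor_le hb)

/-- The classes increase with `n`, so the networks of class `n` are treated as members of class `n₀
+ n`. This turns the asymptotic bound into one for all `n`, at the price of the factor `2 ^ (t *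
n₀)`. -/
theorem exists_halts_of_isBigO {θ : Finset ℝ} {d k Ct w L : ℕ} {A : ProbTM (NetSym θ) RatSym} {t : ℝ}
    (hA : IsBigOTwoPow
      (fun n => A.worstTime (Net.encode '' inputClass θ d k Ct w L n)) t) :
    ∃ K : ℝ, 0 ≤ K ∧ ∀ n, ∀ Φ ∈ inputClass θ d k Ct w L n,
      ∃ T : ℕ, A.HaltsWithin Φ.encode T ∧ (T : ℝ) ≤ K * 2 ^ (t * (n : ℝ)) := by
  obtain ⟨c, hc⟩ := hA
  obtain ⟨n₀, hn₀⟩ := eventually_atTop.1 hc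
  refine ⟨max c 0 * 2 ^ (t * (n₀ : ℝ)), by positivity, fun n Φ hΦ => ?_⟩
  have hmem := inputClass_mono θ d k Ct w L (Nat.le_add_left n n₀) hΦ
  have hle : ((A.time Φ.encode : ℕ∞) : ℝ≥0∞) ≤
      ENNReal.ofReal (c * 2 ^ (t * ((n₀ + n : ℕ) : ℝ))) := by
    refine le_trans ?_ (hn₀ (n₀ + n) (Nat.le_add_right _ _))
    have : A.time Φ.encode ≤ A.worstTime (Net.encode '' inputClass θ d k Ct w L (n₀ + n)) :=
      le_iSup₂ (f := fun v _ => A.time v) Φ.encode (Set.mem_image_of_mem _ hmem)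
    exact_mod_cast this
  obtain ⟨T, hT, hTb⟩ := ProbTM.exists_halts_of_time_le hle
  refine ⟨T, hT, hTb.trans (max_le ?_ (by positivity))⟩
  rw [Nat.cast_add, mul_add, Real.rpow_add two_pos, mul_assoc]
  exact mul_le_mul_of_nonneg_right (le_max_left _ _) (by positivity)

/-- A quadrature algorithm with running time `O(2 ^ (t n))` yields a decision algorithm with running
time `O(2 ^ (t (1 + 1 / q) n))`. -/
theorem sTilde_le_of_fits {P : RedParams} {δ C : ℝ} {w L : ℕ} (hP : P.Fits δ C w L) {θ : Finset ℝ}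
    (hθ : cvWeights δ ⊆ θ) (hδ0 : 0 < δ) (hδ1 : δ < 1 / 2) (hC : 0 < C)
    {Ω : Set (Fin P.d → ℝ)} {μ : Measure (Fin P.d → ℝ)} [IsProbabilityMeasure μ]
    (hμ : CurveMassBound δ C Ω μ) {A : ProbTM (NetSym θ) RatSym}
    (hA : ∀ n : ℕ, 1 ≤ n → ∀ Φ ∈ inputClass θ P.d P.k P.Ct w L n \
        inputClass θ P.d P.k P.Ct w L (n - 1),
      ApproximatesAt A Φ.encode (∫ x in Ω, Φ.realize x 0 ∂μ) (C * δ ^ n / 2))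
    {t : ℝ} (ht : 0 < t)
    (hT : IsBigOTwoPow (fun n => A.worstTime (Net.encode '' inputClass θ P.d P.k P.Ct w L n)) t) :
    sTilde P.k P.Ct ≤ t * (1 + 1 / P.q) := by
  obtain ⟨pt, e, hR⟩ := P.pt_reduce
  obtain ⟨K, hK, hhalt⟩ := exists_halts_of_isBigO hT
  have hq : (0 : ℝ) < P.q := by exact_mod_cast P.hq
  have hs : 0 < t * (1 + 1 / P.q) := by positivity
  have hword : ∀ α, ((P.netWord α).reverse.reverse.map (decLetter hθ)) =
      (P.net hθ α).encode := fun α => by rw [List.reverse_reverse, RedParams.encode_net]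
  have hlt : ∀ α, ∀ a ∈ (P.netWord α).reverse, a < 9 := fun α a ha =>
    netCode_lt _ _ _ _ _ a (List.mem_reverse.1 ha)
  have happ : ∀ α, 2 / 3 ≤ A.prob (P.net hθ α).encode {v | ∃ x : ℝ, Represents v x ∧
      |x - ∫ y in Ω, (P.net hθ α).realize y 0 ∂μ| < C * δ ^ P.N α / 2} := fun α =>
    hA (P.N α) (by have := RedParams.d_le_N hP α; omega) _ (RedParams.net_mem hP hθ α)
  have hruns : ∀ α : CNF, α.IsKCNF P.k → ∀ T, A.HaltsWithin (P.net hθ α).encode T →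
      ∃ n ≤ 11 * α.encode.length + 17 + 27 * (8 * α.encode.length + 3) ^ e + (1 + 12 * A.growth) * T,
        (redMachine A (decLetter hθ) pt).HaltsWithin α.encode n := by
    intro α hα T hTα
    have hred := P.reduce_encode hα
    obtain ⟨n, hn, hh⟩ := halts_redMachine A (decLetter hθ) pt hR hred (hlt α) (t := T)
      (by rwa [hword])
    refine ⟨n, hn.trans ?_, hh⟩
    have hsz := (hR (revCode α.encode)).1
    rw [hred] at hsz
    simp only [esize_some, esize_pair, esize_nat] at hsz
    have h₁ := length_lt_esize (P.netWord α).reverse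
    have h₂ : (esize (revCode α.encode) + 2) ^ e ≤ (8 * α.encode.length + 3) ^ e :=
      Nat.pow_le_pow_left (by have := esize_revCode_le α.encode; omega) e
    have h₃ : (1 + 12 * A.growth) * T = T + 12 * (A.growth * T) := by ring
    omega
  refine csInf_le ⟨0, fun s hs => hs.1.le⟩ ⟨hs, redMachine A (decLetter hθ) pt,
    ⟨fun α hα => ⟨?_, fun hsat => ?_, fun hunsat => ?_⟩, fun v hv => ?_⟩, ?_⟩
  · obtain ⟨T, hTα, -⟩ := hhalt _ _ (RedParams.net_mem hP hθ α).1
    obtain ⟨n, -, hn⟩ := hruns α hα T hTα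
    exact ⟨n, hn⟩
  · refine (happ α).trans ?_
    rw [← hword]
    refine prob_le_redMachine A (decLetter hθ) pt hR (P.reduce_encode hα) (hlt α) ?_
    rintro v ⟨x, hv, hx⟩
    exact RedParams.verdict_of_sat hP hθ α hδ0 hC hδ1 hμ hsat hv hx
  · refine (happ α).trans ?_
    rw [← hword]
    refine prob_le_redMachine A (decLetter hθ) pt hR (P.reduce_encode hα) (hlt α) ?_
    rintro v ⟨x, hv, hx⟩
    exact RedParams.verdict_of_unsat hP hθ α hδ0 hC hδ1 hunsat hv hx
  -- The empty output is neither of the two answers, so an invalid word is accepted with probability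
  -- `0`.
  · rw [redMachine_reject A (decLetter hθ) pt hR (P.reduce_eq_none hv) _ (by simp)]
    exact zero_le
  · refine ⟨1 + (1 + 12 * A.growth) * (K * 2 ^ (t * (P.q + 1 + P.e₁ : ℝ))), ?_⟩
    filter_upwards [eventually_overhead_le P.k P.Ct e hs] with n hn
    refine ProbTM.worstTime_le (by positivity) ?_
    rintro _ ⟨α, hα, rfl⟩
    have hN : P.N α ≤ (P.q + 1) * (n / P.q + 1) + P.e₁ :=
      Nat.add_le_add_right (Nat.mul_le_mul_left _ (blocks_le P.hCt hα)) _
    obtain ⟨T, hTα, hTb⟩ := hhalt _ _ (RedParams.net_mem hP hθ α).1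
    obtain ⟨m, hm, hh⟩ := hruns α hα.1 T hTα
    refine ⟨m, hh, ?_⟩
    -- One extra index per block of `q` variables yields the factor `1 + 1 / q`; rounding and `e₁`
    -- are constants.
    have hNr : (P.N α : ℝ) ≤ (1 + 1 / P.q) * n + (P.q + 1 + P.e₁) := by
      have hdiv : ((n / P.q : ℕ) : ℝ) ≤ n / P.q := Nat.cast_div_le
      calc (P.N α : ℝ) ≤ (P.q + 1) * ((n / P.q : ℕ) + 1) + P.e₁ := by exact_mod_cast hN
        _ ≤ (P.q + 1) * (n / P.q + 1) + P.e₁ := by gcongr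
        _ = _ := by field_simp; ring
    have hTb' : (T : ℝ) ≤ K * 2 ^ (t * (P.q + 1 + P.e₁ : ℝ)) * 2 ^ (t * (1 + 1 / P.q) * n) := by
      refine hTb.trans ?_
      rw [mul_assoc, ← Real.rpow_add two_pos]
      refine mul_le_mul_of_nonneg_left (Real.rpow_le_rpow_of_exponent_le one_le_two ?_) hK
      calc t * (P.N α : ℝ) ≤ t * ((1 + 1 / P.q) * n + (P.q + 1 + P.e₁)) := by gcongr
        _ = _ := by ring
    have hover := hn _ (length_encode_le hα)
    calc (m : ℝ) ≤ ((11 * α.encode.length + 17 + 27 * (8 * α.encode.length + 3) ^ e : ℕ) : ℝ) +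
          (1 + 12 * A.growth) * T := by exact_mod_cast hm
      _ ≤ 2 ^ (t * (1 + 1 / P.q) * n) + (1 + 12 * A.growth) *
          (K * 2 ^ (t * (P.q + 1 + P.e₁ : ℝ)) * 2 ^ (t * (1 + 1 / P.q) * n)) := by gcongr
      _ = _ := by ring

/-- The lower bound for the running time of quadrature algorithms. -/
theorem sTilde_le {d k Ct w L : ℕ} (hd : 1 ≤ d) (hk : 1 ≤ k) (hCt : 1 ≤ Ct) (hw : 1 ≤ w) (hL : 1 ≤ L)
    {δ C : ℝ} {θ : Finset ℝ} (hθ : cvWeights δ ⊆ θ) (hδ0 : 0 < δ) (hδ1 : δ < 1 / 2) (hC : 0 < C)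
    {Ω : Set (Fin d → ℝ)} {μ : Measure (Fin d → ℝ)} [IsProbabilityMeasure μ]
    (hμ : CurveMassBound δ C Ω μ) {A : ProbTM (NetSym θ) RatSym}
    (hA : ∀ n : ℕ, 1 ≤ n → ∀ Φ ∈ inputClass θ d k Ct w L n \ inputClass θ d k Ct w L (n - 1),
      ApproximatesAt A Φ.encode (∫ x in Ω, Φ.realize x 0 ∂μ) (C * δ ^ n / 2))
    {t : ℝ} (ht : 0 < t)
    (hT : IsBigOTwoPow (fun n => A.worstTime (Net.encode '' inputClass θ d k Ct w L n)) t) :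
    sTilde k Ct ≤ t := by
  -- The same algorithm `A` is used for every block length `q + 1`; in the limit the loss in the
  -- exponent disappears.
  have hq : ∀ q : ℕ, sTilde k Ct ≤ t * (1 + 1 / ((q : ℝ) + 1)) := by
    intro q
    obtain ⟨P, hP, rfl, rfl, rfl, hPq⟩ :=
      RedParams.exists_fits hd hk hCt (Nat.succ_pos q) hw hL hδ0 hδ1 hC
    have := sTilde_le_of_fits hP hθ hδ0 hδ1 hC hμ hA ht hT
    rw [hPq] at this
    exact_mod_cast this
  refine ge_of_tendsto' (f := fun q : ℕ => t * (1 + 1 / ((q : ℝ) + 1))) (x := atTop) ?_ hq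
  simpa using (tendsto_one_div_add_atTop_nhds_zero_nat (𝕜 := ℝ)).const_add 1 |>.const_mul t

/-! ### The mass bound for Lebesgue measure -/

section Lebesgue

variable {δ : ℝ} (hδ0 : 0 < δ) (hδ1 : δ < 1 / 2)

/-- The parameters at which the curve is close to the vertex `z`. -/
def curveSet (δ : ℝ) (m : ℕ) (z : ℕ → Bool) : Set ℝ :=
  {t | (0 ≤ t ∧ t ≤ 1) ∧ ∀ j : Fin m, |bit (z j) - clamp (curve δ m t j)| ≤ δ}

theorem clamp_of_mem {t : ℝ} (h₀ : 0 ≤ t) (h₁ : t ≤ 1) : clamp t = t := by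
  rw [clamp, min_eq_right h₁, max_eq_right h₀]

theorem mem_curveSet_succ {m : ℕ} {z : ℕ → Bool} {t : ℝ} (h₀ : 0 ≤ t) (h₁ : t ≤ 1)
    (hz : |bit (z m) - t| ≤ δ) (h : hat δ t ∈ curveSet δ m z) : t ∈ curveSet δ (m + 1) z := by
  refine ⟨⟨h₀, h₁⟩, Fin.lastCases ?_ fun j => ?_⟩
  · rwa [curve, Fin.snoc_last, clamp_of_mem h₀ h₁]
  · rw [curve, Fin.snoc_castSucc]
    exact h.2 j

include hδ0 hδ1

/-- The last bit selects a branch: on `[0, δ]` the parameter is close to `0`, and the hat function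
is `t ↦ δ⁻¹ * t`, onto `[0, 1]`. -/
theorem preimage_subset_curveSet_false {m : ℕ} {z : ℕ → Bool} (hz : z m = false) :
    (δ⁻¹ * ·) ⁻¹' curveSet δ m z ⊆ curveSet δ (m + 1) z := by
  intro t ht
  have h₀ : 0 ≤ t := (mul_nonneg_iff_of_pos_left (inv_pos.2 hδ0)).1 ht.1.1
  have h₁ : t ≤ δ := (inv_mul_le_one₀ hδ0).1 ht.1.2
  refine mem_curveSet_succ h₀ (by linarith) ?_ ?_
  · rw [hz, bit, if_neg (by simp), zero_sub, abs_neg, abs_of_nonneg h₀]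
    exact h₁
  · rw [hat, if_pos h₁, div_eq_inv_mul]
    exact ht

/-- On `[1 - δ, 1]` the hat function is the mirror image `t ↦ δ⁻¹ * (1 - t)` of the first branch. -/
theorem preimage_subset_curveSet_true {m : ℕ} {z : ℕ → Bool} (hz : z m = true) :
    (fun t => 1 - t) ⁻¹' ((δ⁻¹ * ·) ⁻¹' curveSet δ m z) ⊆ curveSet δ (m + 1) z := by
  intro t ht
  have h₀ : 0 ≤ 1 - t := (mul_nonneg_iff_of_pos_left (inv_pos.2 hδ0)).1 ht.1.1
  have h₁ : 1 - t ≤ δ := (inv_mul_le_one₀ hδ0).1 ht.1.2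
  refine mem_curveSet_succ (by linarith) (by linarith) ?_ ?_
  · rw [hz, bit, if_pos rfl, abs_of_nonneg h₀]
    exact h₁
  · have heq : hat δ t = δ⁻¹ * (1 - t) := by
      have hinv : δ⁻¹ * δ = 1 := inv_mul_cancel₀ hδ0.ne'
      rw [hat_eq hδ0 hδ1, max_eq_left (by linarith), max_eq_right (by linarith)]
      linear_combination -hinv
    rw [heq]
    exact ht

/-- Pulling back along an affine branch of slope `±δ⁻¹` scales lengths by `δ`, once for each bit.
The induction starts from the whole unit interval. -/
theorem pow_le_volume_curveSet (m : ℕ) (z : ℕ → Bool) :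
    ENNReal.ofReal δ ^ m ≤ volume (curveSet δ m z) := by
  induction m with
  | zero =>
    have : Set.Icc (0 : ℝ) 1 ⊆ curveSet δ 0 z := fun t ht => ⟨ht, fun j => j.elim0⟩
    simpa using measure_mono (μ := volume) this
  | succ m ih =>
    have hpre : volume ((δ⁻¹ * ·) ⁻¹' curveSet δ m z) =
        ENNReal.ofReal δ * volume (curveSet δ m z) := by
      rw [Real.volume_preimage_mul_left (inv_ne_zero hδ0.ne'), inv_inv, abs_of_pos hδ0]
    rw [pow_succ']
    refine (mul_le_mul_right ih _).trans (hpre.ge.trans ?_)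
    cases hz : z m with
    | false => exact measure_mono (preimage_subset_curveSet_false hδ0 hδ1 hz)
    | true =>
      refine le_trans (le_of_eq ?_) (measure_mono (preimage_subset_curveSet_true hδ0 hδ1 hz))
      -- The reflection is treated as a measurable equivalence, for which no measurability of
      -- `curveSet` is needed.
      exact ((Measure.measurePreserving_sub_left volume (1 : ℝ)).measure_preimage_equiv
        (f := MeasurableEquiv.subLeft 1) _).symm

/-- The set contains a product: each of the first `d - 1` factors carries one bit, and the last one
carries the remaining `n - d + 1` bits along the curve. -/
theorem pow_le_volume_Qset {d n : ℕ} (hd : 1 ≤ d) (hn : d < n) {Ω : Set (Fin d → ℝ)}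
    (hΩ : Set.Icc 0 1 ⊆ Ω) (z : Fin n → Bool) :
    ENNReal.ofReal δ ^ n ≤ volume (Qset δ Ω z) := by
  obtain ⟨z', rfl⟩ : ∃ z' : ℕ → Bool, z = fun i : Fin n => z' i :=
    ⟨fun i => if h : i < n then z ⟨i, h⟩ else false, by ext i; simp⟩
  -- A single coordinate is the curve with one component, so `curveSet` with `m = 1` covers the
  -- first factors.
  let S : Fin d → Set ℝ := fun l => if (l : ℕ) + 1 < d then curveSet δ 1 (fun _ => z' l) else
    curveSet δ (n - d + 1) fun j => z' (l + j)
  have hS : ∀ l, S l ⊆ Set.Icc 0 1 := fun l t ht => by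
    simp only [S] at ht
    split_ifs at ht
    · exact ht.1
    · exact ht.1
  have hsub : Set.univ.pi S ⊆ Qset δ Ω fun i : Fin n => z' i := by
    intro x hx
    refine ⟨hΩ ⟨fun l => (hS l (hx l trivial)).1, fun l => (hS l (hx l trivial)).2⟩, ?_, ?_⟩
    · intro i l hl hil
      have := hx l trivial
      simp only [S, if_pos hl] at this
      have h0 := this.2 0
      rw [curve_succ] at h0
      simpa [hil] using h0
    · intro i l j hl hil
      have := hx l trivial
      simp only [S, if_neg (show ¬ (l : ℕ) + 1 < d by omega)] at this
      have hj := this.2 j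
      simpa only [hil] using hj
  refine le_trans ?_ (measure_mono hsub)
  rw [volume_pi_pi]
  obtain ⟨d, rfl⟩ := Nat.exists_eq_add_of_le' hd
  rw [Fin.prod_univ_castSucc]
  have hpow : ENNReal.ofReal δ ^ n = (∏ _l : Fin d, ENNReal.ofReal δ ^ 1) *
      ENNReal.ofReal δ ^ (n - (d + 1) + 1) := by
    rw [Finset.prod_const, Finset.card_univ, Fintype.card_fin, ← pow_mul, ← pow_add]
    congr 1
    omega
  rw [hpow]
  refine mul_le_mul' (Finset.prod_le_prod' fun l _ => ?_) ?_
  · simp only [S, Fin.val_castSucc, if_pos (show (l : ℕ) + 1 < d + 1 by omega)]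
    exact pow_le_volume_curveSet hδ0 hδ1 _ _
  · simp only [S, Fin.val_last, lt_irrefl, if_false]
    exact pow_le_volume_curveSet hδ0 hδ1 _ _

omit hδ0 hδ1 in
theorem one_le_volume {d : ℕ} {Ω : Set (Fin d → ℝ)} (hΩ : Set.Icc 0 1 ⊆ Ω) : 1 ≤ volume Ω := by
  refine le_trans (le_of_eq ?_) (measure_mono hΩ)
  simp [Real.volume_Icc_pi]

theorem curveMassBound_lebesgue {d : ℕ} (hd : 1 ≤ d) {Ω : Set (Fin d → ℝ)} (hm : MeasurableSet Ω)
    (hΩ : Set.Icc 0 1 ⊆ Ω) (hfin : volume Ω ≠ ⊤) :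
    CurveMassBound δ (volume.real Ω)⁻¹ Ω ((volume Ω)⁻¹ • (volume.restrict Ω)) := by
  intro n hn z
  have hsub : Qset δ Ω z ⊆ Ω := fun x hx => hx.1
  rw [measureReal_def, measureReal_def, Measure.smul_apply, Measure.restrict_apply' hm,
    Set.inter_eq_left.2 hsub, smul_eq_mul, ENNReal.toReal_mul, ENNReal.toReal_inv]
  refine mul_le_mul_of_nonneg_left ?_ (by positivity)
  have := ENNReal.toReal_mono (measure_ne_top_of_subset hsub hfin)
    (pow_le_volume_Qset hδ0 hδ1 hd hn hΩ z)
  rwa [ENNReal.toReal_pow, ENNReal.toReal_ofReal hδ0.le] at this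

end Lebesgue

end NNQuad

theorem theorem3p20
    (d k : ℕ) (hd : 1 ≤ d) (hk : 1 ≤ k)
    -- the constant in the linear bound on the number of clauses
    (Ct : ℕ) (hCt : 1 ≤ Ct)
    (δ : ℝ) (hδ0 : 0 < δ) (hδ1 : δ < 1 / 2)
    -- the network `Ψ` and its realization `r`
    (wr Lr : ℕ) (θr : Finset ℝ) (Ψ : Net θr 1 1) (hΨ : Ψ ∈ netClass θr 1 wr Lr)
    (r : ℝ → ℝ) (hr01 : ∀ x, 0 ≤ r x ∧ r x ≤ 1) (hrc : Continuous r)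
    (hr0 : ∀ x, x ≤ 1 / 2 → r x = 0) (hr1 : ∀ x, 1 - δ ≤ x → r x = 1)
    (hΨr : ∀ x : ℝ, Ψ.realize (fun _ => x) 0 = r x)
    -- the finite sets of weights
    (θCNF θCV : Finset ℝ) (hCNF : cnfWeights k θr ⊆ θCNF) (hCV : cvWeights δ ⊆ θCV) :
    (∀ (Ω : Set (Fin d → ℝ)) (μ : Measure (Fin d → ℝ)) (C : ℝ),
      MeasurableSet Ω → Set.Icc 0 1 ⊆ Ω → IsProbabilityMeasure μ → μ Ω = 1 →
      0 < C → CurveMassBound δ C Ω μ →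
      ∀ A : ProbTM (NetSym (θCNF ∪ θCV)) RatSym,
        (∀ n : ℕ, 1 ≤ n →
          ∀ Φ ∈ inputClass (θCNF ∪ θCV) d k Ct wr Lr n \
              inputClass (θCNF ∪ θCV) d k Ct wr Lr (n - 1),
            ApproximatesAt A Φ.encode (∫ x in Ω, Φ.realize x 0 ∂μ) (C * δ ^ n / 2)) →
        ∀ t : ℝ, 0 < t →
          IsBigOTwoPow
            (fun n => A.worstTime
              (Net.encode '' inputClass (θCNF ∪ θCV) d k Ct wr Lr n)) t →
          sTilde k Ct ≤ t) ∧
    -- normalized Lebesgue measure: one can take `C = |Ω|⁻¹`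
    (∀ Ω : Set (Fin d → ℝ), MeasurableSet Ω → Set.Icc 0 1 ⊆ Ω → volume Ω ≠ ⊤ →
      IsProbabilityMeasure ((volume Ω)⁻¹ • (volume.restrict Ω)) ∧
      ((volume Ω)⁻¹ • (volume.restrict Ω)) Ω = 1 ∧
      0 < (volume.real Ω)⁻¹ ∧
      CurveMassBound δ (volume.real Ω)⁻¹ Ω ((volume Ω)⁻¹ • (volume.restrict Ω))) := by
  have hθ : cvWeights δ ⊆ ((θCNF ∪ θCV : Finset ℝ) : Set ℝ) := fun x hx => by
    rw [Finset.coe_union]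
    exact Or.inr (hCV hx)
  refine ⟨fun Ω μ C _ _ _ _ hC hμ A hA t ht hT => ?_, fun Ω hm hΩ hfin => ?_⟩
  · exact sTilde_le hd hk hCt hΨ.1.one_le (Ψ.one_le_depth.trans hΨ.2) hθ hδ0 hδ1 hC hμ hA ht hT
  · have h1 := one_le_volume hΩ
    have h0 : volume Ω ≠ 0 := (zero_lt_one.trans_le h1).ne'
    have hone : ((volume Ω)⁻¹ • (volume.restrict Ω)) Ω = 1 := by
      rw [Measure.smul_apply, Measure.restrict_apply_self, smul_eq_mul,
        ENNReal.inv_mul_cancel h0 hfin]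
    refine ⟨⟨?_⟩, hone, inv_pos.2 (ENNReal.toReal_pos h0 hfin),
      curveMassBound_lebesgue hδ0 hδ1 hd hm hΩ hfin⟩
    rw [← hone, Measure.smul_apply, Measure.smul_apply, Measure.restrict_apply_univ,
      Measure.restrict_apply_self]
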